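/- Let $(X_i,Y_i)$, $i\ge 1$, be i.i.d. observations from the model $Y=m(X)+\sigma(X)\varepsilon$, where $X$ has a density $f$ and $\varepsilon$ is independent of $X$ with mean $0$ and variance $1$. Let $K$ be a symmetric probability density with compact support and $\int K^2<\infty$. Fix $x\in\mathbb R$ and assume: $m''$ exists near $x$, is bounded there and is continuous at $x$; $f(x)>0$ and $|f(x)-f(y)|\le c|x-y|^{\alpha}$ for $y$ near $x$, for some constants $c$ and $0<\alpha<1$; $\sigma^2$ is bounded near $x$ and continuous at $x$. Let $h=h_n>0$ satisfy $h\to0$ and $nh\to\infty$ as $n\to\infty$. Write $K_h(t)=K(t/h)/h$, $S_{n,l}(z)=h\sum_{i=1}^n(z-X_i)^lK_h(z-X_i)$, $T_{n,l}(z)=h\sum_{i=1}^n(z-X_i)^lK_h(z-X_i)Y_i$, and let $$\hat m(z)=\frac{S_{n,2}(z)T_{n,0}(z)-S_{n,1}(z)T_{n,1}(z)}{S_{n,0}(z)S_{n,2}(z)-S_{n,1}(z)^2+n^{-2}}$$ be the local linear estimator (with $n^{-2}$ added to the denominator so that its unconditional moments exist). For constants $\delta>0$ and $r\in(-1,1)$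 let $$\tilde m_q(x)=\sum_{j=0}^{2}A_j(r)\,\hat m\bigl(x-(r+1-j)\delta h\bigr),\quad A_0(r)=\tfrac{r(r-1)}2,\ A_1(r)=1-r^2,\ A_2(r)=\tfrac{r(r+1)}2 .$$ Put $\nu_{20}=\int s^2K(s)\,ds$, $\nu_{02}=\int K(s)^2\,ds$ and $\tilde\nu_{02}=\int\bigl\{\sum_{i=0}^{2}A_i(r)K(s+i\delta)\bigr\}^2ds$. Then, for all large $n$, $\hat m(x)$ and $\tilde m_q(x)$ have finite second moments, and as $n\to\infty$ $$\mathbb E\{\tilde m_q(x)\}-m(x)=\tfrac12m''(x)\nu_{20}h^2+o\{h^2+(nh)^{-1/2}\},$$ and the same expansion holds for $\mathbb E\{\hat m(x)\}-m(x)$; moreover $$\operatorname{Var}\{\tilde m_q(x)\}=\frac{\sigma^2(x)}{nhf(x)}\tilde\nu_{02}+o\{h^4+(nh)^{-1}\},$$ and $$\tilde\nu_{02}=\nu_{02}-r^2(1-r^2)C(\delta),\qquad C(\delta)=\tfrac32C(0,\delta)-2C(\tfrac12,\delta)+\tfrac12C(1,\delta),\qquad C(a,\delta)=\int K(t-a\delta)K(t+a\delta)\,dt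 .$$ -/

import Mathlib

open MeasureTheory ProbabilityTheory Filter Topology Asymptotics

namespace LocalLinear

noncomputable section

/-- `K` is a symmetric probability density with compact support and finite `∫ K²`
(the constant `∫ K²` enters the asymptotic variance). -/
structure IsKernel (K : ℝ → ℝ) : Prop where
  measurable : Measurable K
  nonneg : ∀ u, 0 ≤ K u
  symm : ∀ u, K (-u) = K u
  compactSupport : HasCompactSupport K
  integrable : Integrable K volume
  integral_eq_one : ∫ u, K u = 1
  sq_integrable : MemLp K 2 volume

/-- The observations `(X i, Y i)` are an i.i.d. sample of the regression model
`Y = m(X) + σ(X) ε`, where `X` has density `f` and the error `ε`, independent of `X`,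
has mean zero and variance one. -/
structure IsRegressionSample {Ω : Type*} [MeasurableSpace Ω] (P : Measure Ω)
    (m σ f : ℝ → ℝ) (X ε Y : ℕ → Ω → ℝ) : Prop where
  measurable_X : ∀ i, Measurable (X i)
  measurable_eps : ∀ i, Measurable (ε i)
  /-- the pairs `(X i, ε i)` are mutually independent -/
  iIndep : iIndepFun (fun i ω => (X i ω, ε i ω)) P
  /-- within each pair, the error is independent of the design variable -/
  indep : ∀ i, IndepFun (X i) (ε i) P
  /-- every `X i` has density `f` with respect to Lebesgue measure -/
  law_X : ∀ i, P.map (X i) = volume.withDensity (fun y => ENNReal.ofReal (f y))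
  identDistrib_eps : ∀ i, IdentDistrib (ε i) (ε 0) P P
  memLp_eps : ∀ i, MemLp (ε i) 2 P
  mean_eps : ∀ i, ∫ ω, ε i ω ∂P = 0
  variance_eps : ∀ i, variance (ε i) P = 1
  model : ∀ i ω, Y i ω = m (X i ω) + σ (X i ω) * ε i ω

/-- The rescaled kernel `K_h(t) = K(t/h)/h`. -/
def Kh (K : ℝ → ℝ) (h t : ℝ) : ℝ := K (t / h) / h

/-- `S_{n,l}(z) = h ∑_{i=1}^n (z - X_i)^l K_h(z - X_i)` for the design points `X 0, …, X (n-1)`. -/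
def S (K : ℝ → ℝ) (h : ℝ) (n : ℕ) (X : ℕ → ℝ) (l : ℕ) (z : ℝ) : ℝ :=
  h * ∑ i ∈ Finset.range n, (z - X i) ^ l * Kh K h (z - X i)

/-- `T_{n,l}(z) = h ∑_{i=1}^n (z - X_i)^l K_h(z - X_i) Y_i`. -/
def T (K : ℝ → ℝ) (h : ℝ) (n : ℕ) (X Y : ℕ → ℝ) (l : ℕ) (z : ℝ) : ℝ :=
  h * ∑ i ∈ Finset.range n, (z - X i) ^ l * Kh K h (z - X i) * Y i

/-- The local linear estimator at `z`, with `n⁻²` added to its denominator (this makes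
its unconditional moments exist). -/
def mhat (K : ℝ → ℝ) (h : ℝ) (n : ℕ) (X Y : ℕ → ℝ) (z : ℝ) : ℝ :=
  (S K h n X 2 z * T K h n X Y 0 z - S K h n X 1 z * T K h n X Y 1 z) /
    (S K h n X 0 z * S K h n X 2 z - S K h n X 1 z * S K h n X 1 z + ((n : ℝ) ^ 2)⁻¹)

/-- The quadratic interpolation coefficients `A_0(r), A_1(r), A_2(r)`. -/
def A (r : ℝ) : Fin 3 → ℝ := ![r * (r - 1) / 2, 1 - r ^ 2, r * (r + 1) / 2]

/-- The variance reduced estimator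
`m̃_q(x) = ∑_{j=0,1,2} A_j(r) m̂(x - (r + 1 - j) δ h)`. -/
def mtilde (K : ℝ → ℝ) (h : ℝ) (n : ℕ) (X Y : ℕ → ℝ) (r δ x : ℝ) : ℝ :=
  ∑ j : Fin 3, A r j * mhat K h n X Y (x - (r + 1 - (j : ℕ)) * (δ * h))

/-- `ν_{ij} = ∫ s^i K(s)^j ds`. -/
def nu (K : ℝ → ℝ) (i j : ℕ) : ℝ := ∫ s, s ^ i * K s ^ j

/-- `ν̃_{0l} = ∫ {∑_{i=0,1,2} A_i(r) K(s + iδ)}^l ds`. -/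
def nuTilde (K : ℝ → ℝ) (r δ : ℝ) (l : ℕ) : ℝ :=
  ∫ s, (∑ i : Fin 3, A r i * K (s + (i : ℕ) * δ)) ^ l

/-- `C(a, δ) = ∫ K(t - aδ) K(t + aδ) dt`. -/
def C₂ (K : ℝ → ℝ) (a δ : ℝ) : ℝ := ∫ t, K (t - a * δ) * K (t + a * δ)

/-- `C(δ) = 1.5 C(0, δ) - 2 C(0.5, δ) + 0.5 C(1, δ)`. -/
def C (K : ℝ → ℝ) (δ : ℝ) : ℝ :=
  3 / 2 * C₂ K 0 δ - 2 * C₂ K (1 / 2) δ + 1 / 2 * C₂ K 1 δ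

end

end LocalLinear

/-!
Rescale the design around `x`: with `N = n h` and `u_i = (x - X_i) / h + t`, the local linear
estimator at `x + h t` is `∑ W_i Y_i` with weights
`W_i = N⁻¹ K(u_i) (s₂ - u_i s₁) / (s₀ s₂ - s₁² + N⁻⁴)`, `s_l = N⁻¹ ∑ u_i ^ l K(u_i)` (`locWt`,
`mhat_eq_sum_locWt`). A linear combination `∑ A_j m̂(x + h t_j)` is therefore the sum of its
conditional mean `M` given the design and of a linear form `V` in the errors, and `V` is centred and
orthogonal to every square integrable statistic of the design (`IsRegressionSample.noise`). Hence
the estimator has mean `E M` and variance `Var M + E V²`, and the theorem follows from two facts.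

* `LocalDesign.conditional_bias`: for each `t` the conditional mean differs from
  `m(x) + m'(x) h t + m''(x) h² (t² + ν₂₀) / 2` by an error with mean square
  `o(h⁴ + N⁻¹)`. By the Cauchy–Schwarz inequality this controls both the bias and `Var M`.
* `LocalDesign.tendsto_condVar`: `N E V²` tends to
  `σ²(x) / f(x) ∫ (∑ A_j K(v + t_j))² dv`, because `N W_i` is close to `K(u_i) / f(x)`.

The difficulty in both is the random denominator, which vanishes up to the term `N⁻⁴` when the
design is badly spread. On the event that both tails of the design, `u_i ≥ a` and `u_i ≤ -a`, carry
normalised kernel mass at least `c` (`GoodDesign`), the weighted spread `s₀ s₂ - s₁²` is bounded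
below (`GoodDesign.mul_le_det`), and the weights are controlled by `|s₀ - f(x)|` and `|s₁|`; these
tend to zero in mean square by a variance computation (`LocalDesign.tendsto_sq`), which needs only
the continuity of `f` at `x` and `∫ K² < ∞`. On the complement the sum of the absolute weights is
only bounded by a multiple of `N² s₀`, thanks to the term `N⁻⁴` (`sum_abs_locWt_le`); but the
complement is so rare that `N⁵` times the square of a kernel average, integrated over it, still
tends to zero. This comes from an exponential moment bound for the independent summands
(`LocalDesign.eventually_exp_moment`, `LocalDesign.exists_lower_tail`).

For the quadratic interpolation the nodes are `t_j = (j - 1 - r) δ`; the coefficients sum to one and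
annihilate `t_j` and `t_j²` (`sum_node_expansion`), so the bias is that of `m̂(x)`, and the constant
in the variance is found by expanding the square and translating (`IsKernel.nuTilde_two`).
-/

namespace LocalLinear

/-! ### Deterministic bounds for the local linear weights -/

section

/-- The normalised local moment `s_l = N⁻¹ ∑ u_i^l K(u_i)` of the points `u_0, …, u_{n-1}`; it is
applied with `N = n h` and `u_i = (z - X_i) / h`. -/
noncomputable def locMom (K : ℝ → ℝ) (N : ℝ) (n : ℕ) (u : ℕ → ℝ) (l : ℕ) : ℝ :=
  N⁻¹ * ∑ i ∈ Finset.range n, u i ^ l * K (u i)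

/-- The normalised denominator `s₀ s₂ - s₁² + N⁻⁴` of the local linear estimator. -/
noncomputable def locDen (K : ℝ → ℝ) (N : ℝ) (n : ℕ) (u : ℕ → ℝ) : ℝ :=
  locMom K N n u 0 * locMom K N n u 2 - locMom K N n u 1 ^ 2 + (N ^ 4)⁻¹

/-- The weight that the local linear estimator gives to the `i`-th observation. -/
noncomputable def locWt (K : ℝ → ℝ) (N : ℝ) (n : ℕ) (u : ℕ → ℝ) (i : ℕ) : ℝ :=
  N⁻¹ * K (u i) * ((locMom K N n u 2 - u i * locMom K N n u 1) / locDen K N n u)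

/-- The design is well spread around the point of estimation: both `[a, ∞)` and `(-∞, -a]` carry
normalised kernel mass at least `c`. -/
def GoodDesign (K : ℝ → ℝ) (a c N : ℝ) (n : ℕ) (u : ℕ → ℝ) : Prop :=
  c ≤ N⁻¹ * ∑ i ∈ Finset.range n, (Set.Ici a).indicator K (u i) ∧
  c ≤ N⁻¹ * ∑ i ∈ Finset.range n, (Set.Iic (-a)).indicator K (u i)

variable {K : ℝ → ℝ} {a c L N : ℝ} {n : ℕ} {u : ℕ → ℝ}

/-- The term `n⁻²` in the denominator of the estimator becomes `N⁻⁴`, where `N = n h`, after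
division by `(n h ^ 2) ^ 2 = n ^ 2 h ^ 4`. -/
theorem mhat_eq_sum_locWt {h : ℝ} (hh : 0 < h) (hn : 0 < n) (X Y : ℕ → ℝ) (z : ℝ) :
    mhat K h n X Y z =
      ∑ i ∈ Finset.range n, locWt K (n * h) n (fun i => (z - X i) / h) i * Y i := by
  have hn' : (0 : ℝ) < n := by exact_mod_cast hn
  have hS : ∀ l, S K h n X l z
      = n * h * h ^ l * locMom K (n * h) n (fun i => (z - X i) / h) l := by
    intro l
    simp only [S, locMom, Kh, Finset.mul_sum]
    refine Finset.sum_congr rfl fun i _ => ?_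
    rw [div_pow]
    field_simp
  have hT : ∀ l, T K h n X Y l z
      = h ^ l * ∑ i ∈ Finset.range n, ((z - X i) / h) ^ l * K ((z - X i) / h) * Y i := by
    intro l
    simp only [T, Kh, Finset.mul_sum]
    refine Finset.sum_congr rfl fun i _ => ?_
    rw [div_pow]
    field_simp
  have hden : S K h n X 0 z * S K h n X 2 z - S K h n X 1 z * S K h n X 1 z + ((n : ℝ) ^ 2)⁻¹
      = (n * h) ^ 2 * h ^ 2 * locDen K (n * h) n (fun i => (z - X i) / h) := by
    simp only [hS, locDen]
    field_simp
  have hnum : S K h n X 2 z * T K h n X Y 0 z - S K h n X 1 z * T K h n X Y 1 z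
      = (n * h) ^ 2 * h ^ 2 * ∑ i ∈ Finset.range n, (n * h)⁻¹ * K ((z - X i) / h) *
        (locMom K (n * h) n (fun i => (z - X i) / h) 2
          - (z - X i) / h * locMom K (n * h) n (fun i => (z - X i) / h) 1) * Y i := by
    simp only [hS, hT, Finset.mul_sum, ← Finset.sum_sub_distrib]
    refine Finset.sum_congr rfl fun i _ => ?_
    field_simp
  have h2 : ((n : ℝ) * h) ^ 2 * h ^ 2 ≠ 0 := by positivity
  rw [mhat, hden, hnum, mul_div_mul_left _ _ h2, Finset.sum_div]
  refine Finset.sum_congr rfl fun i _ => ?_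
  rw [locWt]
  ring

theorem locMom_zero_nonneg (hK0 : ∀ v, 0 ≤ K v) (hN : 0 < N) : 0 ≤ locMom K N n u 0 :=
  mul_nonneg (inv_nonneg.2 hN.le)
    (Finset.sum_nonneg fun i _ => mul_nonneg (by simp) (hK0 _))

theorem locMom_two_nonneg (hK0 : ∀ v, 0 ≤ K v) (hN : 0 < N) : 0 ≤ locMom K N n u 2 :=
  mul_nonneg (inv_nonneg.2 hN.le)
    (Finset.sum_nonneg fun _ _ => mul_nonneg (sq_nonneg _) (hK0 _))

theorem abs_locMom_le (hK0 : ∀ v, 0 ≤ K v) (hKL : ∀ v, K v ≠ 0 → |v| ≤ L) (hN : 0 < N) (l : ℕ) :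
    |locMom K N n u l| ≤ L ^ l * locMom K N n u 0 := by
  rw [locMom, locMom, abs_mul, abs_of_pos (inv_pos.2 hN), mul_left_comm]
  refine mul_le_mul_of_nonneg_left ?_ (inv_pos.2 hN).le
  refine (Finset.abs_sum_le_sum_abs _ _).trans ?_
  rw [Finset.mul_sum]
  refine Finset.sum_le_sum fun i _ => ?_
  by_cases h : K (u i) = 0
  · simp [h]
  · rw [abs_mul, abs_of_nonneg (hK0 _), abs_pow, pow_zero, one_mul]
    exact mul_le_mul_of_nonneg_right (pow_le_pow_left₀ (abs_nonneg _) (hKL _ h) _) (hK0 _)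

/-- Weighted quadratic forms in the design are expressed by the local moments. -/
theorem sum_mul_sq_sub (α β : ℝ) :
    N⁻¹ * ∑ i ∈ Finset.range n, K (u i) * (α * u i - β) ^ 2
      = α ^ 2 * locMom K N n u 2 - 2 * α * β * locMom K N n u 1 + β ^ 2 * locMom K N n u 0 := by
  simp only [locMom, Finset.mul_sum, ← Finset.sum_sub_distrib, ← Finset.sum_add_distrib]
  refine Finset.sum_congr rfl fun i _ => ?_
  ring

/-- The Gram determinant `s₀ s₂ - s₁²` is nonnegative. -/
theorem locMom_det_nonneg (hK0 : ∀ v, 0 ≤ K v) :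
    0 ≤ locMom K N n u 0 * locMom K N n u 2 - locMom K N n u 1 ^ 2 := by
  have h := Finset.sum_sq_le_sum_mul_sum_of_sq_le_mul (Finset.range n)
    (r := fun i => u i ^ 1 * K (u i)) (f := fun i => u i ^ 0 * K (u i))
    (g := fun i => u i ^ 2 * K (u i))
    (fun i _ => mul_nonneg (by simp) (hK0 _)) (fun i _ => mul_nonneg (sq_nonneg _) (hK0 _))
    (fun i _ => le_of_eq (by ring))
  have h2 := mul_le_mul_of_nonneg_left h (sq_nonneg N⁻¹)
  simp only [locMom]
  nlinarith [h2]

theorem locDen_pos (hK0 : ∀ v, 0 ≤ K v) (hN : 0 < N) : 0 < locDen K N n u :=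
  add_pos_of_nonneg_of_pos (locMom_det_nonneg hK0) (by positivity)

/-- The weights sum to one up to the effect of the term `N⁻⁴` in the denominator. -/
theorem sum_locWt (hK0 : ∀ v, 0 ≤ K v) (hN : 0 < N) :
    ∑ i ∈ Finset.range n, locWt K N n u i = 1 - (N ^ 4)⁻¹ / locDen K N n u := by
  have hd := (locDen_pos (n := n) (u := u) hK0 hN).ne'
  have h1 : ∑ i ∈ Finset.range n, locWt K N n u i
      = (locMom K N n u 0 * locMom K N n u 2 - locMom K N n u 1 ^ 2) / locDen K N n u := by
    rw [eq_div_iff hd, Finset.sum_mul]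
    have : ∀ i ∈ Finset.range n, locWt K N n u i * locDen K N n u
        = locMom K N n u 2 * (N⁻¹ * (u i ^ 0 * K (u i)))
          - locMom K N n u 1 * (N⁻¹ * (u i ^ 1 * K (u i))) := by
      intro i _
      rw [locWt]
      field_simp
    rw [Finset.sum_congr rfl this, Finset.sum_sub_distrib, ← Finset.mul_sum, ← Finset.mul_sum,
      ← Finset.mul_sum, ← Finset.mul_sum]
    change _ * locMom K N n u 0 - _ * locMom K N n u 1 = _
    ring
  rw [h1, div_eq_iff hd, sub_mul, div_mul_cancel₀ _ hd, locDen]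
  ring

/-- The weights annihilate linear functions centred at the point of estimation. -/
theorem sum_locWt_mul :
    ∑ i ∈ Finset.range n, locWt K N n u i * u i = 0 := by
  have : ∀ i ∈ Finset.range n, locWt K N n u i * u i
      = (locMom K N n u 2 * (N⁻¹ * (u i ^ 1 * K (u i)))
          - locMom K N n u 1 * (N⁻¹ * (u i ^ 2 * K (u i)))) / locDen K N n u := by
    intro i _
    rw [locWt]
    ring
  rw [Finset.sum_congr rfl this, ← Finset.sum_div, Finset.sum_sub_distrib, ← Finset.mul_sum,
    ← Finset.mul_sum, ← Finset.mul_sum, ← Finset.mul_sum]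
  change (_ * locMom K N n u 1 - _ * locMom K N n u 2) / _ = _
  ring

/-- A bound for the weights valid for every design. It follows from the Cauchy-Schwarz inequality
and `N⁻¹ ∑ K(u_i) (s₂ - u_i s₁)² = s₂ (s₀ s₂ - s₁²)`, and it is only of first order in the kernel,
so that its square is integrable for a square integrable kernel. -/
theorem sum_abs_locWt_le (hK0 : ∀ v, 0 ≤ K v) (hKL : ∀ v, K v ≠ 0 → |v| ≤ L) (hL : 0 ≤ L)
    (hN : 0 < N) :
    ∑ i ∈ Finset.range n, |locWt K N n u i| ≤ L * N ^ 2 * locMom K N n u 0 := by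
  have hd := locDen_pos (n := n) (u := u) hK0 hN
  have hD0 := locMom_det_nonneg (N := N) (n := n) (u := u) hK0
  have hs0 := locMom_zero_nonneg (n := n) (u := u) hK0 hN
  have hs2 := locMom_two_nonneg (n := n) (u := u) hK0 hN
  have hs2' := (le_abs_self _).trans (abs_locMom_le (n := n) (u := u) hK0 hKL hN 2)
  set s0 := locMom K N n u 0 with hs0d
  set s1 := locMom K N n u 1
  set s2 := locMom K N n u 2
  have e1 : ∑ i ∈ Finset.range n, |locWt K N n u i|
      = (N⁻¹ * ∑ i ∈ Finset.range n, K (u i) * |s2 - u i * s1|) / locDen K N n u := by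
    rw [Finset.mul_sum, Finset.sum_div]
    refine Finset.sum_congr rfl fun i _ => ?_
    rw [locWt, abs_mul, abs_mul, abs_div, abs_of_pos hd, abs_of_pos (inv_pos.2 hN),
      abs_of_nonneg (hK0 _)]
    ring
  have e2 : (N⁻¹ * ∑ i ∈ Finset.range n, K (u i) * |s2 - u i * s1|) ^ 2
      ≤ s0 * (s2 * (s0 * s2 - s1 ^ 2)) := by
    have h := Finset.sum_sq_le_sum_mul_sum_of_sq_le_mul (Finset.range n)
      (r := fun i => K (u i) * |s2 - u i * s1|) (f := fun i => u i ^ 0 * K (u i))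
      (g := fun i => K (u i) * (s1 * u i - s2) ^ 2)
      (fun i _ => mul_nonneg (by simp) (hK0 _)) (fun i _ => mul_nonneg (hK0 _) (sq_nonneg _))
      (fun i _ => le_of_eq (by rw [mul_pow, sq_abs]; ring))
    have h2 := mul_le_mul_of_nonneg_left h (sq_nonneg N⁻¹)
    have h3 := sum_mul_sq_sub (K := K) (N := N) (n := n) (u := u) s1 s2
    calc _ = N⁻¹ ^ 2 * (∑ i ∈ Finset.range n, K (u i) * |s2 - u i * s1|) ^ 2 := by ring
      _ ≤ _ := h2
      _ = (N⁻¹ * ∑ i ∈ Finset.range n, u i ^ 0 * K (u i)) *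
          (N⁻¹ * ∑ i ∈ Finset.range n, K (u i) * (s1 * u i - s2) ^ 2) := by ring
      _ = s0 * (s2 * (s0 * s2 - s1 ^ 2)) := by
        rw [h3]
        change s0 * (s1 ^ 2 * s2 - 2 * s1 * s2 * s1 + s2 ^ 2 * s0) = _
        ring
  have hτ : 0 < (N ^ 4)⁻¹ := by positivity
  have hNτ : (N ^ 2) ^ 2 * (N ^ 4)⁻¹ = 1 := by field_simp
  rw [e1, div_le_iff₀ hd]
  refine abs_le_of_sq_le_sq (a := N⁻¹ * ∑ i ∈ Finset.range n, K (u i) * |s2 - u i * s1|) ?_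
    (by positivity) |> (le_abs_self _).trans
  refine e2.trans ?_
  -- `D * N⁻⁴ ≤ (D + N⁻⁴) ^ 2`: one of the two factors of the denominator comes from `N⁻⁴`
  set D := s0 * s2 - s1 ^ 2 with hD
  have hden : locDen K N n u = D + (N ^ 4)⁻¹ := rfl
  rw [hden]
  calc s0 * (s2 * D) ≤ s0 * (L ^ 2 * s0 * D) := by gcongr
    _ = L ^ 2 * s0 ^ 2 * ((N ^ 2) ^ 2 * (D * (N ^ 4)⁻¹)) := by
      linear_combination (- L ^ 2 * s0 ^ 2 * D) * hNτ
    _ ≤ L ^ 2 * s0 ^ 2 * ((N ^ 2) ^ 2 * (D + (N ^ 4)⁻¹) ^ 2) := by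
      gcongr
      nlinarith
    _ = _ := by ring

theorem GoodDesign.le_locMom_zero (hK0 : ∀ v, 0 ≤ K v) (hN : 0 < N)
    (hg : GoodDesign K a c N n u) : c ≤ locMom K N n u 0 := by
  refine hg.1.trans (mul_le_mul_of_nonneg_left (Finset.sum_le_sum fun i _ => ?_)
    (inv_pos.2 hN).le)
  rw [pow_zero, one_mul]
  exact Set.indicator_le_self' (fun v => fun _ => hK0 v) _

/-- On a well spread design the Gram determinant is bounded below by a multiple of `s₀`: the
weighted second moment about the weighted mean is at least the contribution of the side of the
origin opposite to that mean. -/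
theorem GoodDesign.mul_le_det (hK0 : ∀ v, 0 ≤ K v) (hN : 0 < N) (ha : 0 < a) (hc : 0 < c)
    (hg : GoodDesign K a c N n u) :
    a ^ 2 * c * locMom K N n u 0
      ≤ locMom K N n u 0 * locMom K N n u 2 - locMom K N n u 1 ^ 2 := by
  have hs0 : 0 < locMom K N n u 0 := hc.trans_le (hg.le_locMom_zero hK0 hN)
  have h3 := sum_mul_sq_sub (K := K) (N := N) (n := n) (u := u)
    (locMom K N n u 0) (locMom K N n u 1)
  set s0 := locMom K N n u 0 with hs0d
  set s1 := locMom K N n u 1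
  set s2 := locMom K N n u 2
  suffices hs : a ^ 2 * s0 ^ 2 * c
      ≤ N⁻¹ * ∑ i ∈ Finset.range n, K (u i) * (s0 * u i - s1) ^ 2 by
    rw [h3] at hs
    have : s0 * (a ^ 2 * c * s0) ≤ s0 * (s0 * s2 - s1 ^ 2) := by linarith
    exact le_of_mul_le_mul_left this hs0
  have key : ∀ E : Set ℝ, (∀ v ∈ E, (s0 * a) ^ 2 ≤ (s0 * v - s1) ^ 2) →
      c ≤ N⁻¹ * ∑ i ∈ Finset.range n, E.indicator K (u i) →
      a ^ 2 * s0 ^ 2 * c ≤ N⁻¹ * ∑ i ∈ Finset.range n, K (u i) * (s0 * u i - s1) ^ 2 := by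
    intro E hE hcE
    refine (mul_le_mul_of_nonneg_left hcE (by positivity)).trans ?_
    rw [mul_left_comm, Finset.mul_sum]
    refine mul_le_mul_of_nonneg_left (Finset.sum_le_sum fun i _ => ?_) (inv_pos.2 hN).le
    by_cases h : u i ∈ E
    · rw [Set.indicator_of_mem h]
      have := mul_le_mul_of_nonneg_left (hE _ h) (hK0 (u i))
      linarith
    · rw [Set.indicator_of_notMem h, mul_zero]
      exact mul_nonneg (hK0 _) (sq_nonneg _)
  -- use the side of the origin on which `|s0 * v - s1|` is at least `s0 * a`
  rcases le_total s1 0 with h | h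
  · refine key _ (fun v hv => ?_) hg.1
    have : s0 * a ≤ s0 * v := mul_le_mul_of_nonneg_left hv hs0.le
    exact pow_le_pow_left₀ (by positivity) (by linarith) 2
  · refine key _ (fun v hv => ?_) hg.2
    have : s0 * v ≤ s0 * (-a) := mul_le_mul_of_nonneg_left hv hs0.le
    have := pow_le_pow_left₀ (n := 2) (by positivity : 0 ≤ s0 * a)
      (show s0 * a ≤ s1 - s0 * v by linarith)
    linarith

theorem GoodDesign.le_locDen (hK0 : ∀ v, 0 ≤ K v) (hN : 0 < N) (ha : 0 < a) (hc : 0 < c)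
    (hg : GoodDesign K a c N n u) :
    a ^ 2 * c * locMom K N n u 0 ≤ locDen K N n u :=
  (hg.mul_le_det hK0 hN ha hc).trans (le_add_of_nonneg_right (by positivity))

theorem GoodDesign.le_locDen' (hK0 : ∀ v, 0 ≤ K v) (hN : 0 < N) (ha : 0 < a) (hc : 0 < c)
    (hg : GoodDesign K a c N n u) :
    a ^ 2 * c ^ 2 ≤ locDen K N n u := by
  refine le_trans ?_ (hg.le_locDen hK0 hN ha hc)
  have := mul_le_mul_of_nonneg_left (hg.le_locMom_zero hK0 hN) (by positivity : 0 ≤ a ^ 2 * c)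
  linarith

/-- On a well spread design the local linear weight of an observation is a bounded multiple of its
kernel weight. -/
theorem GoodDesign.abs_locWt_le (hK0 : ∀ v, 0 ≤ K v) (hKL : ∀ v, K v ≠ 0 → |v| ≤ L) (hN : 0 < N)
    (ha : 0 < a) (hc : 0 < c) (hg : GoodDesign K a c N n u) (i : ℕ) :
    |locWt K N n u i| ≤ 2 * L ^ 2 / (a ^ 2 * c) * (N⁻¹ * K (u i)) := by
  by_cases hKi : K (u i) = 0
  · simp [locWt, hKi]
  have hL : 0 ≤ L := (abs_nonneg _).trans (hKL _ hKi)
  have hd := locDen_pos (n := n) (u := u) hK0 hN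
  have hs0 : 0 < locMom K N n u 0 := hc.trans_le (hg.le_locMom_zero hK0 hN)
  have hs1 := abs_locMom_le (n := n) (u := u) hK0 hKL hN 1
  have hs2 := abs_locMom_le (n := n) (u := u) hK0 hKL hN 2
  have hden := hg.le_locDen hK0 hN ha hc
  rw [locWt, abs_mul, abs_of_nonneg (mul_nonneg (inv_pos.2 hN).le (hK0 _)), mul_comm]
  refine mul_le_mul_of_nonneg_right ?_ (mul_nonneg (inv_pos.2 hN).le (hK0 _))
  rw [abs_div, abs_of_pos hd, div_le_div_iff₀ hd (by positivity)]
  have : |locMom K N n u 2 - u i * locMom K N n u 1| ≤ 2 * L ^ 2 * locMom K N n u 0 := by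
    refine (abs_sub _ _).trans ?_
    rw [abs_mul]
    have := mul_le_mul (hKL _ hKi) hs1 (abs_nonneg _) hL
    linarith
  calc _ ≤ 2 * L ^ 2 * locMom K N n u 0 * (a ^ 2 * c) := by gcongr
    _ = 2 * L ^ 2 * (a ^ 2 * c * locMom K N n u 0) := by ring
    _ ≤ _ := by gcongr

/-- On a well spread design the local linear weights are close to the kernel weights
`K(u_i) / (N g)` as soon as the local moments `s₀` and `s₁` are close to `g` and `0`. -/
theorem exists_abs_locWt_sub_le (hK0 : ∀ v, 0 ≤ K v) (hKL : ∀ v, K v ≠ 0 → |v| ≤ L) (hL : 0 ≤ L)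
    (ha : 0 < a) (hc : 0 < c) {g : ℝ} (hg0 : 0 < g) :
    ∃ B, 0 < B ∧ ∀ (N : ℝ) (n : ℕ) (u : ℕ → ℝ), 0 < N → GoodDesign K a c N n u → ∀ i,
      |locWt K N n u i - N⁻¹ * K (u i) / g| ≤
        B * min 1 (|locMom K N n u 0 - g| + |locMom K N n u 1| + (N ^ 4)⁻¹) *
          (N⁻¹ * K (u i)) := by
  set M := a ^ 2 * c with hM
  have hMp : 0 < M := by positivity
  set B₁ := 2 * L ^ 2 / M + 1 / g
  set B₂ := L ^ 2 / M + (L / M + L * g / (M * c)) + 1 / (M * c)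
  have hB₁ : 0 < B₁ := by positivity
  have hB₂ : 0 < B₂ := by positivity
  refine ⟨B₁ + B₂ / g, by positivity, fun N n u hN hg i => ?_⟩
  have hNK : 0 ≤ N⁻¹ * K (u i) := mul_nonneg (inv_pos.2 hN).le (hK0 _)
  have hτ : 0 < (N ^ 4)⁻¹ := by positivity
  set ρ := |locMom K N n u 0 - g| + |locMom K N n u 1| + (N ^ 4)⁻¹ with hρ
  have hρ0 : 0 ≤ ρ := by positivity
  -- for large deviations both weights are bounded multiples of the kernel weight
  have hb1 : |locWt K N n u i - N⁻¹ * K (u i) / g| ≤ B₁ * (N⁻¹ * K (u i)) := by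
    refine (abs_sub _ _).trans ?_
    rw [abs_of_nonneg (div_nonneg hNK hg0.le)]
    have := hg.abs_locWt_le hK0 hKL hN ha hc i
    calc _ ≤ 2 * L ^ 2 / M * (N⁻¹ * K (u i)) + N⁻¹ * K (u i) / g := by gcongr
      _ = _ := by ring
  -- for small deviations the numerator of the difference is expanded in `g - s0`, `s1` and `N⁻⁴`
  have hb2 : |locWt K N n u i - N⁻¹ * K (u i) / g| ≤ B₂ / g * ρ * (N⁻¹ * K (u i)) := by
    by_cases hKi : K (u i) = 0
    · simp [locWt, hKi]
    have hd := locDen_pos (n := n) (u := u) hK0 hN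
    have hs0 : 0 < locMom K N n u 0 := hc.trans_le (hg.le_locMom_zero hK0 hN)
    have hs1 := abs_locMom_le (n := n) (u := u) hK0 hKL hN 1
    have hs2 := abs_locMom_le (n := n) (u := u) hK0 hKL hN 2
    have hden := hg.le_locDen hK0 hN ha hc
    have hden' := hg.le_locDen' hK0 hN ha hc
    have hui := hKL _ hKi
    have e : locWt K N n u i - N⁻¹ * K (u i) / g
        = (g * (locMom K N n u 2 - u i * locMom K N n u 1) - locDen K N n u) /
          (g * locDen K N n u) * (N⁻¹ * K (u i)) := by
      rw [locWt]; field_simp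
    rw [e, abs_mul, abs_of_nonneg hNK]
    refine mul_le_mul_of_nonneg_right ?_ hNK
    rw [abs_div, abs_of_pos (mul_pos hg0 hd), div_le_iff₀ (mul_pos hg0 hd)]
    have hdef : locDen K N n u = locMom K N n u 0 * locMom K N n u 2 - locMom K N n u 1 ^ 2
      + (N ^ 4)⁻¹ := rfl
    set s0 := locMom K N n u 0
    set s1 := locMom K N n u 1
    set s2 := locMom K N n u 2
    set D := locDen K N n u
    have h1 : s0 ≤ D / M := by rw [le_div_iff₀ hMp]; linarith
    have h2 : 1 ≤ D / (M * c) := by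
      rw [le_div_iff₀ (by positivity)]
      calc _ = a ^ 2 * c ^ 2 := by rw [hM]; ring
        _ ≤ D := hden'
    have e2 : g * (s2 - u i * s1) - D = s2 * (g - s0) + s1 * (s1 - u i * g) - (N ^ 4)⁻¹ := by
      rw [hdef]; ring
    have n1 : |s2 * (g - s0)| ≤ L ^ 2 * (D / M) * |s0 - g| := by
      rw [abs_mul, abs_sub_comm g]
      exact mul_le_mul_of_nonneg_right (hs2.trans (by gcongr)) (abs_nonneg _)
    have n2 : |s1 * (s1 - u i * g)| ≤ |s1| * (L * (D / M) + L * g * (D / (M * c))) := by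
      rw [abs_mul]
      refine mul_le_mul_of_nonneg_left ?_ (abs_nonneg _)
      refine (abs_sub _ _).trans (add_le_add ?_ ?_)
      · rw [pow_one] at hs1
        exact hs1.trans (by gcongr)
      · rw [abs_mul, abs_of_pos hg0]
        calc _ ≤ L * g := by gcongr
          _ = L * g * 1 := by ring
          _ ≤ _ := by gcongr
    have n3 : (N ^ 4)⁻¹ ≤ (N ^ 4)⁻¹ * (D / (M * c)) := le_mul_of_one_le_right hτ.le h2
    calc |g * (s2 - u i * s1) - D|
        ≤ L ^ 2 * (D / M) * |s0 - g| + |s1| * (L * (D / M) + L * g * (D / (M * c)))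
          + (N ^ 4)⁻¹ * (D / (M * c)) := by
          rw [e2]
          refine (abs_sub _ _).trans (add_le_add ((abs_add_le _ _).trans (add_le_add n1 n2)) ?_)
          rwa [abs_of_pos hτ]
      _ = (L ^ 2 / M * |s0 - g| + (L / M + L * g / (M * c)) * |s1| + 1 / (M * c) * (N ^ 4)⁻¹)
          * D := by ring
      _ ≤ B₂ * ρ * D := by
          refine mul_le_mul_of_nonneg_right ?_ hd.le
          have p1 : 0 ≤ L ^ 2 / M := by positivity
          have p2 : 0 ≤ L / M + L * g / (M * c) := by positivity
          have p3 : 0 ≤ 1 / (M * c) := by positivity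
          have q1 := abs_nonneg (s0 - g)
          have q2 := abs_nonneg s1
          have t1 : L ^ 2 / M * |s0 - g| ≤ L ^ 2 / M * ρ := by
            gcongr; linarith
          have t2 : (L / M + L * g / (M * c)) * |s1| ≤ (L / M + L * g / (M * c)) * ρ := by
            gcongr; linarith
          have t3 : 1 / (M * c) * (N ^ 4)⁻¹ ≤ 1 / (M * c) * ρ := by
            gcongr; linarith
          calc _ ≤ _ := add_le_add (add_le_add t1 t2) t3
            _ = B₂ * ρ := by ring
      _ = B₂ / g * ρ * (g * D) := by field_simp
  rcases le_total 1 ρ with h | h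
  · rw [min_eq_left h, mul_one]
    refine hb1.trans (mul_le_mul_of_nonneg_right ?_ hNK)
    exact le_add_of_nonneg_right (by positivity)
  · rw [min_eq_right h]
    refine hb2.trans (mul_le_mul_of_nonneg_right (mul_le_mul_of_nonneg_right ?_ hρ0) hNK)
    exact le_add_of_nonneg_left hB₁.le

end

/-! ### Kernel averages of the design -/

section

/-- The design variables together with the bandwidths: the `X i` are independent with a common
density `f`, which is continuous and positive at `x`, and `h n → 0`, `n h n → ∞`. -/
structure LocalDesign {Ω : Type*} [MeasurableSpace Ω] (P : Measure Ω) (f : ℝ → ℝ)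
    (X : ℕ → Ω → ℝ) (h : ℕ → ℝ) (x : ℝ) : Prop where
  measurable_X : ∀ i, Measurable (X i)
  iIndep : iIndepFun X P
  law_X : ∀ i, P.map (X i) = volume.withDensity (fun y => ENNReal.ofReal (f y))
  measurable_f : Measurable f
  nonneg_f : ∀ y, 0 ≤ f y
  continuousAt_f : ContinuousAt f x
  pos_f : 0 < f x
  pos_h : ∀ n, 0 < h n
  tendsto_h : Tendsto h atTop (𝓝 0)
  tendsto_nh : Tendsto (fun n : ℕ => (n : ℝ) * h n) atTop atTop

/-- Integrable measurable functions of bounded support. -/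
structure IsTest (φ : ℝ → ℝ) : Prop where
  measurable : Measurable φ
  integrable : Integrable φ
  bounded_support : ∃ L, ∀ v, φ v ≠ 0 → |v| ≤ L

/-- The normalised sum `N⁻¹ ∑ φ(v_i)` over the points `v_0, …, v_{n-1}`. -/
noncomputable def empAvg (φ : ℝ → ℝ) (N : ℝ) (n : ℕ) (v : ℕ → ℝ) : ℝ :=
  N⁻¹ * ∑ i ∈ Finset.range n, φ (v i)

variable {Ω : Type*} [MeasurableSpace Ω] {P : Measure Ω} {f : ℝ → ℝ} {X : ℕ → Ω → ℝ} {h : ℕ → ℝ}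
  {x : ℝ} {φ χ : ℝ → ℝ}

/-- The expectation of a function of `(x - X i) / h` is `h f(x) ∫ φ` up to a relative error that is
uniform over all functions supported in a given bounded interval. -/
theorem LocalDesign.eventually_expectation (H : LocalDesign P f X h x) (L : ℝ) {η : ℝ}
    (hη : 0 < η) :
    ∀ᶠ n in atTop, ∀ φ : ℝ → ℝ, Measurable φ → Integrable φ → (∀ v, φ v ≠ 0 → |v| ≤ L) → ∀ i,
      Integrable (fun ω => φ ((x - X i ω) / h n)) P ∧
      |(∫ ω, φ ((x - X i ω) / h n) ∂P) - h n * (f x * ∫ v, φ v)| ≤ h n * (η * ∫ v, |φ v|) := by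
  obtain ⟨ε, hε, hfε⟩ := Metric.continuousAt_iff.1 H.continuousAt_f η hη
  have hhL : Tendsto (fun n => h n * L) atTop (𝓝 0) := by
    simpa using H.tendsto_h.mul_const L
  filter_upwards [hhL.eventually_lt_const hε] with n hn φ hφm hφi hφL i
  have hh := H.pos_h n
  have hclose : ∀ y, φ ((x - y) / h n) ≠ 0 → |f y - f x| ≤ η := by
    intro y hy
    have h1 := hφL _ hy
    rw [abs_div, abs_of_pos hh, div_le_iff₀ hh] at h1
    refine (hfε (x := y) ?_).le
    rw [Real.dist_eq, abs_sub_comm]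
    linarith
  have hI : Integrable (fun y => φ ((x - y) / h n)) :=
    (hφi.comp_div hh.ne').comp_sub_left x
  have hIabs : Integrable (fun y => |φ ((x - y) / h n)|) := hI.abs
  have hmeas : Measurable fun y => φ ((x - y) / h n) := by fun_prop
  have hfI : Integrable (fun y => f y * φ ((x - y) / h n)) := by
    refine (hIabs.const_mul (f x + η)).mono' (H.measurable_f.mul hmeas).aestronglyMeasurable ?_
    refine Eventually.of_forall fun y => ?_
    by_cases hy : φ ((x - y) / h n) = 0
    · simp [hy]
    · rw [Real.norm_eq_abs, abs_mul, abs_of_nonneg (H.nonneg_f y)]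
      have := (abs_le.1 (hclose y hy)).2
      gcongr
      linarith
  have hcv : ∀ g : ℝ → ℝ, ∫ y, g ((x - y) / h n) = h n * ∫ v, g v := by
    intro g
    rw [integral_sub_left_eq_self (fun y => g (y / h n)) volume x, Measure.integral_comp_div,
      abs_of_pos hh, smul_eq_mul]
  have hmap : ∫ ω, φ ((x - X i ω) / h n) ∂P = ∫ y, f y * φ ((x - y) / h n) := by
    rw [← integral_map (f := fun y => φ ((x - y) / h n)) (H.measurable_X i).aemeasurable
      hmeas.aestronglyMeasurable, H.law_X,
      integral_withDensity_eq_integral_toReal_smul H.measurable_f.ennreal_ofReal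
        (Eventually.of_forall fun _ => ENNReal.ofReal_lt_top)]
    refine integral_congr_ae (Eventually.of_forall fun y => ?_)
    simp [ENNReal.toReal_ofReal (H.nonneg_f y)]
  constructor
  · have : Integrable (fun y => φ ((x - y) / h n)) (P.map (X i)) := by
      rw [H.law_X, integrable_withDensity_iff_integrable_smul' H.measurable_f.ennreal_ofReal
        (Eventually.of_forall fun _ => ENNReal.ofReal_lt_top)]
      refine hfI.congr (Eventually.of_forall fun y => ?_)
      simp [ENNReal.toReal_ofReal (H.nonneg_f y)]
    exact this.comp_measurable (H.measurable_X i)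
  · rw [hmap, mul_left_comm (h n) (f x), ← hcv φ, ← integral_const_mul,
      ← integral_sub hfI (hI.const_mul _), mul_left_comm, ← hcv (fun v => |φ v|),
      ← integral_const_mul]
    refine abs_integral_le_integral_abs.trans (integral_mono_of_nonneg
      (Eventually.of_forall fun _ => abs_nonneg _) (hIabs.const_mul _)
      (Eventually.of_forall fun y => ?_))
    change |f y * φ ((x - y) / h n) - f x * φ ((x - y) / h n)| ≤ η * |φ ((x - y) / h n)|
    rw [← sub_mul, abs_mul]
    by_cases hy : φ ((x - y) / h n) = 0
    · simp [hy]
    · exact mul_le_mul_of_nonneg_right (hclose y hy) (abs_nonneg _)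

theorem LocalDesign.eventually_integrable (H : LocalDesign P f X h x) (hφ : IsTest φ) :
    ∀ᶠ n in atTop, ∀ i, Integrable (fun ω => φ ((x - X i ω) / h n)) P := by
  obtain ⟨L, hL⟩ := hφ.bounded_support
  filter_upwards [H.eventually_expectation L one_pos] with n hn i
  exact (hn φ hφ.measurable hφ.integrable hL i).1

theorem LocalDesign.eventually_integrable_empAvg (H : LocalDesign P f X h x) (hφ : IsTest φ) :
    ∀ᶠ n in atTop, Integrable (fun ω => empAvg φ (n * h n) n fun i => (x - X i ω) / h n) P := by
  filter_upwards [H.eventually_integrable hφ] with n hn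
  exact (integrable_finsetSum _ fun i _ => hn i).const_mul _

theorem LocalDesign.tendsto_expectation (H : LocalDesign P f X h x) (hφ : IsTest φ) :
    Tendsto (fun n => ∫ ω, empAvg φ (n * h n) n (fun i => (x - X i ω) / h n) ∂P) atTop
      (𝓝 (f x * ∫ v, φ v)) := by
  obtain ⟨L, hL⟩ := hφ.bounded_support
  rw [Metric.tendsto_atTop']
  intro e he
  have hJ : 0 ≤ ∫ v, |φ v| := integral_nonneg fun _ => abs_nonneg _
  have hη : 0 < e / (1 + ∫ v, |φ v|) := by positivity
  obtain ⟨n₀, hn₀⟩ := eventually_atTop.1 (H.eventually_expectation L hη)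
  refine ⟨n₀, fun n hn => ?_⟩
  have hE := fun i => hn₀ n hn.le φ hφ.measurable hφ.integrable hL i
  have hn0 : (0 : ℝ) < n := by exact_mod_cast (Nat.zero_le _).trans_lt hn
  have hh := H.pos_h n
  simp only [empAvg]
  rw [integral_const_mul, integral_finsetSum _ fun i _ => (hE i).1, Real.dist_eq]
  have e1 : ((n : ℝ) * h n)⁻¹ * ∑ i ∈ Finset.range n, ∫ ω, φ ((x - X i ω) / h n) ∂P
      - f x * ∫ v, φ v = ((n : ℝ) * h n)⁻¹ * ∑ i ∈ Finset.range n,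
        ((∫ ω, φ ((x - X i ω) / h n) ∂P) - h n * (f x * ∫ v, φ v)) := by
    rw [Finset.sum_sub_distrib, Finset.sum_const, Finset.card_range, nsmul_eq_mul]
    field_simp
  rw [e1, abs_mul, abs_of_pos (by positivity)]
  calc _ ≤ ((n : ℝ) * h n)⁻¹ * ∑ i ∈ Finset.range n,
        (h n * (e / (1 + ∫ v, |φ v|) * ∫ v, |φ v|)) := by
        gcongr
        exact (Finset.abs_sum_le_sum_abs _ _).trans (Finset.sum_le_sum fun i _ => (hE i).2)
    _ = e * ((∫ v, |φ v|) / (1 + ∫ v, |φ v|)) := by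
        rw [Finset.sum_const, Finset.card_range, nsmul_eq_mul]
        field_simp
    _ < e * 1 := by
        gcongr
        rw [div_lt_one (by positivity)]
        linarith
    _ = e := mul_one e

/-- First order upper bound for expectations of nonnegative test functions. -/
theorem LocalDesign.eventually_expectation_le (H : LocalDesign P f X h x) (hφ : IsTest φ)
    (hφ0 : ∀ v, 0 ≤ φ v) :
    ∀ᶠ n in atTop, ∀ i, ∫ ω, φ ((x - X i ω) / h n) ∂P ≤ h n * (2 * f x * ∫ v, φ v) := by
  obtain ⟨L, hL⟩ := hφ.bounded_support
  filter_upwards [H.eventually_expectation L H.pos_f] with n hn i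
  have := (abs_le.1 (hn φ hφ.measurable hφ.integrable hL i).2).2
  simp only [abs_of_nonneg (hφ0 _)] at this
  linarith

/-- First order lower bound for expectations of nonnegative test functions. -/
theorem LocalDesign.eventually_le_expectation (H : LocalDesign P f X h x) (hφ : IsTest φ)
    (hφ0 : ∀ v, 0 ≤ φ v) :
    ∀ᶠ n in atTop, ∀ i, h n * (f x / 2 * ∫ v, φ v) ≤ ∫ ω, φ ((x - X i ω) / h n) ∂P := by
  obtain ⟨L, hL⟩ := hφ.bounded_support
  filter_upwards [H.eventually_expectation L (half_pos H.pos_f)] with n hn i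
  have := (abs_le.1 (hn φ hφ.measurable hφ.integrable hL i).2).1
  simp only [abs_of_nonneg (hφ0 _)] at this
  linarith

theorem IsTest.sq (hφ : IsTest φ) (hφ2 : Integrable fun v => φ v ^ 2) :
    IsTest fun v => φ v ^ 2 := by
  obtain ⟨L, hL⟩ := hφ.bounded_support
  exact ⟨hφ.measurable.pow_const 2, hφ2, L, fun v hv => hL v fun h0 => hv (by simp [h0])⟩

theorem LocalDesign.eventually_memLp (H : LocalDesign P f X h x) (hφ : IsTest φ)
    (hφ2 : Integrable fun v => φ v ^ 2) :
    ∀ᶠ n in atTop, ∀ i, MemLp (fun ω => φ ((x - X i ω) / h n)) 2 P := by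
  filter_upwards [H.eventually_integrable (hφ.sq hφ2)] with n hn i
  have hm : Measurable fun ω => φ ((x - X i ω) / h n) := by
    have := H.measurable_X i
    have := hφ.measurable
    fun_prop
  rw [memLp_two_iff_integrable_sq hm.aestronglyMeasurable]
  exact hn i

theorem LocalDesign.eventually_memLp_empAvg (H : LocalDesign P f X h x) (hφ : IsTest φ)
    (hφ2 : Integrable fun v => φ v ^ 2) :
    ∀ᶠ n in atTop, MemLp (fun ω => empAvg φ (n * h n) n fun i => (x - X i ω) / h n) 2 P := by
  filter_upwards [H.eventually_memLp hφ hφ2] with n hn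
  exact (memLp_finsetSum _ fun i _ => hn i).const_mul _

theorem LocalDesign.isProbabilityMeasure (H : LocalDesign P f X h x) : IsProbabilityMeasure P :=
  H.iIndep.isProbabilityMeasure

/-- Kernel averages of square integrable test functions converge in mean square. -/
theorem LocalDesign.tendsto_sq (H : LocalDesign P f X h x) (hφ : IsTest φ)
    (hφ2 : Integrable fun v => φ v ^ 2) :
    Tendsto (fun n => ∫ ω, (empAvg φ (n * h n) n (fun i => (x - X i ω) / h n)
      - f x * ∫ v, φ v) ^ 2 ∂P) atTop (𝓝 0) := by
  have := H.isProbabilityMeasure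
  have hbias := ((H.tendsto_expectation hφ).sub_const (f x * ∫ v, φ v)).pow 2
  rw [sub_self, zero_pow two_ne_zero] at hbias
  have hinv := H.tendsto_nh.inv_tendsto_atTop.mul_const (2 * f x * ∫ v, φ v ^ 2)
  rw [zero_mul] at hinv
  have hsum := hinv.add hbias
  rw [zero_add] at hsum
  refine tendsto_of_tendsto_of_tendsto_of_le_of_le' tendsto_const_nhds hsum
    (Eventually.of_forall fun n => integral_nonneg fun ω => sq_nonneg _) ?_
  filter_upwards [H.eventually_memLp hφ hφ2, H.eventually_memLp_empAvg hφ hφ2,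
    H.eventually_expectation_le (hφ.sq hφ2) (fun v => sq_nonneg _), eventually_gt_atTop 0]
    with n h1 h2 h3 hn
  have hn0 : (0 : ℝ) < n := by exact_mod_cast hn
  have hh := H.pos_h n
  set Z := fun ω => empAvg φ (n * h n) n (fun i => (x - X i ω) / h n) with hZ
  set b := f x * ∫ v, φ v
  have hdec : ∫ ω, (Z ω - b) ^ 2 ∂P = variance Z P + ((∫ ω, Z ω ∂P) - b) ^ 2 := by
    rw [variance_eq_sub h2]
    have hZi : Integrable Z P := h2.integrable (by norm_num)
    have hZ2 : Integrable (fun ω => Z ω ^ 2) P := h2.integrable_sq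
    have : ∀ ω, (Z ω - b) ^ 2 = Z ω ^ 2 - 2 * b * Z ω + b ^ 2 := fun ω => by ring
    have hA : Integrable (fun ω => Z ω ^ 2 - 2 * b * Z ω) P := hZ2.sub (hZi.const_mul _)
    simp only [this]
    rw [integral_add hA (integrable_const _),
      integral_sub hZ2 (hZi.const_mul _), integral_const_mul]
    simp only [integral_const, probReal_univ, smul_eq_mul, Pi.pow_apply]
    ring
  have hvar : variance Z P ≤ ((n : ℝ) * h n)⁻¹ * (2 * f x * ∫ v, φ v ^ 2) := by
    have hZ' : Z = fun ω => ((n : ℝ) * h n)⁻¹ *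
        (∑ i ∈ Finset.range n, fun ω => φ ((x - X i ω) / h n)) ω := by
      ext ω; simp [hZ, empAvg]
    have hind : iIndepFun (fun i ω => φ ((x - X i ω) / h n)) P :=
      H.iIndep.comp (fun _ y => φ ((x - y) / h n)) fun _ => by
        have := hφ.measurable
        fun_prop
    rw [hZ', variance_const_mul, IndepFun.variance_sum (fun i _ => h1 i)
      fun i _ j _ hij => hind.indepFun hij]
    calc _ ≤ ((n : ℝ) * h n)⁻¹ ^ 2 * ∑ i ∈ Finset.range n,
          (h n * (2 * f x * ∫ v, φ v ^ 2)) := by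
          gcongr with i
          exact (variance_le_expectation_sq (h1 i).aestronglyMeasurable).trans (h3 i)
      _ = _ := by
        rw [Finset.sum_const, Finset.card_range, nsmul_eq_mul]
        field_simp
  rw [hdec]
  exact add_le_add hvar le_rfl

end

/-! ### Moments and lower tails of kernel averages -/

section

variable {Ω : Type*} [MeasurableSpace Ω] {P : Measure Ω} {f : ℝ → ℝ} {X : ℕ → Ω → ℝ} {h : ℕ → ℝ}
  {x : ℝ} {φ χ : ℝ → ℝ}

theorem measurable_empAvg {φ : ℝ → ℝ} (hφ : Measurable φ) (hX : ∀ i, Measurable (X i)) (N h : ℝ)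
    (n : ℕ) : Measurable fun ω => empAvg φ N n fun i => (x - X i ω) / h := by
  unfold empAvg
  fun_prop

theorem empAvg_nonneg {φ : ℝ → ℝ} (hφ : ∀ v, 0 ≤ φ v) {N : ℝ} (hN : 0 ≤ N) (n : ℕ) (v : ℕ → ℝ) :
    0 ≤ empAvg φ N n v :=
  mul_nonneg (inv_nonneg.2 hN) (Finset.sum_nonneg fun _ _ => hφ _)

/-- Kernel averages of nonnegative integrable test functions are uniformly integrable: they are
asymptotically negligible on events, and for weights in `[0, 1]`, of vanishing mean. No square
integrability is needed, as the test function can be truncated. -/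
theorem LocalDesign.tendsto_mul_empAvg (H : LocalDesign P f X h x) (hφ : IsTest φ)
    (hφ0 : ∀ v, 0 ≤ φ v) {Z : ℕ → Ω → ℝ} (hZm : ∀ n, Measurable (Z n)) (hZ0 : ∀ n ω, 0 ≤ Z n ω)
    (hZ1 : ∀ n ω, Z n ω ≤ 1) (hZ : Tendsto (fun n => ∫ ω, Z n ω ∂P) atTop (𝓝 0)) :
    Tendsto (fun n => ∫ ω, Z n ω * empAvg φ (n * h n) n (fun i => (x - X i ω) / h n) ∂P) atTop
      (𝓝 0) := by
  have := H.isProbabilityMeasure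
  have hN0 : ∀ n : ℕ, 0 ≤ (n : ℝ) * h n := fun n => mul_nonneg n.cast_nonneg (H.pos_h n).le
  have hZi : ∀ n, Integrable (Z n) P := fun n =>
    Integrable.of_bound (hZm n).aestronglyMeasurable 1 (Eventually.of_forall fun ω => by
      rw [Real.norm_eq_abs, abs_of_nonneg (hZ0 n ω)]; exact hZ1 n ω)
  obtain ⟨L, hL⟩ := hφ.bounded_support
  have hφm := hφ.measurable
  rw [Metric.tendsto_atTop']
  intro e he
  -- the level `M` makes the truncated part small in mean; the rest is bounded and `Z` is small
  have htr : Tendsto (fun M : ℕ => f x * ∫ v, (φ v - min (φ v) M)) atTop (𝓝 0) := by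
    have : Tendsto (fun M : ℕ => ∫ v, (φ v - min (φ v) M)) atTop (𝓝 (∫ _ : ℝ, (0 : ℝ))) := by
      refine tendsto_integral_of_dominated_convergence φ
        (fun M => (hφm.sub (hφm.min measurable_const)).aestronglyMeasurable) hφ.integrable
        (fun M => Eventually.of_forall fun v => ?_) (Eventually.of_forall fun v => ?_)
      · have h1 : min (φ v) M ≤ φ v := min_le_left _ _
        have h2 : 0 ≤ min (φ v) (M : ℝ) := le_min (hφ0 v) M.cast_nonneg
        rw [Real.norm_eq_abs, abs_of_nonneg (by linarith)]
        linarith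
      · refine tendsto_const_nhds.congr' ?_
        filter_upwards [eventually_ge_atTop ⌈φ v⌉₊] with M hM
        rw [min_eq_left ((Nat.le_ceil _).trans (by exact_mod_cast hM)), sub_self]
    simpa using this.const_mul (f x)
  obtain ⟨M, hM⟩ := (htr.eventually_lt_const (half_pos he)).exists
  set φ₁ : ℝ → ℝ := fun v => min (φ v) M with hφ₁
  set φ₂ : ℝ → ℝ := fun v => φ v - min (φ v) M with hφ₂
  have h10 : ∀ v, 0 ≤ φ₁ v := fun v => le_min (hφ0 v) M.cast_nonneg
  have h1le : ∀ v, φ₁ v ≤ φ v := fun v => min_le_left _ _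
  have h20 : ∀ v, 0 ≤ φ₂ v := fun v => sub_nonneg.2 (h1le v)
  have hm1 : Measurable φ₁ := hφm.min measurable_const
  have hi1 : Integrable φ₁ := hφ.integrable.mono' hm1.aestronglyMeasurable
    (Eventually.of_forall fun v => by
      rw [Real.norm_eq_abs, abs_of_nonneg (h10 v)]; exact h1le v)
  have ht1 : IsTest φ₁ := ⟨hm1, hi1, L, fun v hv => hL v fun h0 => hv (le_antisymm
    ((h1le v).trans h0.le) (h10 v))⟩
  have ht2 : IsTest φ₂ := ⟨hφm.sub hm1, hφ.integrable.sub hi1, L, fun v hv => hL v fun h0 => hv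
    (le_antisymm (by have := h10 v; simp only [hφ₂]; change φ v - φ₁ v ≤ 0; linarith) (h20 v))⟩
  have hs1 : Integrable fun v => φ₁ v ^ 2 := by
    refine (hi1.const_mul M).mono' (hm1.pow_const 2).aestronglyMeasurable
      (Eventually.of_forall fun v => ?_)
    rw [Real.norm_eq_abs, abs_of_nonneg (sq_nonneg _), sq]
    exact mul_le_mul_of_nonneg_right (min_le_right _ _) (h10 v)
  set b := f x * ∫ v, φ₁ v
  have hlim : Tendsto (fun n =>
      (∫ ω, empAvg φ₂ (n * h n) n (fun i => (x - X i ω) / h n) ∂P)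
      + ((4 / e) * (∫ ω, (empAvg φ₁ (n * h n) n (fun i => (x - X i ω) / h n) - b) ^ 2 ∂P)
      + e / 4 + b * ∫ ω, Z n ω ∂P)) atTop
      (𝓝 (f x * (∫ v, φ₂ v) + ((4 / e) * 0 + e / 4 + b * 0))) :=
    (H.tendsto_expectation ht2).add ((((H.tendsto_sq ht1 hs1).const_mul _).add_const _).add
      (hZ.const_mul _))
  have hlt : f x * (∫ v, φ₂ v) + ((4 / e) * 0 + e / 4 + b * 0) < e := by linarith
  obtain ⟨n₀, hn₀⟩ := eventually_atTop.1 ((hlim.eventually_lt_const hlt).and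
    ((H.eventually_integrable_empAvg ht2).and (H.eventually_memLp_empAvg ht1 hs1)))
  refine ⟨n₀, fun n hn => ?_⟩
  obtain ⟨hn1, hn2, hn3⟩ := hn₀ n hn.le
  rw [Real.dist_eq, sub_zero, abs_of_nonneg (integral_nonneg fun ω =>
    mul_nonneg (hZ0 n ω) (empAvg_nonneg hφ0 (hN0 n) _ _))]
  refine lt_of_le_of_lt ?_ hn1
  set W₁ := fun ω => empAvg φ₁ (n * h n) n (fun i => (x - X i ω) / h n) with hW₁
  set W₂ := fun ω => empAvg φ₂ (n * h n) n (fun i => (x - X i ω) / h n) with hW₂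
  have hsq : Integrable (fun ω => (W₁ ω - b) ^ 2) P :=
    (hn3.sub (memLp_const b)).integrable_sq
  have hA : Integrable (fun ω => (4 / e) * (W₁ ω - b) ^ 2) P := hsq.const_mul _
  have hB : Integrable (fun ω => (4 / e) * (W₁ ω - b) ^ 2 + e / 4) P :=
    hA.add (integrable_const _)
  have hC : Integrable (fun ω => (4 / e) * (W₁ ω - b) ^ 2 + e / 4 + b * Z n ω) P :=
    hB.add ((hZi n).const_mul _)
  calc _ ≤ ∫ ω, W₂ ω + ((4 / e) * (W₁ ω - b) ^ 2 + e / 4 + b * Z n ω) ∂P := by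
        refine integral_mono_of_nonneg (Eventually.of_forall fun ω =>
          mul_nonneg (hZ0 n ω) (empAvg_nonneg hφ0 (hN0 n) _ _)) (hn2.add hC)
          (Eventually.of_forall fun ω => ?_)
        have hsplit : empAvg φ (n * h n) n (fun i => (x - X i ω) / h n) = W₁ ω + W₂ ω := by
          simp only [hW₁, hW₂, empAvg, ← mul_add, ← Finset.sum_add_distrib]
          congr 1
          refine Finset.sum_congr rfl fun i _ => ?_
          simp [hφ₁, hφ₂]
        change Z n ω * empAvg φ (n * h n) n (fun i => (x - X i ω) / h n) ≤ _
        rw [hsplit]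
        have hW2 : 0 ≤ W₂ ω := empAvg_nonneg h20 (hN0 n) _ _
        have hz0 := hZ0 n ω
        have hz1 := hZ1 n ω
        have hb1 : |W₁ ω - b| ≤ 4 / e * (W₁ ω - b) ^ 2 + e / 4 := by
          rw [← sq_abs]
          set y := |W₁ ω - b|
          have : 4 / e * y ^ 2 + e / 4 - y = (4 / e) * (y - e / 8) ^ 2 + 3 * e / 16 := by
            field_simp; ring
          have h3 : 0 ≤ (4 / e) * (y - e / 8) ^ 2 := by positivity
          linarith
        have t1 : Z n ω * W₂ ω ≤ W₂ ω := mul_le_of_le_one_left hW2 hz1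
        have t2 : Z n ω * (W₁ ω - b) ≤ |W₁ ω - b| :=
          (mul_le_mul_of_nonneg_left (le_abs_self _) hz0).trans
            (mul_le_of_le_one_left (abs_nonneg _) hz1)
        change Z n ω * (W₁ ω + W₂ ω) ≤ W₂ ω + _
        linarith
    _ = _ := by
        rw [integral_add hn2 hC, integral_add hB ((hZi n).const_mul _),
          integral_add hA (integrable_const _), integral_const_mul, integral_const_mul]
        simp only [integral_const, probReal_univ, one_smul]
        rfl

/-- Expectations of products over the independent design variables factorise. -/
theorem LocalDesign.integral_prod (H : LocalDesign P f X h x) (n : ℕ) {g : ℕ → ℝ → ℝ}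
    (hg : ∀ l, Measurable (g l)) :
    ∫ ω, ∏ l ∈ Finset.range n, g l (X l ω) ∂P = ∏ l ∈ Finset.range n, ∫ ω, g l (X l ω) ∂P := by
  have hind : iIndepFun (fun (l : Fin n) => X l) P := H.iIndep.precomp Fin.val_injective
  have := hind.integral_fun_prod_comp (f := fun (l : Fin n) => g l)
    (fun l => (H.measurable_X l).aemeasurable) (fun l => (hg l).aestronglyMeasurable)
  simp only [Finset.prod_range]
  exact this

/-- Exponential moments of a sum of nonnegative functions of the design, in the presence of at most
two factors `φ`: each of these costs a factor of order `h`. -/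
theorem LocalDesign.eventually_exp_moment (H : LocalDesign P f X h x) (hχ : IsTest χ)
    (hχ0 : ∀ v, 0 ≤ χ v) (hχp : 0 < ∫ v, χ v) (hφ : IsTest φ) (hφ0 : ∀ v, 0 ≤ φ v)
    (hφ2 : Integrable fun v => φ v ^ 2) :
    ∃ κ B : ℝ, 0 < κ ∧ 0 ≤ B ∧ ∀ᶠ n : ℕ in atTop,
      (∫ ω, Real.exp (-∑ l ∈ Finset.range n, χ ((x - X l ω) / h n)) ∂P
        ≤ Real.exp (-(κ * (n * h n)))) ∧
      ∀ i ∈ Finset.range n, ∀ j ∈ Finset.range n,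
        ∫ ω, Real.exp (-∑ l ∈ Finset.range n, χ ((x - X l ω) / h n)) *
          (φ ((x - X i ω) / h n) * φ ((x - X j ω) / h n)) ∂P
        ≤ Real.exp (-(κ * (n * h n))) * (if i = j then B * h n else (B * h n) * (B * h n)) := by
  have := H.isProbabilityMeasure
  have hχm := hχ.measurable
  have hφm := hφ.measurable
  obtain ⟨L, hL⟩ := hχ.bounded_support
  set g : ℝ → ℝ := fun v => 1 - Real.exp (-χ v) with hg
  have hgm : Measurable g := by fun_prop
  have hg0 : ∀ v, 0 ≤ g v := fun v => by
    simp only [hg, sub_nonneg, Real.exp_le_one_iff]; linarith [hχ0 v]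
  have hgle : ∀ v, g v ≤ χ v := fun v => by
    have := Real.add_one_le_exp (-χ v)
    simp only [hg]; linarith
  have hgi : Integrable g := hχ.integrable.mono' hgm.aestronglyMeasurable
    (Eventually.of_forall fun v => by
      rw [Real.norm_eq_abs, abs_of_nonneg (hg0 v)]; exact hgle v)
  have hgt : IsTest g := ⟨hgm, hgi, L, fun v hv => hL v fun h0 => hv (by simp [hg, h0])⟩
  have hgp : 0 < ∫ v, g v := by
    rw [integral_pos_iff_support_of_nonneg hg0 hgi]
    rw [integral_pos_iff_support_of_nonneg hχ0 hχ.integrable] at hχp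
    refine hχp.trans_le (measure_mono fun v hv => ?_)
    simp only [Function.mem_support, hg] at hv ⊢
    intro h0
    have : Real.exp (-χ v) = 1 := by linarith
    exact hv (by simpa using this)
  -- `E exp (-χ) = 1 - E g ≤ exp (-κ h)` for each design variable
  set κ := f x / 2 * ∫ v, g v with hκ
  have hκp : 0 < κ := mul_pos (half_pos H.pos_f) hgp
  set B := Real.exp κ * (2 * f x * ((∫ v, φ v) + ∫ v, φ v ^ 2)) with hB
  have hI1 : 0 ≤ ∫ v, φ v := integral_nonneg hφ0
  have hI2 : 0 ≤ ∫ v, φ v ^ 2 := integral_nonneg fun v => sq_nonneg _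
  have hfx := H.pos_f
  have hB0 : 0 ≤ B := by positivity
  refine ⟨κ, B, hκp, hB0, ?_⟩
  filter_upwards [H.eventually_le_expectation hgt hg0, H.eventually_integrable hgt,
    H.eventually_expectation_le hφ hφ0, H.eventually_integrable hφ,
    H.eventually_expectation_le (hφ.sq hφ2) (fun v => sq_nonneg _),
    H.eventually_integrable (hφ.sq hφ2), H.tendsto_h.eventually_lt_const one_pos]
    with n e1 e2 e3 e4 e5 e6 e7
  have hh := H.pos_h n
  set ψ : ℝ → ℝ := fun y => Real.exp (-χ ((x - y) / h n)) with hψ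
  have hψm : Measurable ψ := by fun_prop
  have hψ1 : ∀ y, ψ y ≤ 1 := fun y => by
    simp only [hψ, Real.exp_le_one_iff]; linarith [hχ0 ((x - y) / h n)]
  have hψ0 : ∀ y, 0 ≤ ψ y := fun y => (Real.exp_pos _).le
  have hψE : ∀ l, ∫ ω, ψ (X l ω) ∂P ≤ Real.exp (-(κ * h n)) := by
    intro l
    have h1 : ∀ ω, ψ (X l ω) = 1 - g ((x - X l ω) / h n) := fun ω => by simp [hψ, hg]
    simp only [h1]
    rw [integral_sub (integrable_const _) (e2 l), integral_const, probReal_univ, one_smul]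
    have := Real.add_one_le_exp (-(κ * h n))
    have h2 : h n * κ ≤ ∫ ω, g ((x - X l ω) / h n) ∂P := e1 l
    linarith
  have hexp : ∀ ω, Real.exp (-∑ l ∈ Finset.range n, χ ((x - X l ω) / h n))
      = ∏ l ∈ Finset.range n, ψ (X l ω) := fun ω => by
    rw [← Finset.sum_neg_distrib, Real.exp_sum]
  have hpow : Real.exp (-(κ * (n * h n))) = ∏ _l ∈ Finset.range n, Real.exp (-(κ * h n)) := by
    rw [Finset.prod_const, Finset.card_range, ← Real.exp_nat_mul]
    congr 1; ring
  constructor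
  · simp only [hexp]
    rw [H.integral_prod n fun _ => hψm, hpow]
    exact Finset.prod_le_prod (fun l _ => integral_nonneg fun ω => hψ0 _) fun l _ => hψE l
  intro i hi j hj
  -- a factor carrying `q` is at most `h` times a constant; the lost `exp (-κ h)` is absorbed
  have hfac : ∀ q : ℝ → ℝ, (∀ v, 0 ≤ q v) → ∀ l,
      Integrable (fun ω => q ((x - X l ω) / h n)) P → Measurable q →
      ∫ ω, q ((x - X l ω) / h n) ∂P ≤ h n * (2 * f x * ∫ v, q v) →
      (∫ v, q v) ≤ (∫ v, φ v) + ∫ v, φ v ^ 2 →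
      ∫ ω, ψ (X l ω) * q ((x - X l ω) / h n) ∂P ≤ Real.exp (-(κ * h n)) * (B * h n) := by
    intro q hq0 l hqi hqm hqle hqB
    calc _ ≤ ∫ ω, q ((x - X l ω) / h n) ∂P := integral_mono_of_nonneg
          (Eventually.of_forall fun ω => mul_nonneg (hψ0 _) (hq0 _)) hqi
          (Eventually.of_forall fun ω => mul_le_of_le_one_left (hq0 _) (hψ1 _))
      _ ≤ h n * (2 * f x * ((∫ v, φ v) + ∫ v, φ v ^ 2)) := hqle.trans (by gcongr)
      _ = Real.exp 0 * (h n * (2 * f x * ((∫ v, φ v) + ∫ v, φ v ^ 2))) := by simp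
      _ ≤ Real.exp (-(κ * h n) + κ) * (h n * (2 * f x * ((∫ v, φ v) + ∫ v, φ v ^ 2))) := by
          gcongr
          nlinarith
      _ = _ := by rw [Real.exp_add, hB]; ring
  by_cases hij : i = j
  · subst hij
    rw [if_pos rfl]
    have hterm : ∀ ω, Real.exp (-∑ l ∈ Finset.range n, χ ((x - X l ω) / h n)) *
        (φ ((x - X i ω) / h n) * φ ((x - X i ω) / h n))
        = ∏ l ∈ Finset.range n,
          (fun l y => ψ y * (if l = i then φ ((x - y) / h n) ^ 2 else 1)) l (X l ω) := by
      intro ω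
      rw [hexp, Finset.prod_mul_distrib, Finset.prod_ite_eq' _ _
        (fun l => φ ((x - X l ω) / h n) ^ 2), if_pos hi, sq]
    have hfact := H.integral_prod n
      (g := fun l y => ψ y * (if l = i then φ ((x - y) / h n) ^ 2 else 1))
      (fun l => by split_ifs <;> fun_prop)
    simp only [hterm]
    rw [hfact, hpow]
    have hR : B * h n = ∏ l ∈ Finset.range n, (if l = i then B * h n else 1) := by
      rw [Finset.prod_ite_eq' _ _ (fun _ => B * h n), if_pos hi]
    rw [hR, ← Finset.prod_mul_distrib]
    refine Finset.prod_le_prod (fun l _ => integral_nonneg fun ω => mul_nonneg (hψ0 _) ?_)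
      fun l _ => ?_
    · change 0 ≤ if l = i then φ ((x - X l ω) / h n) ^ 2 else 1
      split_ifs <;> positivity
    · by_cases hl : l = i
      · simp only [if_pos hl]
        exact hfac (fun v => φ v ^ 2) (fun v => sq_nonneg _) l (e6 l) (hφm.pow_const 2) (e5 l)
          (by linarith)
      · simp only [if_neg hl, mul_one]
        exact hψE l
  · rw [if_neg hij]
    have hterm : ∀ ω, Real.exp (-∑ l ∈ Finset.range n, χ ((x - X l ω) / h n)) *
        (φ ((x - X i ω) / h n) * φ ((x - X j ω) / h n))
        = ∏ l ∈ Finset.range n, (fun l y => ψ y * ((if l = i then φ ((x - y) / h n) else 1) *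
          (if l = j then φ ((x - y) / h n) else 1))) l (X l ω) := by
      intro ω
      rw [hexp, Finset.prod_mul_distrib, Finset.prod_mul_distrib, Finset.prod_ite_eq' _ _
        (fun l => φ ((x - X l ω) / h n)), if_pos hi, Finset.prod_ite_eq' _ _
        (fun l => φ ((x - X l ω) / h n)), if_pos hj]
    have hfact := H.integral_prod n
      (g := fun l y => ψ y * ((if l = i then φ ((x - y) / h n) else 1) *
          (if l = j then φ ((x - y) / h n) else 1)))
      (fun l => by split_ifs <;> fun_prop)
    simp only [hterm]
    rw [hfact, hpow]
    have hR : (B * h n) * (B * h n) = ∏ l ∈ Finset.range n,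
        ((if l = i then B * h n else 1) * (if l = j then B * h n else 1)) := by
      rw [Finset.prod_mul_distrib, Finset.prod_ite_eq' _ _ (fun _ => B * h n), if_pos hi,
        Finset.prod_ite_eq' _ _ (fun _ => B * h n), if_pos hj]
    rw [hR, ← Finset.prod_mul_distrib]
    refine Finset.prod_le_prod (fun l _ => integral_nonneg fun ω => mul_nonneg (hψ0 _)
      (mul_nonneg ?_ ?_)) fun l _ => ?_
    · change 0 ≤ if l = i then φ ((x - X l ω) / h n) else 1
      split_ifs
      exacts [hφ0 _, zero_le_one]
    · change 0 ≤ if l = j then φ ((x - X l ω) / h n) else 1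
      split_ifs
      exacts [hφ0 _, zero_le_one]
    · by_cases hl : l = i
      · have hlj : l ≠ j := fun h => hij (hl.symm.trans h)
        simp only [if_pos hl, if_neg hlj, mul_one]
        exact hfac φ hφ0 l (e4 l) hφm (e3 l) (by linarith)
      · by_cases hlj : l = j
        · simp only [if_neg hl, if_pos hlj, one_mul]
          exact hfac φ hφ0 l (e4 l) hφm (e3 l) (by linarith)
        · simp only [if_neg hl, if_neg hlj, mul_one]
          exact hψE l

/-- The event that a kernel average of a nonnegative test function of positive integral stays below
a small threshold is negligible to every polynomial order in `n h`, also when it is weighted by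
the square of another kernel average. -/
theorem LocalDesign.exists_lower_tail (H : LocalDesign P f X h x) (hχ : IsTest χ)
    (hχ0 : ∀ v, 0 ≤ χ v) (hχp : 0 < ∫ v, χ v) (hφ : IsTest φ) (hφ0 : ∀ v, 0 ≤ φ v)
    (hφ2 : Integrable fun v => φ v ^ 2) :
    ∃ c₀ : ℝ, 0 < c₀ ∧ ∀ c, c ≤ c₀ → Tendsto (fun n : ℕ => ((n : ℝ) * h n) ^ 5 *
      ∫ ω in {ω | empAvg χ (n * h n) n (fun i => (x - X i ω) / h n) < c},
        (1 + empAvg φ (n * h n) n (fun i => (x - X i ω) / h n) ^ 2) ∂P) atTop (𝓝 0) := by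
  have := H.isProbabilityMeasure
  obtain ⟨κ, B, hκ, hB, hev⟩ := H.eventually_exp_moment hχ hχ0 hχp hφ hφ0 hφ2
  refine ⟨κ / 2, half_pos hκ, fun c hc => ?_⟩
  have hlim : Tendsto (fun n : ℕ => (2 / κ) ^ 5 * (1 + B + B ^ 2) *
      ((κ / 2 * (n * h n)) ^ 5 * Real.exp (-(κ / 2 * (n * h n))))) atTop
      (𝓝 ((2 / κ) ^ 5 * (1 + B + B ^ 2) * 0)) :=
    ((Real.tendsto_pow_mul_exp_neg_atTop_nhds_zero 5).comp
      (H.tendsto_nh.const_mul_atTop (half_pos hκ))).const_mul _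
  rw [mul_zero] at hlim
  refine tendsto_of_tendsto_of_tendsto_of_le_of_le' tendsto_const_nhds hlim
    (Eventually.of_forall fun n => mul_nonneg
      (pow_nonneg (mul_nonneg n.cast_nonneg (H.pos_h n).le) 5)
      (integral_nonneg fun ω => by positivity)) ?_
  filter_upwards [hev, H.eventually_memLp hφ hφ2, H.tendsto_nh.eventually_ge_atTop 1]
    with n hn hφn hN1
  obtain ⟨hn1, hn2⟩ := hn
  have hN : 0 < (n : ℝ) * h n := one_pos.trans_le hN1
  have hh := H.pos_h n
  have hXm := H.measurable_X
  have hχm := hχ.measurable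
  have hφm := hφ.measurable
  set N := (n : ℝ) * h n with hNd
  set F : Ω → ℝ := fun ω => Real.exp (-∑ l ∈ Finset.range n, χ ((x - X l ω) / h n)) with hF
  have hFm : Measurable F := by fun_prop
  have hF0 : ∀ ω, 0 ≤ F ω := fun ω => (Real.exp_pos _).le
  have hF1 : ∀ ω, F ω ≤ 1 := fun ω => by
    simp only [hF, Real.exp_le_one_iff, neg_nonpos]
    exact Finset.sum_nonneg fun _ _ => hχ0 _
  have hFi : Integrable F P := Integrable.of_bound hFm.aestronglyMeasurable 1
    (Eventually.of_forall fun ω => by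
      rw [Real.norm_eq_abs, abs_of_nonneg (hF0 ω)]; exact hF1 ω)
  have hFφ : ∀ i j, Integrable
      (fun ω => F ω * (φ ((x - X i ω) / h n) * φ ((x - X j ω) / h n))) P := fun i j => by
    refine ((hφn i).integrable_mul (hφn j)).mono' (by fun_prop)
      (Eventually.of_forall fun ω => ?_)
    have h0 := mul_nonneg (hφ0 ((x - X i ω) / h n)) (hφ0 ((x - X j ω) / h n))
    rw [Real.norm_eq_abs, abs_of_nonneg (mul_nonneg (hF0 ω) h0)]
    exact mul_le_of_le_one_left h0 (hF1 ω)
  have hdbl : Integrable (fun ω => N⁻¹ ^ 2 * ∑ i ∈ Finset.range n, ∑ j ∈ Finset.range n,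
      F ω * (φ ((x - X i ω) / h n) * φ ((x - X j ω) / h n))) P :=
    (integrable_finsetSum _ fun i _ => integrable_finsetSum _ fun j _ => hFφ i j).const_mul _
  have hsq : ∀ ω, F ω * (1 + empAvg φ N n (fun i => (x - X i ω) / h n) ^ 2)
      = F ω + N⁻¹ ^ 2 * ∑ i ∈ Finset.range n, ∑ j ∈ Finset.range n,
      F ω * (φ ((x - X i ω) / h n) * φ ((x - X j ω) / h n)) := by
    intro ω
    simp only [← Finset.mul_sum]
    rw [← Finset.sum_mul, empAvg]
    ring
  have hGi : Integrable (fun ω => F ω * (1 + empAvg φ N n (fun i => (x - X i ω) / h n) ^ 2)) P := by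
    simp only [hsq]
    exact hFi.add hdbl
  have hEm : MeasurableSet {ω | empAvg χ N n (fun i => (x - X i ω) / h n) < c} :=
    measurableSet_lt (measurable_empAvg hχm hXm _ _ _) measurable_const
  -- `n` diagonal terms of order `h` and `n ^ 2` other terms of order `h ^ 2`
  have hcount : N⁻¹ ^ 2 * ∑ i ∈ Finset.range n, ∑ j ∈ Finset.range n,
      (if i = j then B * h n else (B * h n) * (B * h n)) ≤ B + B ^ 2 := by
    have h1 : ∀ i ∈ Finset.range n, ∑ j ∈ Finset.range n,
        (if i = j then B * h n else (B * h n) * (B * h n)) ≤ B * h n + n * (B * h n) ^ 2 := by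
      intro i hi
      calc _ ≤ ∑ j ∈ Finset.range n, ((if i = j then B * h n else 0) + (B * h n) ^ 2) := by
            refine Finset.sum_le_sum fun j _ => ?_
            split_ifs
            · nlinarith [sq_nonneg (B * h n)]
            · exact le_of_eq (by ring)
        _ = _ := by
            rw [Finset.sum_add_distrib, Finset.sum_ite_eq _ i (fun _ => B * h n), if_pos hi,
              Finset.sum_const, Finset.card_range, nsmul_eq_mul]
    calc _ ≤ N⁻¹ ^ 2 * ∑ i ∈ Finset.range n, (B * h n + n * (B * h n) ^ 2) := by
          gcongr with i hi
          exact h1 i hi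
      _ = N⁻¹ ^ 2 * (B * N + B ^ 2 * N ^ 2) := by
          rw [Finset.sum_const, Finset.card_range, nsmul_eq_mul, hNd]; ring
      _ = B * N⁻¹ + B ^ 2 := by field_simp
      _ ≤ B * 1 + B ^ 2 := by gcongr; exact inv_le_one_of_one_le₀ hN1
      _ = _ := by ring
  have hGE : ∫ ω, F ω * (1 + empAvg φ N n (fun i => (x - X i ω) / h n) ^ 2) ∂P
      ≤ Real.exp (-(κ * N)) * (1 + B + B ^ 2) := by
    simp only [hsq]
    rw [integral_add hFi hdbl, integral_const_mul, integral_finsetSum _ fun i _ =>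
      integrable_finsetSum _ fun j _ => hFφ i j]
    calc _ ≤ Real.exp (-(κ * N)) + N⁻¹ ^ 2 * ∑ i ∈ Finset.range n, ∑ j ∈ Finset.range n,
          Real.exp (-(κ * N)) * (if i = j then B * h n else (B * h n) * (B * h n)) := by
          gcongr with i hi
          rw [integral_finsetSum _ fun j _ => hFφ i j]
          exact Finset.sum_le_sum fun j hj => hn2 i hi j hj
      _ = Real.exp (-(κ * N)) * (1 + N⁻¹ ^ 2 * ∑ i ∈ Finset.range n, ∑ j ∈ Finset.range n,
          (if i = j then B * h n else (B * h n) * (B * h n))) := by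
          simp only [← Finset.mul_sum]; ring
      _ ≤ Real.exp (-(κ * N)) * (1 + (B + B ^ 2)) := by gcongr
      _ = _ := by ring
  -- on the event, `exp (κ / 2 * N) * F` is at least one
  have hset : ∫ ω in {ω | empAvg χ N n (fun i => (x - X i ω) / h n) < c},
      (1 + empAvg φ N n (fun i => (x - X i ω) / h n) ^ 2) ∂P
      ≤ Real.exp (κ / 2 * N) * (Real.exp (-(κ * N)) * (1 + B + B ^ 2)) := by
    rw [← integral_indicator hEm]
    refine le_trans ?_ (mul_le_mul_of_nonneg_left hGE (Real.exp_pos _).le)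
    rw [← integral_const_mul]
    refine integral_mono_of_nonneg (Eventually.of_forall fun ω =>
      Set.indicator_nonneg (fun ω _ => by positivity) ω) (hGi.const_mul _)
      (Eventually.of_forall fun ω => ?_)
    change Set.indicator _ _ ω ≤ Real.exp (κ / 2 * N) * (F ω * _)
    by_cases hω : ω ∈ {ω | empAvg χ N n (fun i => (x - X i ω) / h n) < c}
    · rw [Set.indicator_of_mem hω, ← mul_assoc]
      refine le_mul_of_one_le_left (by positivity) ?_
      simp only [hF]
      rw [← Real.exp_add, Real.one_le_exp_iff]
      have h1 : empAvg χ N n (fun i => (x - X i ω) / h n) < c := hω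
      rw [empAvg, inv_mul_lt_iff₀ hN] at h1
      nlinarith
    · rw [Set.indicator_of_notMem hω]
      have := hF0 ω
      positivity
  calc _ ≤ N ^ 5 * (Real.exp (κ / 2 * N) * (Real.exp (-(κ * N)) * (1 + B + B ^ 2))) := by
        gcongr
    _ = N ^ 5 * (Real.exp (κ / 2 * N + -(κ * N)) * (1 + B + B ^ 2)) := by
        rw [Real.exp_add]; ring
    _ = (2 / κ) ^ 5 * (1 + B + B ^ 2) * ((κ / 2 * N) ^ 5 * Real.exp (-(κ / 2 * N))) := by
        rw [show κ / 2 * N + -(κ * N) = -(κ / 2 * N) by ring]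
        field_simp

end

/-! ### Local moments of the design -/

section

variable {Ω : Type*} [MeasurableSpace Ω] {P : Measure Ω} {f K : ℝ → ℝ} {X : ℕ → Ω → ℝ} {h : ℕ → ℝ}
  {x : ℝ} {φ χ : ℝ → ℝ}

theorem IsKernel.exists_bound (hK : IsKernel K) : ∃ L, 0 ≤ L ∧ ∀ v, K v ≠ 0 → |v| ≤ L := by
  obtain ⟨L, hL⟩ := hK.compactSupport.isCompact.isBounded.subset_closedBall (0 : ℝ)
  refine ⟨max L 0, le_max_right _ _, fun v hv => ?_⟩
  have := hL (subset_tsupport K hv)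
  rw [mem_closedBall_zero_iff, Real.norm_eq_abs] at this
  exact this.trans (le_max_left _ _)

theorem IsTest.comp_add (hφ : IsTest φ) (t : ℝ) : IsTest fun v => φ (v + t) := by
  obtain ⟨L, hL⟩ := hφ.bounded_support
  have := hφ.measurable
  refine ⟨by fun_prop, hφ.integrable.comp_add_right t, L + |t|, fun v hv => ?_⟩
  have h1 := hL _ hv
  have h2 := abs_sub (v + t) t
  rw [add_sub_cancel_right] at h2
  linarith

theorem IsKernel.isTest (hK : IsKernel K) : IsTest K := by
  obtain ⟨L, -, hL⟩ := hK.exists_bound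
  exact ⟨hK.measurable, hK.integrable, L, hL⟩

theorem IsKernel.integrable_sq (hK : IsKernel K) : Integrable fun v => K v ^ 2 :=
  hK.sq_integrable.integrable_sq

/-- Multiplication by a function that is bounded by `b` preserves test functions. -/
theorem IsTest.mul_bdd (hφ : IsTest φ) {g : ℝ → ℝ} (hg : Measurable g) {b : ℝ}
    (hb : ∀ v, φ v ≠ 0 → |g v| ≤ b) : IsTest fun v => g v * φ v := by
  obtain ⟨L, hL⟩ := hφ.bounded_support
  refine ⟨hg.mul hφ.measurable, ?_, L, fun v hv => hL v (right_ne_zero_of_mul hv)⟩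
  refine (hφ.integrable.abs.const_mul b).mono' (hg.mul hφ.measurable).aestronglyMeasurable
    (Eventually.of_forall fun v => ?_)
  rw [Real.norm_eq_abs, abs_mul]
  by_cases hv : φ v = 0
  · simp [hv]
  · exact mul_le_mul_of_nonneg_right (hb v hv) (abs_nonneg _)

theorem IsKernel.isTest_moment (hK : IsKernel K) (l : ℕ) : IsTest fun v => v ^ l * K v := by
  obtain ⟨L, -, hL⟩ := hK.exists_bound
  refine hK.isTest.mul_bdd (by fun_prop) (b := L ^ l) fun v hv => ?_
  rw [abs_pow]
  exact pow_le_pow_left₀ (abs_nonneg _) (hL v hv) l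

theorem IsKernel.integrable_moment_sq (hK : IsKernel K) (l : ℕ) :
    Integrable fun v => (v ^ l * K v) ^ 2 := by
  obtain ⟨L, -, hL⟩ := hK.exists_bound
  have h1 := (hK.isTest.sq hK.integrable_sq).mul_bdd (g := fun v => (v ^ l) ^ 2) (by fun_prop)
    (b := (L ^ l) ^ 2) fun v hv => by
      have hv' : K v ≠ 0 := fun h0 => hv (by simp [h0])
      rw [abs_pow, abs_pow]
      exact pow_le_pow_left₀ (by positivity) (pow_le_pow_left₀ (abs_nonneg _) (hL v hv') l) 2
  simpa only [mul_pow] using h1.integrable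

theorem IsKernel.integral_moment_one (hK : IsKernel K) : ∫ v, v ^ 1 * K v = 0 := by
  have h1 := integral_neg_eq_self (fun v => v ^ 1 * K v) volume
  have h2 : ∫ v, (-v) ^ 1 * K (-v) = - ∫ v, v ^ 1 * K v := by
    rw [← integral_neg]
    refine integral_congr_ae (Eventually.of_forall fun v => ?_)
    simp [hK.symm]
  linarith

/-- A symmetric density puts positive mass on both sides of the origin, away from it. -/
theorem IsKernel.exists_pos_mass (hK : IsKernel K) : ∃ a, 0 < a ∧
    0 < ∫ v, (Set.Ici a).indicator K v ∧ 0 < ∫ v, (Set.Iic (-a)).indicator K v := by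
  have hsym : ∀ b : ℝ, ∫ v in Set.Iic (-b), K v = ∫ v in Set.Ici b, K v := fun b => by
    rw [integral_Ici_eq_integral_Ioi]
    have := integral_comp_neg_Iic (-b) K
    simpa [hK.symm] using this
  have hhalf : 0 < ∫ v in Set.Ioi (0 : ℝ), K v := by
    have h1 := intervalIntegral.integral_Iic_add_Ioi (b := (0 : ℝ)) hK.integrable.integrableOn
      hK.integrable.integrableOn
    have h2 := hsym 0
    rw [neg_zero, integral_Ici_eq_integral_Ioi] at h2
    rw [hK.integral_eq_one, h2] at h1
    linarith
  have hU : ⋃ n : ℕ, Set.Ici (1 / ((n : ℝ) + 1)) = Set.Ioi 0 := by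
    ext v
    simp only [Set.mem_iUnion, Set.mem_Ici, Set.mem_Ioi]
    constructor
    · rintro ⟨n, hn⟩
      exact lt_of_lt_of_le (by positivity) hn
    · intro hv
      obtain ⟨n, hn⟩ := exists_nat_one_div_lt hv
      exact ⟨n, hn.le⟩
  have hlim := tendsto_setIntegral_of_monotone (μ := volume) (f := K)
    (s := fun n : ℕ => Set.Ici (1 / ((n : ℝ) + 1))) (fun _ => measurableSet_Ici)
    (fun i j hij => Set.Ici_subset_Ici.2 (by gcongr)) hK.integrable.integrableOn
  rw [hU] at hlim
  obtain ⟨n, hn⟩ := (hlim.eventually_const_lt hhalf).exists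
  refine ⟨1 / ((n : ℝ) + 1), by positivity, ?_, ?_⟩
  · rwa [integral_indicator measurableSet_Ici]
  · rw [integral_indicator measurableSet_Iic, hsym]
    exact hn

theorem IsTest.indicator (hφ : IsTest φ) {E : Set ℝ} (hE : MeasurableSet E) :
    IsTest (E.indicator φ) := by
  obtain ⟨L, hL⟩ := hφ.bounded_support
  exact ⟨hφ.measurable.indicator hE, hφ.integrable.indicator hE, L,
    fun v hv => hL v fun h0 => hv (by simp [h0])⟩

/-- The design points, rescaled around the point of estimation `x + h t`. -/
noncomputable def scaledDesign (X : ℕ → Ω → ℝ) (h x t : ℝ) (ω : Ω) (i : ℕ) : ℝ :=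
  (x - X i ω) / h + t

omit [MeasurableSpace Ω] in
theorem locMom_scaledDesign (N h t : ℝ) (n : ℕ) (ω : Ω) (l : ℕ) :
    locMom K N n (scaledDesign X h x t ω) l
      = empAvg (fun v => (v + t) ^ l * K (v + t)) N n fun i => (x - X i ω) / h := rfl

theorem measurable_scaledDesign (hX : ∀ i, Measurable (X i)) (h t : ℝ) (i : ℕ) :
    Measurable fun ω => scaledDesign X h x t ω i := by
  have := hX i
  unfold scaledDesign
  fun_prop

theorem measurable_locMom (hK : Measurable K) (hX : ∀ i, Measurable (X i)) (N h t : ℝ) (n l : ℕ) :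
    Measurable fun ω => locMom K N n (scaledDesign X h x t ω) l := by
  simp only [locMom_scaledDesign]
  exact measurable_empAvg (by fun_prop) hX _ _ _

theorem measurable_locWt (hK : Measurable K) (hX : ∀ i, Measurable (X i)) (N h t : ℝ) (n i : ℕ) :
    Measurable fun ω => locWt K N n (scaledDesign X h x t ω) i := by
  have h1 := fun l => measurable_locMom (x := x) hK hX N h t n l
  have h2 := measurable_scaledDesign (x := x) hX h t i
  unfold locWt locDen
  fun_prop

theorem measurableSet_goodDesign (hK : Measurable K) (hX : ∀ i, Measurable (X i)) (a c N h t : ℝ)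
    (n : ℕ) : MeasurableSet {ω | GoodDesign K a c N n (scaledDesign X h x t ω)} := by
  have h2 := fun i => measurable_scaledDesign (x := x) hX h t i
  have h3 := hK.indicator (measurableSet_Ici (a := a))
  have h4 := hK.indicator (measurableSet_Iic (a := -a))
  have h5 : Measurable fun ω => N⁻¹ * ∑ i ∈ Finset.range n,
      (Set.Ici a).indicator K (scaledDesign X h x t ω i) := by fun_prop
  have h6 : Measurable fun ω => N⁻¹ * ∑ i ∈ Finset.range n,
      (Set.Iic (-a)).indicator K (scaledDesign X h x t ω i) := by fun_prop
  exact (measurableSet_le measurable_const h5).inter (measurableSet_le measurable_const h6)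

theorem LocalDesign.eventually_memLp_locMom (H : LocalDesign P f X h x) (hK : IsKernel K) (t : ℝ)
    (l : ℕ) :
    ∀ᶠ n in atTop, MemLp (fun ω => locMom K (n * h n) n (scaledDesign X (h n) x t ω) l) 2 P := by
  simp only [locMom_scaledDesign]
  exact H.eventually_memLp_empAvg ((hK.isTest_moment l).comp_add t)
    ((hK.integrable_moment_sq l).comp_add_right t)

/-- The local moments converge in mean square to `f(x) ∫ s^l K(s) ds`. -/
theorem LocalDesign.tendsto_locMom_sq (H : LocalDesign P f X h x) (hK : IsKernel K) (t : ℝ)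
    (l : ℕ) :
    Tendsto (fun n : ℕ => ∫ ω, (locMom K (n * h n) n (scaledDesign X (h n) x t ω) l
      - f x * ∫ v, v ^ l * K v) ^ 2 ∂P) atTop (𝓝 0) := by
  simp only [locMom_scaledDesign]
  have h1 := H.tendsto_sq ((hK.isTest_moment l).comp_add t)
    ((hK.integrable_moment_sq l).comp_add_right t)
  rwa [integral_add_right_eq_self (fun v => v ^ l * K v) t] at h1

/-- Badly spread designs are negligible to a high polynomial order in `n h`, also when weighted by
the square of a kernel average. -/
theorem LocalDesign.exists_goodDesign (H : LocalDesign P f X h x) (hK : IsKernel K) (t : ℝ)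
    (hφ : IsTest φ) (hφ0 : ∀ v, 0 ≤ φ v) (hφ2 : Integrable fun v => φ v ^ 2) :
    ∃ a c, 0 < a ∧ 0 < c ∧ Tendsto (fun n : ℕ => ((n : ℝ) * h n) ^ 5 *
      ∫ ω in {ω | ¬ GoodDesign K a c (n * h n) n (scaledDesign X (h n) x t ω)},
        (1 + empAvg φ (n * h n) n (fun i => (x - X i ω) / h n) ^ 2) ∂P) atTop (𝓝 0) := by
  have := H.isProbabilityMeasure
  obtain ⟨a, ha, hp, hq⟩ := hK.exists_pos_mass
  have key : ∀ E : Set ℝ, MeasurableSet E → 0 < ∫ v, E.indicator K v →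
      ∃ c₀ : ℝ, 0 < c₀ ∧ ∀ c, c ≤ c₀ → Tendsto (fun n : ℕ => ((n : ℝ) * h n) ^ 5 *
      ∫ ω in {ω | empAvg (fun v => E.indicator K (v + t)) (n * h n) n
          (fun i => (x - X i ω) / h n) < c},
        (1 + empAvg φ (n * h n) n (fun i => (x - X i ω) / h n) ^ 2) ∂P) atTop (𝓝 0) := by
    intro E hE hpos
    refine H.exists_lower_tail ((hK.isTest.indicator hE).comp_add t)
      (fun v => Set.indicator_nonneg (fun v _ => hK.nonneg v) _) ?_ hφ hφ0 hφ2
    rwa [integral_add_right_eq_self (fun v => E.indicator K v) t]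
  obtain ⟨c₁, hc₁, h1⟩ := key (Set.Ici a) measurableSet_Ici hp
  obtain ⟨c₂, hc₂, h2⟩ := key (Set.Iic (-a)) measurableSet_Iic hq
  refine ⟨a, min c₁ c₂, ha, lt_min hc₁ hc₂, ?_⟩
  have hsum := (h1 (min c₁ c₂) (min_le_left _ _)).add (h2 (min c₁ c₂) (min_le_right _ _))
  rw [add_zero] at hsum
  refine tendsto_of_tendsto_of_tendsto_of_le_of_le' tendsto_const_nhds hsum
    (Eventually.of_forall fun n => mul_nonneg
      (pow_nonneg (mul_nonneg n.cast_nonneg (H.pos_h n).le) 5)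
      (integral_nonneg fun ω => by positivity)) ?_
  filter_upwards [H.eventually_memLp_empAvg hφ hφ2] with n hn
  have hN : 0 ≤ (n : ℝ) * h n := mul_nonneg n.cast_nonneg (H.pos_h n).le
  have hint : Integrable
      (fun ω => 1 + empAvg φ (n * h n) n (fun i => (x - X i ω) / h n) ^ 2) P :=
    (integrable_const _).add hn.integrable_sq
  rw [← mul_add]
  refine mul_le_mul_of_nonneg_left ?_ (pow_nonneg hN 5)
  rw [← integral_add_measure hint.integrableOn hint.integrableOn]
  refine integral_mono_measure ?_ (Eventually.of_forall fun ω => by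
    change (0 : ℝ) ≤ _; positivity) (hint.restrict.add_measure hint.restrict)
  refine le_trans (Measure.restrict_mono (fun ω hω => ?_) le_rfl) (Measure.restrict_union_le _ _)
  simp only [Set.mem_ofPred_eq, GoodDesign, not_and_or, not_le] at hω
  exact hω

/-! ### Local linear smoothing of a locally quadratic function -/

/-- A Taylor expansion of second order with Peano remainder. -/
theorem eventually_taylor {m : ℝ → ℝ} (hm1 : ∀ᶠ y in 𝓝 x, DifferentiableAt ℝ m y)
    (hm2 : DifferentiableAt ℝ (deriv m) x) {η : ℝ} (hη : 0 < η) :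
    ∀ᶠ y in 𝓝 x, |m y - (m x + deriv m x * (y - x) + 1 / 2 * deriv (deriv m) x * (y - x) ^ 2)|
      ≤ η * (y - x) ^ 2 := by
  set F : ℝ → ℝ := fun y => m y - (m x + deriv m x * (y - x)
    + 1 / 2 * deriv (deriv m) x * (y - x) ^ 2) with hF
  have h1 := hm2.hasDerivAt.isLittleO.def hη
  obtain ⟨ε, hε, hb⟩ := Metric.eventually_nhds_iff.1 (hm1.and h1)
  refine Metric.eventually_nhds_iff.2 ⟨ε, hε, fun y hy => ?_⟩
  have hderiv : ∀ z ∈ Metric.closedBall x |y - x|, HasDerivWithinAt F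
      (deriv m z - (deriv m x + deriv (deriv m) x * (z - x))) (Metric.closedBall x |y - x|) z := by
    intro z hz
    have hz' : dist z x < ε := (Metric.mem_closedBall.1 hz).trans_lt (by rwa [← Real.dist_eq])
    have hd := (hb hz').1.hasDerivAt
    have hq : HasDerivAt (fun y => m x + deriv m x * (y - x)
        + 1 / 2 * deriv (deriv m) x * (y - x) ^ 2)
        (deriv m x * 1 + 1 / 2 * deriv (deriv m) x * (2 * (z - x) ^ 1 * 1)) z := by
      have hid : HasDerivAt (fun y : ℝ => y - x) 1 z := (hasDerivAt_id z).sub_const x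
      exact ((hid.const_mul _).const_add _).add ((hid.pow 2).const_mul _)
    refine ((hd.sub hq).congr_deriv ?_).hasDerivWithinAt
    ring
  have hbound : ∀ z ∈ Metric.closedBall x |y - x|,
      ‖deriv m z - (deriv m x + deriv (deriv m) x * (z - x))‖ ≤ η * |y - x| := by
    intro z hz
    have hz1 := Metric.mem_closedBall.1 hz
    have hz' : dist z x < ε := hz1.trans_lt (by rwa [← Real.dist_eq])
    have := (hb hz').2
    rw [Real.dist_eq] at hz1
    have h3 : deriv m z - deriv m x - (z - x) • deriv (deriv m) x
        = deriv m z - (deriv m x + deriv (deriv m) x * (z - x)) := by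
      rw [smul_eq_mul]; ring
    rw [h3] at this
    exact this.trans (by rw [Real.norm_eq_abs (z - x)]; gcongr)
  have := (convex_closedBall x |y - x|).norm_image_sub_le_of_norm_hasDerivWithin_le hderiv hbound
    (Metric.mem_closedBall_self (abs_nonneg _)) (y := y) (by simp [Real.dist_eq])
  have hFx : F x = 0 := by simp [hF]
  rw [hFx, sub_zero, Real.norm_eq_abs, Real.norm_eq_abs, mul_assoc, ← sq, sq_abs] at this
  exact this

section Deterministic

variable {a c L N : ℝ} {n : ℕ} {u : ℕ → ℝ}

theorem inv_pow_div_locDen_le_one (hK0 : ∀ v, 0 ≤ K v) (hN : 0 < N) :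
    (N ^ 4)⁻¹ / locDen K N n u ≤ 1 := by
  rw [div_le_one (locDen_pos hK0 hN)]
  exact le_add_of_nonneg_left (locMom_det_nonneg hK0)

/-- The smoothing error for a quadratic polynomial in the rescaled design plus a remainder. -/
theorem sum_locWt_quadratic (hK0 : ∀ v, 0 ≤ K v) (hN : 0 < N) (p₀ p₁ p₂ ν : ℝ) (R : ℕ → ℝ) :
    ∑ i ∈ Finset.range n, locWt K N n u i * (p₀ + p₁ * u i + p₂ * u i ^ 2 + R i) - (p₀ + p₂ * ν)
      = -(p₀ * ((N ^ 4)⁻¹ / locDen K N n u))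
        + p₂ * (∑ i ∈ Finset.range n, locWt K N n u i * u i ^ 2 - ν)
        + ∑ i ∈ Finset.range n, locWt K N n u i * R i := by
  have h1 := sum_locWt (n := n) (u := u) hK0 hN
  have h2 := sum_locWt_mul (K := K) (N := N) (n := n) (u := u)
  have e : ∀ i ∈ Finset.range n, locWt K N n u i * (p₀ + p₁ * u i + p₂ * u i ^ 2 + R i)
      = p₀ * locWt K N n u i + p₁ * (locWt K N n u i * u i)
        + p₂ * (locWt K N n u i * u i ^ 2) + locWt K N n u i * R i := fun i _ => by ring
  rw [Finset.sum_congr rfl e]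
  simp only [Finset.sum_add_distrib, ← Finset.mul_sum]
  rw [h1, h2]
  ring

theorem abs_sum_locWt_mul_le {R : ℕ → ℝ} {η : ℝ} (hR : ∀ i, K (u i) ≠ 0 → |R i| ≤ η) :
    |∑ i ∈ Finset.range n, locWt K N n u i * R i|
      ≤ η * ∑ i ∈ Finset.range n, |locWt K N n u i| := by
  refine (Finset.abs_sum_le_sum_abs _ _).trans ?_
  rw [Finset.mul_sum]
  refine Finset.sum_le_sum fun i _ => ?_
  by_cases hi : K (u i) = 0
  · simp [locWt, hi]
  · rw [abs_mul, mul_comm]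
    exact mul_le_mul_of_nonneg_right (hR i hi) (abs_nonneg _)

/-- A bound valid for every design. -/
theorem abs_smoothing_error_le (hK0 : ∀ v, 0 ≤ K v) (hKL : ∀ v, K v ≠ 0 → |v| ≤ L) (hL : 0 ≤ L)
    (hN : 0 < N) (p₀ p₁ p₂ ν : ℝ) {R : ℕ → ℝ} {η : ℝ} (hη : 0 ≤ η)
    (hR : ∀ i, K (u i) ≠ 0 → |R i| ≤ η) :
    |∑ i ∈ Finset.range n, locWt K N n u i * (p₀ + p₁ * u i + p₂ * u i ^ 2 + R i) - (p₀ + p₂ * ν)|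
      ≤ |p₀| + |p₂| * |ν| + (|p₂| * L ^ 2 + η) * (L * N ^ 2 * locMom K N n u 0) := by
  have hS := sum_abs_locWt_le (n := n) (u := u) hK0 hKL hL hN
  rw [sum_locWt_quadratic hK0 hN]
  have hτ1 := inv_pow_div_locDen_le_one (n := n) (u := u) hK0 hN
  have hτ0 : 0 ≤ (N ^ 4)⁻¹ / locDen K N n u := by
    have := locDen_pos (n := n) (u := u) hK0 hN
    positivity
  have h1 : |-(p₀ * ((N ^ 4)⁻¹ / locDen K N n u))| ≤ |p₀| := by
    rw [abs_neg, abs_mul, abs_of_nonneg hτ0]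
    exact mul_le_of_le_one_right (abs_nonneg _) hτ1
  have h2 : |∑ i ∈ Finset.range n, locWt K N n u i * u i ^ 2 - ν|
      ≤ L ^ 2 * (L * N ^ 2 * locMom K N n u 0) + |ν| := by
    refine (abs_sub _ _).trans (add_le_add ((abs_sum_locWt_mul_le fun i hi => ?_).trans
      (mul_le_mul_of_nonneg_left hS (sq_nonneg L))) le_rfl)
    rw [abs_pow]
    exact pow_le_pow_left₀ (abs_nonneg _) (hKL _ hi) 2
  have h3 := (abs_sum_locWt_mul_le (n := n) (N := N) hR).trans (mul_le_mul_of_nonneg_left hS hη)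
  have h2' : |p₂ * (∑ i ∈ Finset.range n, locWt K N n u i * u i ^ 2 - ν)|
      ≤ |p₂| * (L ^ 2 * (L * N ^ 2 * locMom K N n u 0) + |ν|) := by
    rw [abs_mul]
    exact mul_le_mul_of_nonneg_left h2 (abs_nonneg _)
  refine (abs_add_le _ _).trans
    ((add_le_add ((abs_add_le _ _).trans (add_le_add h1 h2')) h3).trans (le_of_eq ?_))
  ring

/-- On a well spread design the smoothing error of a quadratic polynomial is controlled by the
deviations of the local moments from their limits. -/
theorem GoodDesign.exists_smoothing_error (hK0 : ∀ v, 0 ≤ K v) (hKL : ∀ v, K v ≠ 0 → |v| ≤ L)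
    (hL : 0 ≤ L) (ha : 0 < a) (hc : 0 < c) {g : ℝ} (hg0 : 0 < g) (ν : ℝ) :
    ∃ B, 0 < B ∧ ∀ (N : ℝ) (n : ℕ) (u R : ℕ → ℝ) (p₀ p₁ p₂ η : ℝ), 0 < N →
      GoodDesign K a c N n u → 0 ≤ η → (∀ i, K (u i) ≠ 0 → |R i| ≤ η) →
      |∑ i ∈ Finset.range n, locWt K N n u i * (p₀ + p₁ * u i + p₂ * u i ^ 2 + R i)
          - (p₀ + p₂ * ν)|
        ≤ B * (|p₀| * (N ^ 4)⁻¹ + |p₂| * (|locMom K N n u 2 - g * ν| + |locMom K N n u 0 - g|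
          + |locMom K N n u 1| + (N ^ 4)⁻¹) + η * (|locMom K N n u 0 - g| + 1)) := by
  obtain ⟨B, hB, hW⟩ := exists_abs_locWt_sub_le hK0 hKL hL ha hc hg0
  set B₀ := (a ^ 2 * c ^ 2)⁻¹
  set B₁ := g⁻¹ + B * L ^ 2 * (1 + g)
  set B₂ := 2 * L ^ 2 / (a ^ 2 * c) * (1 + g)
  have hB₀ : 0 < B₀ := by positivity
  have hB₁ : 0 < B₁ := by positivity
  have hB₂ : 0 ≤ B₂ := by positivity
  refine ⟨B₀ + B₁ + B₂, by positivity, fun N n u R p₀ p₁ p₂ η hN hg hη hR => ?_⟩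
  have hτ : 0 < (N ^ 4)⁻¹ := by positivity
  have hs0 := locMom_zero_nonneg (n := n) (u := u) hK0 hN
  have hd := locDen_pos (n := n) (u := u) hK0 hN
  have hd' := hg.le_locDen' hK0 hN ha hc
  rw [sum_locWt_quadratic hK0 hN]
  have h1 : |-(p₀ * ((N ^ 4)⁻¹ / locDen K N n u))| ≤ B₀ * (|p₀| * (N ^ 4)⁻¹) := by
    rw [abs_neg, abs_mul, abs_of_nonneg (by positivity : 0 ≤ (N ^ 4)⁻¹ / locDen K N n u),
      mul_left_comm]
    refine mul_le_mul_of_nonneg_left ?_ (abs_nonneg _)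
    rw [div_eq_mul_inv, mul_comm]
    exact mul_le_mul_of_nonneg_right (inv_anti₀ (by positivity) hd') hτ.le
  have hWi := hW N n u hN hg
  set s0 := locMom K N n u 0 with hs0d
  set s1 := locMom K N n u 1
  set s2 := locMom K N n u 2 with hs2d
  set τ := (N ^ 4)⁻¹
  set ρ := |s0 - g| + |s1| + τ with hρ
  have hρ0 : 0 ≤ ρ := by positivity
  have hs0le : s0 ≤ |s0 - g| + g := by have := le_abs_self (s0 - g); linarith
  have hK0s : N⁻¹ * ∑ i ∈ Finset.range n, K (u i) = s0 := by simp [hs0d, locMom]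
  have h2 : |∑ i ∈ Finset.range n, locWt K N n u i * u i ^ 2 - ν|
      ≤ B₁ * (|s2 - g * ν| + |s0 - g| + |s1| + τ) := by
    have e1 : ∑ i ∈ Finset.range n, locWt K N n u i * u i ^ 2 - ν
        = g⁻¹ * (s2 - g * ν) + ∑ i ∈ Finset.range n,
          (locWt K N n u i - N⁻¹ * K (u i) / g) * u i ^ 2 := by
      have e2 : g⁻¹ * s2 = ∑ i ∈ Finset.range n, N⁻¹ * K (u i) / g * u i ^ 2 := by
        rw [hs2d, locMom, Finset.mul_sum, Finset.mul_sum]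
        exact Finset.sum_congr rfl fun i _ => by ring
      simp only [sub_mul, Finset.sum_sub_distrib]
      rw [← e2, mul_sub, ← mul_assoc, inv_mul_cancel₀ hg0.ne']
      ring
    have e3 : |∑ i ∈ Finset.range n, (locWt K N n u i - N⁻¹ * K (u i) / g) * u i ^ 2|
        ≤ B * L ^ 2 * (min 1 ρ * s0) := by
      refine (Finset.abs_sum_le_sum_abs _ _).trans ?_
      calc _ ≤ ∑ i ∈ Finset.range n, B * min 1 ρ * (N⁻¹ * K (u i)) * L ^ 2 := by
            refine Finset.sum_le_sum fun i _ => ?_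
            by_cases hi : K (u i) = 0
            · simp [locWt, hi]
            · rw [abs_mul, abs_pow]
              have := hKL _ hi
              have h0 := (abs_nonneg _).trans (hWi i)
              exact mul_le_mul (hWi i) (pow_le_pow_left₀ (abs_nonneg _) this 2) (by positivity) h0
        _ = B * min 1 ρ * (N⁻¹ * ∑ i ∈ Finset.range n, K (u i)) * L ^ 2 := by
            rw [← Finset.sum_mul, ← Finset.mul_sum, ← Finset.mul_sum]
        _ = _ := by rw [hK0s]; ring
    have e4 : min 1 ρ * s0 ≤ (1 + g) * ρ := by
      calc min 1 ρ * s0 ≤ min 1 ρ * (|s0 - g| + g) := by gcongr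
        _ = min 1 ρ * |s0 - g| + min 1 ρ * g := by ring
        _ ≤ 1 * ρ + ρ * g := by
            gcongr
            · exact min_le_left _ _
            · rw [hρ]; linarith [abs_nonneg s1]
            · exact min_le_right _ _
        _ = _ := by ring
    rw [e1]
    refine (abs_add_le _ _).trans ?_
    rw [abs_mul, abs_of_pos (inv_pos.2 hg0)]
    have e5 : B * L ^ 2 * (min 1 ρ * s0) ≤ B * L ^ 2 * ((1 + g) * ρ) := by gcongr
    have e6 : 0 ≤ g⁻¹ * ρ := by positivity
    have e7 : 0 ≤ B * L ^ 2 * (1 + g) * |s2 - g * ν| := by positivity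
    have e8 : |s2 - g * ν| + |s0 - g| + |s1| + τ = |s2 - g * ν| + ρ := by rw [hρ]; ring
    rw [e8]
    calc _ ≤ g⁻¹ * |s2 - g * ν| + B * L ^ 2 * ((1 + g) * ρ) := by linarith
      _ ≤ g⁻¹ * |s2 - g * ν| + B * L ^ 2 * ((1 + g) * ρ)
          + (g⁻¹ * ρ + B * L ^ 2 * (1 + g) * |s2 - g * ν|) := by linarith
      _ = _ := by ring
  have h3 : |∑ i ∈ Finset.range n, locWt K N n u i * R i| ≤ B₂ * (η * (|s0 - g| + 1)) := by
    refine (abs_sum_locWt_mul_le (n := n) (N := N) hR).trans ?_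
    have e1 : ∑ i ∈ Finset.range n, |locWt K N n u i| ≤ 2 * L ^ 2 / (a ^ 2 * c) * s0 := by
      rw [← hK0s, Finset.mul_sum, Finset.mul_sum]
      exact Finset.sum_le_sum fun i _ => hg.abs_locWt_le hK0 hKL hN ha hc i
    have e2 : s0 ≤ (1 + g) * (|s0 - g| + 1) := by
      nlinarith [abs_nonneg (s0 - g)]
    calc _ ≤ η * (2 * L ^ 2 / (a ^ 2 * c) * ((1 + g) * (|s0 - g| + 1))) := by
          refine mul_le_mul_of_nonneg_left (e1.trans ?_) hη
          gcongr
      _ = _ := by ring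
  have h2' : |p₂ * (∑ i ∈ Finset.range n, locWt K N n u i * u i ^ 2 - ν)|
      ≤ B₁ * (|p₂| * (|s2 - g * ν| + |s0 - g| + |s1| + τ)) := by
    rw [abs_mul, mul_left_comm]
    exact mul_le_mul_of_nonneg_left h2 (abs_nonneg _)
  set Y₀ := |p₀| * τ
  set Y₁ := |p₂| * (|s2 - g * ν| + |s0 - g| + |s1| + τ)
  set Y₂ := η * (|s0 - g| + 1)
  have y0 : 0 ≤ Y₀ := by positivity
  have y1 : 0 ≤ Y₁ := by positivity
  have y2 : 0 ≤ Y₂ := by positivity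
  refine ((abs_add_le _ _).trans (add_le_add ((abs_add_le _ _).trans (add_le_add h1 h2')) h3)).trans
    ?_
  have : (B₀ + B₁ + B₂) * (Y₀ + Y₁ + Y₂) = B₀ * Y₀ + B₁ * Y₁ + B₂ * Y₂
      + (B₀ * (Y₁ + Y₂) + B₁ * (Y₀ + Y₂) + B₂ * (Y₀ + Y₁)) := by ring
  rw [this]
  have : 0 ≤ B₀ * (Y₁ + Y₂) + B₁ * (Y₀ + Y₂) + B₂ * (Y₀ + Y₁) := by positivity
  linarith

end Deterministic

end

/-! ### Conditional bias -/

section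

variable {Ω : Type*} [MeasurableSpace Ω] {P : Measure Ω} {f K m : ℝ → ℝ} {X : ℕ → Ω → ℝ}
  {h : ℕ → ℝ} {x : ℝ}

/-- Observations with positive kernel weight lie in any given neighbourhood of `x` once the
bandwidth is small. -/
theorem LocalDesign.eventually_near (H : LocalDesign P f X h x) {L : ℝ}
    (hL : ∀ v, K v ≠ 0 → |v| ≤ L) (t : ℝ) {p : ℝ → Prop} (hp : ∀ᶠ y in 𝓝 x, p y) :
    ∀ᶠ n in atTop, ∀ ω i, K (scaledDesign X (h n) x t ω i) ≠ 0 →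
      p (X i ω) ∧ |X i ω - x| ≤ h n * (L + |t|) := by
  obtain ⟨ε, hε, hpε⟩ := Metric.eventually_nhds_iff.1 hp
  have hlim : Tendsto (fun n => h n * (L + |t|)) atTop (𝓝 0) := by
    simpa using H.tendsto_h.mul_const (L + |t|)
  filter_upwards [hlim.eventually_lt_const hε] with n hn ω i hi
  have hh := H.pos_h n
  have h1 := hL _ hi
  have h2 : |X i ω - x| ≤ h n * (L + |t|) := by
    have e : X i ω - x = h n * (t - scaledDesign X (h n) x t ω i) := by
      rw [scaledDesign]; field_simp; ring
    rw [e, abs_mul, abs_of_pos hh]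
    refine mul_le_mul_of_nonneg_left ((abs_sub _ _).trans ?_) hh.le
    linarith
  exact ⟨hpε (by rw [Real.dist_eq]; linarith), h2⟩

/-- The error of the conditional mean of the local linear estimator at `x + h t`, with respect to
its two-term expansion. -/
noncomputable def condErr (K m : ℝ → ℝ) (X : ℕ → Ω → ℝ) (h x t : ℝ) (n : ℕ) (ω : Ω) : ℝ :=
  ∑ i ∈ Finset.range n, locWt K (n * h) n (scaledDesign X h x t ω) i * m (X i ω)
    - (m x + deriv m x * (h * t)
      + 1 / 2 * deriv (deriv m) x * h ^ 2 * (t ^ 2 + ∫ v, v ^ 2 * K v))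

/-- Pointwise bounds for the error of the conditional mean: a crude one for all designs and a sharp
one for well spread designs. -/
theorem LocalDesign.exists_condErr_le (H : LocalDesign P f X h x) (hK : IsKernel K)
    (hm1 : ∀ᶠ y in 𝓝 x, DifferentiableAt ℝ m y) (hm2 : DifferentiableAt ℝ (deriv m) x) (t : ℝ)
    {a c : ℝ} (ha : 0 < a) (hc : 0 < c) :
    ∃ B, 0 < B ∧ ∀ η, 0 < η → η ≤ 1 → ∀ᶠ n : ℕ in atTop, ∀ ω,
      |condErr K m X (h n) x t n ω| ≤ B * (1 + ((n : ℝ) * h n) ^ 2 *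
        locMom K (n * h n) n (scaledDesign X (h n) x t ω) 0) ∧
      (GoodDesign K a c (n * h n) n (scaledDesign X (h n) x t ω) →
        |condErr K m X (h n) x t n ω| ≤ B * ((((n : ℝ) * h n) ^ 4)⁻¹ + h n ^ 2 *
          (|locMom K (n * h n) n (scaledDesign X (h n) x t ω) 2 - f x * ∫ v, v ^ 2 * K v|
          + |locMom K (n * h n) n (scaledDesign X (h n) x t ω) 0 - f x|
          + |locMom K (n * h n) n (scaledDesign X (h n) x t ω) 1|
          + (((n : ℝ) * h n) ^ 4)⁻¹ + η))) := by
  obtain ⟨L, hL0, hL⟩ := hK.exists_bound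
  set g := f x with hgd
  have hg0 : 0 < g := H.pos_f
  set ν := ∫ v, v ^ 2 * K v with hν
  obtain ⟨B, hB, hgood⟩ := GoodDesign.exists_smoothing_error hK.nonneg hL hL0 ha hc hg0 ν
  set m₀ := m x with hm₀
  set m₁ := deriv m x with hm₁
  set m₂ := deriv (deriv m) x with hm₂
  set A₀ := |m₀| + |m₁| * |t| + |m₂| * t ^ 2
  set A₂ := 1 / 2 * |m₂|
  set C₁ := A₀ + A₂ * |ν| + (A₂ * L ^ 2 + 1) * L
  have hA₀ : 0 ≤ A₀ := by positivity
  have hA₂ : 0 ≤ A₂ := by positivity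
  have hC₁ : 0 ≤ C₁ := by positivity
  refine ⟨B * (A₀ + A₂ + 1) + C₁, by positivity, ?_⟩
  intro η hη hη1
  have hη' : 0 < η / ((L + |t|) ^ 2 + 1) := by positivity
  filter_upwards [H.eventually_near hL t (eventually_taylor hm1 hm2 hη'),
    H.tendsto_nh.eventually_gt_atTop 0, H.tendsto_h.eventually_le_const one_pos]
    with n hn hN hh1 ω
  have hh := H.pos_h n
  set N := (n : ℝ) * h n with hNd
  set u := scaledDesign X (h n) x t ω with hu
  set R : ℕ → ℝ := fun i => m (X i ω) - (m₀ + m₁ * (X i ω - x)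
    + 1 / 2 * m₂ * (X i ω - x) ^ 2) with hR
  have hRle : ∀ i, K (u i) ≠ 0 → |R i| ≤ η * h n ^ 2 := by
    intro i hi
    obtain ⟨h1, h2⟩ := hn ω i hi
    refine h1.trans ?_
    rw [← sq_abs (X i ω - x)]
    calc _ ≤ η / ((L + |t|) ^ 2 + 1) * (h n * (L + |t|)) ^ 2 := by gcongr
      _ = η * h n ^ 2 * ((L + |t|) ^ 2 / ((L + |t|) ^ 2 + 1)) := by ring
      _ ≤ η * h n ^ 2 * 1 := by
          gcongr
          rw [div_le_one (by positivity)]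
          linarith
      _ = _ := mul_one _
  -- the quadratic Taylor polynomial at `x`, rewritten in the rescaled design `u`
  set p₀ := m₀ + m₁ * (h n * t) + 1 / 2 * m₂ * h n ^ 2 * t ^ 2 with hp₀
  set p₁ := -(m₁ * h n + m₂ * h n ^ 2 * t) with hp₁
  set p₂ := 1 / 2 * m₂ * h n ^ 2 with hp₂
  have hmX : ∀ i, m (X i ω) = p₀ + p₁ * u i + p₂ * u i ^ 2 + R i := by
    intro i
    have e : X i ω - x = h n * (t - u i) := by
      rw [hu, scaledDesign]; field_simp; ring
    simp only [hR, e, hp₀, hp₁, hp₂]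
    ring
  have herr' : condErr K m X (h n) x t n ω = ∑ i ∈ Finset.range n, locWt K N n u i *
      (p₀ + p₁ * u i + p₂ * u i ^ 2 + R i) - (p₀ + p₂ * ν) := by
    simp only [condErr, ← hm₀, ← hm₁, ← hm₂, ← hν]
    congr 1
    · exact Finset.sum_congr rfl fun i _ => by rw [hmX i]
    · simp only [hp₀, hp₂]; ring
  have hh2 : h n ^ 2 ≤ 1 := pow_le_one₀ hh.le hh1
  have hp0le : |p₀| ≤ A₀ := by
    have e1 : |m₁ * (h n * t)| ≤ |m₁| * |t| := by
      rw [abs_mul, abs_mul, abs_of_pos hh]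
      gcongr
      exact mul_le_of_le_one_left (abs_nonneg _) hh1
    have e2 : |1 / 2 * m₂ * h n ^ 2 * t ^ 2| ≤ |m₂| * t ^ 2 := by
      rw [abs_mul, abs_mul, abs_mul, abs_of_nonneg (sq_nonneg t), abs_of_nonneg (sq_nonneg (h n))]
      gcongr
      calc |(1 / 2 : ℝ)| * |m₂| * h n ^ 2 ≤ 1 * |m₂| * 1 := by
            gcongr
            rw [abs_of_pos (by norm_num)]; norm_num
        _ = |m₂| := by ring
    exact (abs_add_le _ _).trans (add_le_add ((abs_add_le _ _).trans (add_le_add le_rfl e1)) e2)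
  have hp2e : |p₂| = A₂ * h n ^ 2 := by
    rw [hp₂, abs_mul, abs_mul, abs_of_nonneg (sq_nonneg (h n)), abs_of_pos (by norm_num)]
  have hηh : η * h n ^ 2 ≤ 1 := mul_le_one₀ hη1 (sq_nonneg _) hh2
  set s0 := locMom K N n u 0 with hs0d
  set s1 := locMom K N n u 1
  set s2 := locMom K N n u 2
  have hs0 : 0 ≤ s0 := locMom_zero_nonneg hK.nonneg hN
  constructor
  · -- the bound for arbitrary designs
    rw [herr']
    refine (abs_smoothing_error_le hK.nonneg hL hL0 hN p₀ p₁ p₂ ν (by positivity) hRle).trans ?_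
    rw [hp2e]
    rw [← hs0d]
    have y0 : 0 ≤ N ^ 2 * s0 := by positivity
    calc _ ≤ A₀ + A₂ * 1 * |ν| + (A₂ * 1 * L ^ 2 + 1) * (L * N ^ 2 * s0) := by gcongr
      _ = A₀ + A₂ * |ν| + (A₂ * L ^ 2 + 1) * L * (N ^ 2 * s0) := by ring
      _ ≤ A₀ + A₂ * |ν| + (A₂ * L ^ 2 + 1) * L * (N ^ 2 * s0)
          + ((A₂ * L ^ 2 + 1) * L + (A₀ + A₂ * |ν|) * (N ^ 2 * s0)) := by
          have : 0 ≤ (A₂ * L ^ 2 + 1) * L + (A₀ + A₂ * |ν|) * (N ^ 2 * s0) := by positivity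
          linarith
      _ = C₁ * (1 + N ^ 2 * s0) := by ring
      _ ≤ _ := by
          gcongr
          exact le_add_of_nonneg_left (by positivity)
  · intro hG
    rw [herr']
    refine (hgood N n u R p₀ p₁ p₂ (η * h n ^ 2) hN hG (by positivity) hRle).trans ?_
    rw [hp2e]
    change B * (_ + _ * (|s2 - g * ν| + |s0 - g| + |s1| + (N ^ 4)⁻¹)
      + _ * (|s0 - g| + 1)) ≤ _
    set D := |s2 - g * ν| + |s0 - g| + |s1| + (N ^ 4)⁻¹ with hD
    have hD0 : |s0 - g| ≤ D := by
      have h1 := abs_nonneg (s2 - g * ν)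
      have h2 := abs_nonneg (s1)
      have h3 : 0 ≤ (N ^ 4)⁻¹ := by positivity
      linarith
    have hDn : 0 ≤ D := (abs_nonneg _).trans hD0
    have hτ : 0 ≤ (N ^ 4)⁻¹ := by positivity
    calc _ ≤ B * (A₀ * (N ^ 4)⁻¹ + A₂ * h n ^ 2 * D + h n ^ 2 * (1 * D + η * 1)) := by
          rw [mul_comm η, mul_assoc (h n ^ 2) η, mul_add η]
          gcongr
      _ = B * (A₀ * (N ^ 4)⁻¹ + h n ^ 2 * ((A₂ + 1) * D + 1 * η)) := by ring
      _ ≤ B * ((A₀ + A₂ + 1) * (N ^ 4)⁻¹ + h n ^ 2 * ((A₀ + A₂ + 1) * D + (A₀ + A₂ + 1) * η)) := by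
          gcongr <;> linarith
      _ = B * (A₀ + A₂ + 1) * ((N ^ 4)⁻¹ + h n ^ 2 * (D + η)) := by ring
      _ ≤ _ := by
          gcongr
          exact le_add_of_nonneg_right hC₁

theorem integral_const_add_mul_sum_three [IsProbabilityMeasure P] {p q r : Ω → ℝ}
    (hp : Integrable p P) (hq : Integrable q P) (hr : Integrable r P) (k₀ k₁ : ℝ) :
    ∫ ω, (k₀ + k₁ * (p ω + q ω + r ω)) ∂P
      = k₀ + k₁ * ((∫ ω, p ω ∂P) + (∫ ω, q ω ∂P) + ∫ ω, r ω ∂P) := by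
  have hpq : Integrable (fun ω => p ω + q ω) P := hp.add hq
  have hpqr : Integrable (fun ω => p ω + q ω + r ω) P := hpq.add hr
  rw [integral_add (integrable_const _) (hpqr.const_mul _), integral_const_mul,
    integral_add hpq hr, integral_add hp hq, integral_const, probReal_univ, one_smul]

/-- The square of the bound for well spread designs, with the deviations of the local moments
separated for integration. -/
theorem sq_le_of_good (B τ H d₂ d₀ d₁ η : ℝ) :
    (B * (τ + H * (d₂ + d₀ + d₁ + τ + η))) ^ 2 ≤ (3 * B ^ 2 * τ ^ 2
      + H ^ 2 * (12 * B ^ 2 * τ ^ 2 + 3 * B ^ 2 * η ^ 2))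
      + H ^ 2 * (12 * B ^ 2) * (d₂ ^ 2 + d₀ ^ 2 + d₁ ^ 2) := by
  have q : ∀ p q r : ℝ, (p + q + r) ^ 2 ≤ 3 * (p ^ 2 + q ^ 2 + r ^ 2) := fun p q r => by
    nlinarith [sq_nonneg (p - q), sq_nonneg (q - r), sq_nonneg (p - r)]
  have q4 : (d₂ + d₀ + d₁ + τ) ^ 2 ≤ 4 * (d₂ ^ 2 + d₀ ^ 2 + d₁ ^ 2 + τ ^ 2) := by
    nlinarith [sq_nonneg (d₂ - d₀), sq_nonneg (d₂ - d₁), sq_nonneg (d₂ - τ),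
      sq_nonneg (d₀ - d₁), sq_nonneg (d₀ - τ), sq_nonneg (d₁ - τ)]
  calc _ = B ^ 2 * (τ + H * (d₂ + d₀ + d₁ + τ) + H * η) ^ 2 := by ring
    _ ≤ B ^ 2 * (3 * (τ ^ 2 + (H * (d₂ + d₀ + d₁ + τ)) ^ 2 + (H * η) ^ 2)) :=
        mul_le_mul_of_nonneg_left (q _ _ _) (sq_nonneg B)
    _ = B ^ 2 * (3 * (τ ^ 2 + H ^ 2 * (d₂ + d₀ + d₁ + τ) ^ 2 + (H * η) ^ 2)) := by ring
    _ ≤ B ^ 2 * (3 * (τ ^ 2 + H ^ 2 * (4 * (d₂ ^ 2 + d₀ ^ 2 + d₁ ^ 2 + τ ^ 2)) + (H * η) ^ 2)) := by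
        gcongr
    _ = _ := by ring

/-- The square of the bound for arbitrary designs costs a factor `N ^ 4`. -/
theorem sq_le_of_bad (B N s : ℝ) (hN : 1 ≤ N) :
    (B * (1 + N ^ 2 * s)) ^ 2 ≤ 2 * B ^ 2 * N ^ 4 * (1 + s ^ 2) := by
  have h1 : (1 : ℝ) ≤ N ^ 4 := one_le_pow₀ hN
  calc (B * (1 + N ^ 2 * s)) ^ 2 = B ^ 2 * (1 + N ^ 2 * s) ^ 2 := by ring
    _ ≤ B ^ 2 * (2 * (N ^ 4 + N ^ 4 * s ^ 2)) := by
        refine mul_le_mul_of_nonneg_left ?_ (sq_nonneg B)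
        nlinarith [sq_nonneg (1 - N ^ 2 * s)]
    _ = _ := by ring

/-- The error of the conditional mean is small in mean square. -/
theorem LocalDesign.conditional_bias (H : LocalDesign P f X h x) (hK : IsKernel K)
    (hm : Measurable m) (hm1 : ∀ᶠ y in 𝓝 x, DifferentiableAt ℝ m y)
    (hm2 : DifferentiableAt ℝ (deriv m) x) (t : ℝ) :
    (∀ᶠ n : ℕ in atTop, MemLp (condErr K m X (h n) x t n) 2 P) ∧
    (fun n : ℕ => ∫ ω, condErr K m X (h n) x t n ω ^ 2 ∂P)
      =o[atTop] fun n : ℕ => h n ^ 4 + ((n : ℝ) * h n)⁻¹ := by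
  have := H.isProbabilityMeasure
  obtain ⟨a, c, ha, hc, hbad⟩ := H.exists_goodDesign hK t ((hK.isTest_moment 0).comp_add t)
    (fun v => by simpa using hK.nonneg (v + t)) ((hK.integrable_moment_sq 0).comp_add_right t)
  simp only [← locMom_scaledDesign] at hbad
  obtain ⟨B, hB, hpt⟩ := H.exists_condErr_le hK hm1 hm2 t ha hc
  set g := f x with hgd
  have hg0 : 0 < g := H.pos_f
  set ν := ∫ v, v ^ 2 * K v with hν
  set s : ℕ → ℕ → Ω → ℝ := fun l n ω =>
    locMom K (n * h n) n (scaledDesign X (h n) x t ω) l with hs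
  set err : ℕ → Ω → ℝ := fun n => condErr K m X (h n) x t n with herr
  have hXm := H.measurable_X
  have hsm : ∀ l n, Measurable (s l n) := fun l n => measurable_locMom hK.measurable hXm _ _ _ _ _
  have hem : ∀ n, Measurable (err n) := fun n => by
    have h1 := fun i => measurable_locWt (x := x) hK.measurable hXm (n * h n) (h n) t n i
    have h2 : ∀ i, Measurable fun ω => m (X i ω) := fun i => hm.comp (hXm i)
    simp only [herr]
    unfold condErr
    fun_prop
  have hmem : ∀ᶠ n : ℕ in atTop, MemLp (err n) 2 P := by
    filter_upwards [hpt 1 one_pos le_rfl, H.eventually_memLp_locMom hK t 0] with n hn hsn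
    have hsn' : MemLp (s 0 n) 2 P := hsn
    have hb₁ : MemLp (fun ω => ((n : ℝ) * h n) ^ 2 * s 0 n ω) 2 P :=
      hsn'.const_mul (((n : ℝ) * h n) ^ 2)
    have hb₂ : MemLp (fun ω => 1 + ((n : ℝ) * h n) ^ 2 * s 0 n ω) 2 P :=
      (memLp_const (1 : ℝ)).add hb₁
    have hb : MemLp (fun ω => B * (1 + ((n : ℝ) * h n) ^ 2 * s 0 n ω)) 2 P := hb₂.const_mul B
    refine hb.mono' (hem n).aestronglyMeasurable (Eventually.of_forall fun ω => ?_)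
    exact (hn ω).1
  refine ⟨hmem, ?_⟩
  rw [isLittleO_iff]
  intro ε hε
  -- chosen so that `3 B² η² ≤ ε / 2`
  set η := min 1 (ε / (6 * B ^ 2)) with hηd
  have hη : 0 < η := lt_min one_pos (by positivity)
  have hη1 : η ≤ 1 := min_le_left _ _
  have hηε : 3 * B ^ 2 * η ^ 2 ≤ ε / 2 := by
    have h1 : η ≤ ε / (6 * B ^ 2) := min_le_right _ _
    rw [le_div_iff₀ (by positivity)] at h1
    have h2 : η ^ 2 ≤ η := by nlinarith
    nlinarith [sq_nonneg B]
  set C₂ := 12 * B ^ 2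
  have hτ : Tendsto (fun n : ℕ => (((n : ℝ) * h n) ^ 4)⁻¹) atTop (𝓝 0) :=
    ((tendsto_pow_atTop (by norm_num)).comp H.tendsto_nh).inv_tendsto_atTop
  have hI2 := H.tendsto_locMom_sq hK t 2
  have hI1 := H.tendsto_locMom_sq hK t 1
  have hI0 := H.tendsto_locMom_sq hK t 0
  simp only [hK.integral_moment_one, mul_zero, sub_zero] at hI1
  simp only [pow_zero, one_mul, hK.integral_eq_one, mul_one] at hI0
  have l1 : Tendsto (fun n : ℕ => C₂ * (((∫ ω, (s 2 n ω - g * ν) ^ 2 ∂P)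
      + (∫ ω, (s 0 n ω - g) ^ 2 ∂P) + ∫ ω, s 1 n ω ^ 2 ∂P)
      + (((n : ℝ) * h n) ^ 4)⁻¹ ^ 2)) atTop (𝓝 0) := by
    have := (((hI2.add hI0).add hI1).add (hτ.pow 2)).const_mul C₂
    simpa using this
  have l2 : Tendsto (fun n : ℕ => 3 * B ^ 2 * (((n : ℝ) * h n) ^ 4)⁻¹) atTop (𝓝 0) := by
    simpa using hτ.const_mul (3 * B ^ 2)
  have l3 := hbad.const_mul (2 * B ^ 2)
  rw [mul_zero] at l3
  filter_upwards [hpt η hη hη1, H.tendsto_nh.eventually_ge_atTop 1,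
    l1.eventually_le_const (half_pos hε), l2.eventually_le_const (half_pos hε),
    l3.eventually_le_const (half_pos hε), hmem, H.eventually_memLp_locMom hK t 0,
    H.eventually_memLp_locMom hK t 1, H.eventually_memLp_locMom hK t 2]
    with n hn hN1 e1 e2 e3 hen hs0 hs1 hs2
  have hh := H.pos_h n
  set N := (n : ℝ) * h n with hNd
  have hN : 0 < N := one_pos.trans_le hN1
  set τ := (N ^ 4)⁻¹ with hτd
  have hτ0 : 0 < τ := by positivity
  have hτN : τ ≤ N⁻¹ := inv_anti₀ hN (le_self_pow₀ hN1 (by norm_num))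
  set bad := {ω | ¬ GoodDesign K a c N n (scaledDesign X (h n) x t ω)} with hbadd
  have hbm : MeasurableSet bad :=
    (measurableSet_goodDesign hK.measurable hXm a c N (h n) t n).compl
  have i2 : Integrable (fun ω => (s 2 n ω - g * ν) ^ 2) P :=
    (hs2.sub (memLp_const (g * ν))).integrable_sq
  have i0 : Integrable (fun ω => (s 0 n ω - g) ^ 2) P :=
    (hs0.sub (memLp_const g)).integrable_sq
  have i1 : Integrable (fun ω => s 1 n ω ^ 2) P := hs1.integrable_sq
  have i20 : Integrable (fun ω => (s 2 n ω - g * ν) ^ 2 + (s 0 n ω - g) ^ 2) P := i2.add i0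
  have i201 : Integrable (fun ω => (s 2 n ω - g * ν) ^ 2 + (s 0 n ω - g) ^ 2 + s 1 n ω ^ 2) P :=
    i20.add i1
  have ib : Integrable (fun ω => 1 + s 0 n ω ^ 2) P := (integrable_const _).add hs0.integrable_sq
  have ib' : Integrable (bad.indicator fun ω => 1 + s 0 n ω ^ 2) P := ib.indicator hbm
  set F₁ : Ω → ℝ := fun ω => (3 * B ^ 2 * τ ^ 2 + h n ^ 4 * (C₂ * τ ^ 2 + 3 * B ^ 2 * η ^ 2))
    + h n ^ 4 * C₂ * ((s 2 n ω - g * ν) ^ 2 + (s 0 n ω - g) ^ 2 + s 1 n ω ^ 2) with hF₁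
  have iF₁ : Integrable F₁ P := (integrable_const _).add (i201.const_mul _)
  have iF₂ : Integrable (fun ω => F₁ ω
      + 2 * B ^ 2 * N ^ 4 * bad.indicator (fun ω => 1 + s 0 n ω ^ 2) ω) P :=
    iF₁.add (ib'.const_mul _)
  -- the sharp bound on well spread designs, the crude one on the others
  have hle : ∀ ω, err n ω ^ 2
      ≤ F₁ ω + 2 * B ^ 2 * N ^ 4 * bad.indicator (fun ω => 1 + s 0 n ω ^ 2) ω := by
    intro ω
    have hF0 : 0 ≤ F₁ ω := by positivity
    by_cases hG : GoodDesign K a c N n (scaledDesign X (h n) x t ω)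
    · have hnb : ω ∉ bad := fun hb => hb hG
      rw [Set.indicator_of_notMem hnb, mul_zero, add_zero, ← sq_abs]
      refine (pow_le_pow_left₀ (abs_nonneg _) ((hn ω).2 hG) 2).trans ?_
      set d2 := |s 2 n ω - g * ν|
      set d0 := |s 0 n ω - g|
      set d1 := |s 1 n ω|
      change (B * (τ + h n ^ 2 * (d2 + d0 + d1 + τ + η))) ^ 2 ≤ F₁ ω
      refine (sq_le_of_good B τ (h n ^ 2) d2 d0 d1 η).trans (le_of_eq ?_)
      simp only [hF₁, d2, d0, d1, sq_abs, C₂]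
      ring
    · have hb : ω ∈ bad := hG
      rw [Set.indicator_of_mem hb, ← sq_abs]
      refine (pow_le_pow_left₀ (abs_nonneg _) (hn ω).1 2).trans (le_add_of_nonneg_of_le hF0 ?_)
      exact sq_le_of_bad B N (s 0 n ω) hN1
  have hint : ∫ ω, err n ω ^ 2 ∂P ≤ (3 * B ^ 2 * τ ^ 2 + h n ^ 4 * (C₂ *
      (((∫ ω, (s 2 n ω - g * ν) ^ 2 ∂P) + (∫ ω, (s 0 n ω - g) ^ 2 ∂P) + ∫ ω, s 1 n ω ^ 2 ∂P)
        + τ ^ 2) + 3 * B ^ 2 * η ^ 2)) + 2 * B ^ 2 * N ^ 4 * ∫ ω in bad, (1 + s 0 n ω ^ 2) ∂P := by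
    refine (integral_mono hen.integrable_sq iF₂ hle).trans (le_of_eq ?_)
    rw [integral_add iF₁ (ib'.const_mul _), integral_const_mul, integral_indicator hbm]
    congr 1
    simp only [hF₁]
    rw [integral_const_add_mul_sum_three i2 i0 i1]
    ring
  have hnn : 0 ≤ ∫ ω, err n ω ^ 2 ∂P := integral_nonneg fun ω => sq_nonneg _
  change ‖∫ ω, err n ω ^ 2 ∂P‖ ≤ ε * ‖h n ^ 4 + N⁻¹‖
  rw [Real.norm_eq_abs, Real.norm_eq_abs, abs_of_nonneg hnn, abs_of_pos (by positivity)]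
  refine hint.trans ?_
  have t1 : 3 * B ^ 2 * τ ^ 2 ≤ ε / 2 * N⁻¹ := by
    calc _ = 3 * B ^ 2 * τ * τ := by ring
      _ ≤ ε / 2 * N⁻¹ := by gcongr
  have t3 : 2 * B ^ 2 * N ^ 4 * ∫ ω in bad, (1 + s 0 n ω ^ 2) ∂P ≤ ε / 2 * N⁻¹ := by
    calc _ = 2 * B ^ 2 * (N ^ 5 * ∫ ω in bad, (1 + s 0 n ω ^ 2) ∂P) * N⁻¹ := by
          field_simp
      _ ≤ _ := by gcongr
  have t2 : h n ^ 4 * (C₂ *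
      (((∫ ω, (s 2 n ω - g * ν) ^ 2 ∂P) + (∫ ω, (s 0 n ω - g) ^ 2 ∂P) + ∫ ω, s 1 n ω ^ 2 ∂P)
        + τ ^ 2) + 3 * B ^ 2 * η ^ 2) ≤ h n ^ 4 * (ε / 2 + ε / 2) :=
    mul_le_mul_of_nonneg_left (add_le_add e1 hηε) (by positivity)
  calc _ ≤ (ε / 2 * N⁻¹ + h n ^ 4 * (ε / 2 + ε / 2)) + ε / 2 * N⁻¹ := by
        exact add_le_add (add_le_add t1 t2) t3
    _ = _ := by ring

end

/-! ### Conditional variance -/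

section

variable {Ω : Type*} [MeasurableSpace Ω] {P : Measure Ω} {f K q : ℝ → ℝ} {X : ℕ → Ω → ℝ}
  {h : ℕ → ℝ} {x : ℝ} {ι : Type*} [Fintype ι]

/-- The weight of the `i`-th observation in the linear combination, with coefficients `A j`, of the
local linear estimators at the points `x + h t_j`. -/
noncomputable def combWt (K : ℝ → ℝ) (A t : ι → ℝ) (X : ℕ → Ω → ℝ) (h x : ℝ) (n : ℕ) (ω : Ω)
    (i : ℕ) : ℝ :=
  ∑ j, A j * locWt K (n * h) n (scaledDesign X h x (t j) ω) i

/-- On well spread designs the weights of a linear combination of estimators, multiplied by `N`, are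
close to `∑ A_j K(u_i) / g`. -/
theorem exists_abs_comb_sub_le {L g : ℝ} (hK0 : ∀ v, 0 ≤ K v) (hKL : ∀ v, K v ≠ 0 → |v| ≤ L)
    (hL : 0 ≤ L) (hg0 : 0 < g) (A a c : ι → ℝ) (ha : ∀ j, 0 < a j) (hc : ∀ j, 0 < c j) :
    ∃ B, 0 ≤ B ∧ ∀ (N : ℝ) (n : ℕ) (u : ι → ℕ → ℝ), 0 < N →
      (∀ j, GoodDesign K (a j) (c j) N n (u j)) → ∀ i,
      |N * (∑ j, A j * locWt K N n (u j) i) - (∑ j, A j * K (u j i)) / g| ≤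
        B * min 1 (∑ j, (|locMom K N n (u j) 0 - g| + |locMom K N n (u j) 1| + (N ^ 4)⁻¹)) *
          ∑ j, K (u j i) := by
  choose B hB hW using fun j => exists_abs_locWt_sub_le hK0 hKL hL (ha j) (hc j) hg0
  refine ⟨∑ j, |A j| * B j, Finset.sum_nonneg fun j _ => mul_nonneg (abs_nonneg _) (hB j).le,
    fun N n u hN hg i => ?_⟩
  have e : N * (∑ j, A j * locWt K N n (u j) i) - (∑ j, A j * K (u j i)) / g
      = ∑ j, A j * (N * (locWt K N n (u j) i - N⁻¹ * K (u j i) / g)) := by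
    rw [Finset.mul_sum, Finset.sum_div, ← Finset.sum_sub_distrib]
    refine Finset.sum_congr rfl fun j _ => ?_
    field_simp
  set ρ : ι → ℝ := fun j =>
    |locMom K N n (u j) 0 - g| + |locMom K N n (u j) 1| + (N ^ 4)⁻¹ with hρ
  have hρ0 : ∀ j, 0 ≤ ρ j := fun j => by positivity
  rw [e]
  refine (Finset.abs_sum_le_sum_abs _ _).trans ?_
  rw [Finset.sum_mul, Finset.sum_mul]
  refine Finset.sum_le_sum fun j _ => ?_
  rw [abs_mul, abs_mul, abs_of_pos hN, mul_assoc, mul_assoc]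
  refine mul_le_mul_of_nonneg_left ?_ (abs_nonneg _)
  calc _ ≤ N * (B j * min 1 (ρ j) * (N⁻¹ * K (u j i))) :=
        mul_le_mul_of_nonneg_left (hW j N n (u j) hN (hg j) i) hN.le
    _ = B j * (min 1 (ρ j) * K (u j i)) := by field_simp
    _ ≤ _ := by
        have h1 : min 1 (ρ j) ≤ min 1 (∑ j, ρ j) :=
          min_le_min le_rfl (Finset.single_le_sum (fun j _ => hρ0 j) (Finset.mem_univ j))
        have h2 : K (u j i) ≤ ∑ j, K (u j i) :=
          Finset.single_le_sum (f := fun j => K (u j i)) (fun j _ => hK0 _) (Finset.mem_univ j)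
        have h3 := hK0 (u j i)
        have h4 : 0 ≤ min 1 (ρ j) := le_min zero_le_one (hρ0 j)
        refine mul_le_mul_of_nonneg_left (mul_le_mul h1 h2 h3 (h4.trans h1)) (hB j).le

/-- Comparison of a weighted square with its limit. -/
theorem abs_sq_mul_sub_le {y k κ B A g z w s η : ℝ} (hg : 0 < g) (hB : 0 ≤ B) (hA : 0 ≤ A)
    (hz0 : 0 ≤ z) (hz1 : z ≤ 1) (hκ : 0 ≤ κ) (hy : |y - k / g| ≤ B * z * κ) (hk : |k| ≤ A * κ)
    (hw : κ ≠ 0 → |w - s| ≤ η) (hη : η ≤ 1) :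
    |y ^ 2 * w - s / g ^ 2 * k ^ 2|
      ≤ B * (B + 2 * A / g) * (|s| + 1) * (z * κ ^ 2) + A ^ 2 / g ^ 2 * η * κ ^ 2 := by
  rcases hκ.eq_or_lt with h0 | hκ'
  · have hk0 : k = 0 := by rw [← h0, mul_zero] at hk; exact abs_nonpos_iff.1 hk
    have hy0 : y = 0 := by
      rw [← h0, mul_zero, hk0, zero_div, sub_zero] at hy
      exact abs_nonpos_iff.1 hy
    rw [hk0, hy0, ← h0]
    simp
  have hws := hw hκ'.ne'
  have hη0 : 0 ≤ η := (abs_nonneg _).trans hws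
  have hw1 : |w| ≤ |s| + 1 := by
    have := abs_add_le (w - s) s
    rw [sub_add_cancel] at this
    linarith
  have hkg : |k / g| ≤ A / g * κ := by
    rw [abs_div, abs_of_pos hg, div_mul_eq_mul_div]
    gcongr
  have hyk : |y + k / g| ≤ (B + 2 * A / g) * κ := by
    have e : y + k / g = (y - k / g) + 2 * (k / g) := by ring
    rw [e]
    refine (abs_add_le _ _).trans ?_
    rw [abs_mul, abs_two]
    have : B * z * κ ≤ B * 1 * κ := by gcongr
    calc _ ≤ B * 1 * κ + 2 * (A / g * κ) := add_le_add (hy.trans this) (by gcongr)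
      _ = _ := by ring
  have e : y ^ 2 * w - s / g ^ 2 * k ^ 2
      = (y - k / g) * (y + k / g) * w + (k / g) ^ 2 * (w - s) := by
    field_simp; ring
  rw [e]
  refine (abs_add_le _ _).trans (add_le_add ?_ ?_)
  · rw [abs_mul, abs_mul]
    calc _ ≤ (B * z * κ) * ((B + 2 * A / g) * κ) * (|s| + 1) := by gcongr
      _ = _ := by ring
  · rw [abs_mul, abs_pow]
    calc _ ≤ (A / g * κ) ^ 2 * η := by gcongr
      _ = _ := by ring

theorem measurable_combWt (hK : Measurable K) (hX : ∀ i, Measurable (X i)) (A t : ι → ℝ) (h : ℝ)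
    (n i : ℕ) : Measurable fun ω => combWt K A t X h x n ω i := by
  have h1 := fun j => measurable_locWt (x := x) hK hX (n * h) h (t j) n i
  unfold combWt
  fun_prop

/-- Products of the local linear weights with locally bounded functions of the design are square
integrable. -/
theorem LocalDesign.eventually_memLp_locWt_mul (H : LocalDesign P f X h x) (hK : IsKernel K)
    (hq : Measurable q) {b : ℝ} (hqb : ∀ᶠ y in 𝓝 x, |q y| ≤ b) (t : ℝ) :
    ∀ᶠ n : ℕ in atTop, ∀ i ∈ Finset.range n, MemLp (fun ω =>
      locWt K (n * h n) n (scaledDesign X (h n) x t ω) i * q (X i ω)) 2 P := by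
  obtain ⟨L, hL0, hL⟩ := hK.exists_bound
  have hXm := H.measurable_X
  have hb0 : 0 ≤ b := (abs_nonneg _).trans hqb.self_of_nhds
  filter_upwards [H.eventually_near hL t hqb, H.eventually_memLp_locMom hK t 0,
    H.tendsto_nh.eventually_gt_atTop 0] with n hn hs hN i hi
  have h1 := measurable_locWt (x := x) hK.measurable hXm (n * h n) (h n) t n i
  have h2 : Measurable fun ω => q (X i ω) := hq.comp (hXm i)
  refine (hs.const_mul (b * (L * (n * h n) ^ 2))).mono' (h1.mul h2).aestronglyMeasurable
    (Eventually.of_forall fun ω => ?_)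
  rw [Real.norm_eq_abs, abs_mul]
  have hS := sum_abs_locWt_le (n := n) (u := scaledDesign X (h n) x t ω) hK.nonneg hL hL0 hN
  have hsi := (Finset.single_le_sum (f := fun i =>
    |locWt K (n * h n) n (scaledDesign X (h n) x t ω) i|) (fun i _ => abs_nonneg _) hi).trans hS
  by_cases hKi : K (scaledDesign X (h n) x t ω i) = 0
  · rw [locWt, hKi]
    have := (abs_nonneg _).trans hsi
    simp only [mul_zero, zero_mul, abs_zero]
    rw [mul_assoc]
    exact mul_nonneg hb0 this
  · calc _ ≤ L * (n * h n) ^ 2 * locMom K (n * h n) n (scaledDesign X (h n) x t ω) 0 * b :=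
          mul_le_mul hsi (hn ω i hKi).1 (abs_nonneg _) ((abs_nonneg _).trans hsi)
      _ = _ := by ring

theorem LocalDesign.eventually_memLp_combWt_mul (H : LocalDesign P f X h x) (hK : IsKernel K)
    (hq : Measurable q) {b : ℝ} (hqb : ∀ᶠ y in 𝓝 x, |q y| ≤ b) (A t : ι → ℝ) :
    ∀ᶠ n : ℕ in atTop, ∀ i ∈ Finset.range n, MemLp (fun ω =>
      combWt K A t X (h n) x n ω i * q (X i ω)) 2 P := by
  filter_upwards [eventually_all.2 fun j => H.eventually_memLp_locWt_mul hK hq hqb (t j)]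
    with n hn i hi
  simp only [combWt, Finset.sum_mul, mul_assoc]
  exact memLp_finsetSum _ fun j _ => (hn j i hi).const_mul (A j)

theorem tendsto_integral_abs_of_sq [IsProbabilityMeasure P] {Y : ℕ → Ω → ℝ}
    (hY : ∀ᶠ n in atTop, MemLp (Y n) 2 P)
    (h : Tendsto (fun n => ∫ ω, Y n ω ^ 2 ∂P) atTop (𝓝 0)) :
    Tendsto (fun n => ∫ ω, |Y n ω| ∂P) atTop (𝓝 0) := by
  have hs : Tendsto (fun n => √(∫ ω, Y n ω ^ 2 ∂P)) atTop (𝓝 0) := by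
    simpa using h.sqrt
  refine tendsto_of_tendsto_of_tendsto_of_le_of_le' tendsto_const_nhds hs
    (Eventually.of_forall fun n => integral_nonneg fun ω => abs_nonneg _) ?_
  filter_upwards [hY] with n hn
  refine Real.le_sqrt_of_sq_le ?_
  have habs : MemLp (fun ω => |Y n ω|) 2 P := hn.abs
  have h1 := variance_nonneg (fun ω => |Y n ω|) P
  rw [variance_eq_sub habs] at h1
  simp only [Pi.pow_apply, sq_abs] at h1
  linarith

end

/-! ### Pointwise control of the conditional variance -/

section

variable {Ω : Type*} [MeasurableSpace Ω] {P : Measure Ω} {f K σ : ℝ → ℝ} {X : ℕ → Ω → ℝ}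
  {h : ℕ → ℝ} {x : ℝ} {ι : Type*} [Fintype ι]

/-- A bound in `[0, 1]` for the distance of the local moments at the points `x + h t_j` from their
limits; it equals `1` on badly spread designs. -/
noncomputable def designErr (K : ℝ → ℝ) (g : ℝ) (a c t : ι → ℝ) (X : ℕ → Ω → ℝ) (h x : ℝ) (n : ℕ)
    (ω : Ω) : ℝ :=
  min 1 (∑ j, (|locMom K (n * h) n (scaledDesign X h x (t j) ω) 0 - g|
      + |locMom K (n * h) n (scaledDesign X h x (t j) ω) 1| + (((n : ℝ) * h) ^ 4)⁻¹)
    + ∑ j, {ω | ¬ GoodDesign K (a j) (c j) (n * h) n (scaledDesign X h x (t j) ω)}.indicator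
        (fun _ => (1 : ℝ)) ω)

omit [MeasurableSpace Ω] in
theorem designErr_nonneg {g : ℝ} {a c t : ι → ℝ} {h : ℝ} (n : ℕ) (ω : Ω) :
    0 ≤ designErr K g a c t X h x n ω :=
  le_min zero_le_one (add_nonneg (Finset.sum_nonneg fun j _ => by positivity)
    (Finset.sum_nonneg fun j _ => Set.indicator_nonneg (fun _ _ => zero_le_one) _))

omit [MeasurableSpace Ω] in
theorem designErr_of_bad {g : ℝ} {a c t : ι → ℝ} {h : ℝ} {n : ℕ} {ω : Ω}
    (hb : ∃ j, ¬ GoodDesign K (a j) (c j) (n * h) n (scaledDesign X h x (t j) ω)) :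
    designErr K g a c t X h x n ω = 1 := by
  obtain ⟨j, hj⟩ := hb
  refine min_eq_left (le_add_of_nonneg_of_le (Finset.sum_nonneg fun j _ => by positivity) ?_)
  refine le_trans ?_ (Finset.single_le_sum (fun j _ => Set.indicator_nonneg
    (fun _ _ => zero_le_one) _) (Finset.mem_univ j))
  rw [Set.indicator_of_mem (by exact hj)]

theorem measurable_designErr (hK : Measurable K) (hX : ∀ i, Measurable (X i)) (g : ℝ)
    (a c t : ι → ℝ) (h : ℝ) (n : ℕ) : Measurable (designErr K g a c t X h x n) := by
  have h1 := fun l j => measurable_locMom (x := x) hK hX (n * h) h (t j) n l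
  have h2 : ∀ j, Measurable fun ω => {ω | ¬ GoodDesign K (a j) (c j) (n * h) n
      (scaledDesign X h x (t j) ω)}.indicator (fun _ => (1 : ℝ)) ω := fun j =>
    measurable_const.indicator
      (measurableSet_goodDesign hK hX (a j) (c j) (n * h) h (t j) n).compl
  have h3 : ∀ j, Measurable fun ω => |locMom K (n * h) n (scaledDesign X h x (t j) ω) 0 - g|
      + |locMom K (n * h) n (scaledDesign X h x (t j) ω) 1| + (((n : ℝ) * h) ^ 4)⁻¹ := fun j =>
    (((h1 0 j).sub_const g).abs.add (h1 1 j).abs).add_const _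
  exact measurable_const.min
    ((Finset.measurable_sum _ fun j _ => h3 j).add (Finset.measurable_sum _ fun j _ => h2 j))

/-- The mean of the design error vanishes in the limit, since the local moments converge in mean
square and badly spread designs are rare. -/
theorem LocalDesign.tendsto_designErr (H : LocalDesign P f X h x) (hK : IsKernel K)
    {a c t : ι → ℝ}
    (hbad : ∀ j, Tendsto (fun n : ℕ => P.real {ω | ¬ GoodDesign K (a j) (c j) (n * h n) n
      (scaledDesign X (h n) x (t j) ω)}) atTop (𝓝 0)) :
    Tendsto (fun n => ∫ ω, designErr K (f x) a c t X (h n) x n ω ∂P) atTop (𝓝 0) := by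
  have := H.isProbabilityMeasure
  have hXm := H.measurable_X
  have hτ : Tendsto (fun n : ℕ => (((n : ℝ) * h n) ^ 4)⁻¹) atTop (𝓝 0) :=
    ((tendsto_pow_atTop (by norm_num)).comp H.tendsto_nh).inv_tendsto_atTop
  have h0 : ∀ j, Tendsto (fun n : ℕ => ∫ ω, |locMom K (n * h n) n
      (scaledDesign X (h n) x (t j) ω) 0 - f x| ∂P) atTop (𝓝 0) := fun j => by
    have hI0 := H.tendsto_locMom_sq hK (t j) 0
    simp only [pow_zero, one_mul, hK.integral_eq_one, mul_one] at hI0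
    refine tendsto_integral_abs_of_sq ?_ hI0
    filter_upwards [H.eventually_memLp_locMom hK (t j) 0] with n hn
    exact hn.sub (memLp_const (f x))
  have h1 : ∀ j, Tendsto (fun n : ℕ => ∫ ω, |locMom K (n * h n) n
      (scaledDesign X (h n) x (t j) ω) 1| ∂P) atTop (𝓝 0) := fun j => by
    have hI1 := H.tendsto_locMom_sq hK (t j) 1
    simp only [hK.integral_moment_one, mul_zero, sub_zero] at hI1
    exact tendsto_integral_abs_of_sq (H.eventually_memLp_locMom hK (t j) 1) hI1
  have hlim := (tendsto_finsetSum Finset.univ fun j _ => ((h0 j).add (h1 j)).add hτ).add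
    (tendsto_finsetSum Finset.univ fun j _ => hbad j)
  simp only [add_zero, Finset.sum_const_zero] at hlim
  refine tendsto_of_tendsto_of_tendsto_of_le_of_le' tendsto_const_nhds hlim
    (Eventually.of_forall fun n => integral_nonneg fun ω => designErr_nonneg n ω) ?_
  filter_upwards [eventually_all.2 fun j => H.eventually_memLp_locMom hK (t j) 0,
    eventually_all.2 fun j => H.eventually_memLp_locMom hK (t j) 1] with n hn0 hn1
  have i0 : ∀ j, Integrable (fun ω => |locMom K (n * h n) n
      (scaledDesign X (h n) x (t j) ω) 0 - f x|) P := fun j =>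
    (((hn0 j).integrable (by norm_num)).sub (integrable_const (f x))).abs
  have i1 : ∀ j, Integrable (fun ω => |locMom K (n * h n) n
      (scaledDesign X (h n) x (t j) ω) 1|) P := fun j => ((hn1 j).integrable (by norm_num)).abs
  have i01 : ∀ j, Integrable (fun ω => |locMom K (n * h n) n
      (scaledDesign X (h n) x (t j) ω) 0 - f x| + |locMom K (n * h n) n
      (scaledDesign X (h n) x (t j) ω) 1|) P := fun j => (i0 j).add (i1 j)
  have i2 : ∀ j, Integrable (fun ω => |locMom K (n * h n) n
      (scaledDesign X (h n) x (t j) ω) 0 - f x| + |locMom K (n * h n) n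
      (scaledDesign X (h n) x (t j) ω) 1| + (((n : ℝ) * h n) ^ 4)⁻¹) P := fun j =>
    (i01 j).add (integrable_const _)
  have hbm := fun j =>
    (measurableSet_goodDesign (x := x) hK.measurable hXm (a j) (c j) (n * h n) (h n) (t j) n).compl
  have i3 : ∀ j, Integrable (fun ω => {ω | ¬ GoodDesign K (a j) (c j) (n * h n) n
      (scaledDesign X (h n) x (t j) ω)}.indicator (fun _ => (1 : ℝ)) ω) P := fun j =>
    (integrable_const _).indicator (hbm j)
  calc _ ≤ ∫ ω, (∑ j, (|locMom K (n * h n) n (scaledDesign X (h n) x (t j) ω) 0 - f x|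
      + |locMom K (n * h n) n (scaledDesign X (h n) x (t j) ω) 1| + (((n : ℝ) * h n) ^ 4)⁻¹)
      + ∑ j, {ω | ¬ GoodDesign K (a j) (c j) (n * h n) n
        (scaledDesign X (h n) x (t j) ω)}.indicator (fun _ => (1 : ℝ)) ω) ∂P :=
        integral_mono_of_nonneg (Eventually.of_forall fun ω => designErr_nonneg n ω)
          ((integrable_finsetSum _ fun j _ => i2 j).add (integrable_finsetSum _ fun j _ => i3 j))
          (Eventually.of_forall fun ω => min_le_right _ _)
    _ = _ := by
        rw [integral_add (integrable_finsetSum _ fun j _ => i2 j)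
          (integrable_finsetSum _ fun j _ => i3 j), integral_finsetSum _ fun j _ => i2 j,
          integral_finsetSum _ fun j _ => i3 j]
        congr 1
        · refine Finset.sum_congr rfl fun j _ => ?_
          rw [integral_add (i01 j) (integrable_const _), integral_add (i0 j) (i1 j),
            integral_const, probReal_univ, one_smul]
        · refine Finset.sum_congr rfl fun j _ => ?_
          exact integral_indicator_one (hbm j)

/-- Pointwise comparison of the normalised conditional variance with a kernel average. -/
theorem LocalDesign.exists_condVar_sub_le (H : LocalDesign P f X h x) (hK : IsKernel K)
    (hσx : ContinuousAt (fun y => σ y ^ 2) x) (A : ι → ℝ) {a c t : ι → ℝ} (ha : ∀ j, 0 < a j)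
    (hc : ∀ j, 0 < c j) :
    ∃ B, 0 < B ∧ ∀ η, 0 < η → η ≤ 1 → ∀ᶠ n : ℕ in atTop, ∀ ω,
      |(n * h n) * ∑ i ∈ Finset.range n, (combWt K A t X (h n) x n ω i * σ (X i ω)) ^ 2
        - σ x ^ 2 / f x ^ 2 * empAvg (fun v => (∑ j, A j * K (v + t j)) ^ 2) (n * h n) n
          (fun i => (x - X i ω) / h n)|
      ≤ B * (designErr K (f x) a c t X (h n) x n ω *
          empAvg (fun v => (∑ j, K (v + t j)) ^ 2) (n * h n) n (fun i => (x - X i ω) / h n))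
        + B * η * empAvg (fun v => (∑ j, K (v + t j)) ^ 2) (n * h n) n (fun i => (x - X i ω) / h n)
        + B * ∑ j, ((n : ℝ) * h n) ^ 5 *
          {ω | ¬ GoodDesign K (a j) (c j) (n * h n) n (scaledDesign X (h n) x (t j) ω)}.indicator
          (fun ω => 1 + empAvg (fun v => ∑ j, K (v + t j)) (n * h n) n
            (fun i => (x - X i ω) / h n) ^ 2) ω := by
  obtain ⟨L, hL0, hL⟩ := hK.exists_bound
  have hK0 := hK.nonneg
  set g := f x with hg
  have hg0 : 0 < g := H.pos_f
  obtain ⟨B, hB0, hB⟩ := exists_abs_comb_sub_le hK0 hL hL0 hg0 A a c ha hc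
  set A' := ∑ j, |A j| with hA'
  have hA0 : 0 ≤ A' := Finset.sum_nonneg fun j _ => abs_nonneg _
  set s := σ x ^ 2 with hs
  have hs0 : 0 ≤ s := sq_nonneg _
  set B₁ := B * (B + 2 * A' / g) * (|s| + 1)
  set B₂ := A' ^ 2 / g ^ 2
  set B₃ := (s + 1) * (A' * L) ^ 2
  have hB₁ : 0 ≤ B₁ := by positivity
  have hB₂ : 0 ≤ B₂ := by positivity
  have hB₃ : 0 ≤ B₃ := by positivity
  refine ⟨B₁ + B₂ + B₃ + s * B₂ + 1, by positivity, fun η hη hη1 => ?_⟩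
  set B₄ := B₁ + B₂ + B₃ + s * B₂ + 1
  have hsB₂ : 0 ≤ s * B₂ := by positivity
  have hnear : ∀ᶠ y in 𝓝 x, |σ y ^ 2 - s| ≤ η := by
    filter_upwards [Metric.continuousAt_iff'.1 hσx η hη] with y hy
    exact (Real.dist_eq _ _ ▸ hy).le
  filter_upwards [eventually_all.2 fun j => H.eventually_near hL (t j) hnear,
    H.tendsto_nh.eventually_gt_atTop 0] with n hn hN ω
  set N := (n : ℝ) * h n with hNd
  set u : ι → ℕ → ℝ := fun j => scaledDesign X (h n) x (t j) ω with hu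
  set v : ℕ → ℝ := fun i => (x - X i ω) / h n with hv
  set κ : ℝ → ℝ := fun v => ∑ j, K (v + t j) with hκ
  set k : ℝ → ℝ := fun v => ∑ j, A j * K (v + t j) with hk
  set z := designErr K g a c t X (h n) x n ω with hz
  have hκ0 : ∀ w, 0 ≤ κ w := fun w => Finset.sum_nonneg fun j _ => hK0 _
  have hKκ : ∀ j w, K (w + t j) ≤ κ w := fun j w =>
    Finset.single_le_sum (f := fun j => K (w + t j)) (fun j _ => hK0 _) (Finset.mem_univ j)
  have hkκ : ∀ w, |k w| ≤ A' * κ w := fun w => by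
    refine (Finset.abs_sum_le_sum_abs _ _).trans ?_
    rw [hA', Finset.sum_mul]
    refine Finset.sum_le_sum fun j _ => ?_
    rw [abs_mul, abs_of_nonneg (hK0 _)]
    exact mul_le_mul_of_nonneg_left (hKκ j w) (abs_nonneg _)
  have hz0 : 0 ≤ z := designErr_nonneg n ω
  have hz1 : z ≤ 1 := min_le_left _ _
  have hσi : ∀ i, κ (v i) ≠ 0 → |σ (X i ω) ^ 2 - s| ≤ η := by
    intro i hi
    obtain ⟨j, -, hj⟩ := Finset.exists_ne_zero_of_sum_ne_zero hi
    exact (hn j ω i hj).1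
  have hE0 : 0 ≤ empAvg (fun v => κ v ^ 2) N n v := empAvg_nonneg (fun _ => sq_nonneg _) hN.le _ _
  have hb0 : 0 ≤ B₄ * ∑ j, N ^ 5 * {ω | ¬ GoodDesign K (a j) (c j) N n
      (scaledDesign X (h n) x (t j) ω)}.indicator
      (fun ω => 1 + empAvg κ N n (fun i => (x - X i ω) / h n) ^ 2) ω :=
    mul_nonneg (by positivity) (Finset.sum_nonneg fun j _ => mul_nonneg (by positivity)
      (Set.indicator_nonneg (fun _ _ => by positivity) _))
  by_cases hG : ∀ j, GoodDesign K (a j) (c j) N n (u j)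
  · -- well spread designs: compare term by term
    refine le_trans ?_ (le_add_of_nonneg_right hb0)
    have hmin : min 1 (∑ j, (|locMom K N n (u j) 0 - g| + |locMom K N n (u j) 1| + (N ^ 4)⁻¹))
        ≤ z := min_le_min le_rfl (le_add_of_nonneg_right
          (Finset.sum_nonneg fun j _ => Set.indicator_nonneg (fun _ _ => zero_le_one) _))
    have hterm : ∀ i, |(N * combWt K A t X (h n) x n ω i) ^ 2 * σ (X i ω) ^ 2
        - s / g ^ 2 * k (v i) ^ 2| ≤ B₁ * (z * κ (v i) ^ 2) + B₂ * η * κ (v i) ^ 2 := by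
      intro i
      refine abs_sq_mul_sub_le hg0 hB0 hA0 hz0 hz1 (hκ0 _) ?_ (hkκ _) (hσi i) hη1
      refine (hB N n u hN hG i).trans ?_
      exact mul_le_mul_of_nonneg_right (mul_le_mul_of_nonneg_left hmin hB0) (hκ0 _)
    have e : N * ∑ i ∈ Finset.range n, (combWt K A t X (h n) x n ω i * σ (X i ω)) ^ 2
        - s / g ^ 2 * empAvg (fun v => k v ^ 2) N n v
        = N⁻¹ * ∑ i ∈ Finset.range n, ((N * combWt K A t X (h n) x n ω i) ^ 2 * σ (X i ω) ^ 2
        - s / g ^ 2 * k (v i) ^ 2) := by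
      rw [Finset.sum_sub_distrib, mul_sub, empAvg, ← Finset.mul_sum, mul_left_comm]
      congr 1
      rw [Finset.mul_sum, Finset.mul_sum]
      refine Finset.sum_congr rfl fun i _ => ?_
      field_simp
    rw [e, abs_mul, abs_of_pos (inv_pos.2 hN)]
    calc _ ≤ N⁻¹ * ∑ i ∈ Finset.range n, (B₁ * (z * κ (v i) ^ 2) + B₂ * η * κ (v i) ^ 2) := by
          refine mul_le_mul_of_nonneg_left ?_ (inv_pos.2 hN).le
          exact (Finset.abs_sum_le_sum_abs _ _).trans (Finset.sum_le_sum fun i _ => hterm i)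
      _ = B₁ * (z * empAvg (fun v => κ v ^ 2) N n v)
          + B₂ * η * empAvg (fun v => κ v ^ 2) N n v := by
          rw [Finset.sum_add_distrib, ← Finset.mul_sum, ← Finset.mul_sum, ← Finset.mul_sum, empAvg]
          ring
      _ ≤ _ := by
          have p1 : B₁ ≤ B₄ := by simp only [B₄]; linarith
          have p2 : B₂ ≤ B₄ := by simp only [B₄]; linarith
          exact add_le_add
            (mul_le_mul_of_nonneg_right p1 (mul_nonneg hz0 hE0))
            (mul_le_mul_of_nonneg_right (mul_le_mul_of_nonneg_right p2 hη.le) hE0)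
  · -- badly spread designs: bound both quantities separately, the first one by powers of `N`
    have hbad : ∃ j, ¬ GoodDesign K (a j) (c j) N n (u j) := not_forall.1 hG
    have hz1' : z = 1 := designErr_of_bad hbad
    rw [hz1', one_mul]
    obtain ⟨j₀, hj₀⟩ := hbad
    set E₁ := empAvg κ N n v with hE₁
    have hsum : 1 + E₁ ^ 2 ≤ ∑ j, {ω | ¬ GoodDesign K (a j) (c j) N n
        (scaledDesign X (h n) x (t j) ω)}.indicator
        (fun ω => 1 + empAvg κ N n (fun i => (x - X i ω) / h n) ^ 2) ω := by
      refine le_trans ?_ (Finset.single_le_sum (fun j _ => Set.indicator_nonneg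
        (fun _ _ => by positivity) _) (Finset.mem_univ j₀))
      rw [Set.indicator_of_mem (by exact hj₀)]
    have hW : ∑ i ∈ Finset.range n, |combWt K A t X (h n) x n ω i| ≤ A' * L * N ^ 2 * E₁ := by
      have h1 : ∀ j, ∑ i ∈ Finset.range n, |locWt K N n (u j) i| ≤ L * N ^ 2 * E₁ := fun j => by
        refine (sum_abs_locWt_le hK0 hL hL0 hN).trans ?_
        refine mul_le_mul_of_nonneg_left ?_ (by positivity)
        refine mul_le_mul_of_nonneg_left (Finset.sum_le_sum fun i _ => ?_) (inv_pos.2 hN).le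
        rw [pow_zero, one_mul]
        exact hKκ j (v i)
      calc _ ≤ ∑ i ∈ Finset.range n, ∑ j, |A j| * |locWt K N n (u j) i| := by
            refine Finset.sum_le_sum fun i _ => (Finset.abs_sum_le_sum_abs _ _).trans ?_
            exact Finset.sum_le_sum fun j _ => (abs_mul _ _).le
        _ = ∑ j, |A j| * ∑ i ∈ Finset.range n, |locWt K N n (u j) i| := by
            rw [Finset.sum_comm]
            simp only [Finset.mul_sum]
        _ ≤ ∑ j, |A j| * (L * N ^ 2 * E₁) :=
            Finset.sum_le_sum fun j _ => mul_le_mul_of_nonneg_left (h1 j) (abs_nonneg _)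
        _ = _ := by rw [← Finset.sum_mul]; ring
    have hQ : ∑ i ∈ Finset.range n, (combWt K A t X (h n) x n ω i * σ (X i ω)) ^ 2
        ≤ B₃ * (N ^ 4 * E₁ ^ 2) := by
      calc _ ≤ ∑ i ∈ Finset.range n, |combWt K A t X (h n) x n ω i| ^ 2 * (s + 1) := by
            refine Finset.sum_le_sum fun i _ => ?_
            rw [mul_pow, sq_abs]
            by_cases hκi : κ (v i) = 0
            · have h0 : ∀ j, K (u j i) = 0 := fun j =>
                le_antisymm ((hKκ j (v i)).trans hκi.le) (hK0 _)
              have : combWt K A t X (h n) x n ω i = 0 := by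
                refine Finset.sum_eq_zero fun j _ => ?_
                change A j * locWt K N n (u j) i = 0
                simp [locWt, h0 j]
              simp [this]
            · refine mul_le_mul_of_nonneg_left ?_ (sq_nonneg _)
              have := (abs_le.1 (hσi i hκi)).2
              linarith
        _ ≤ (∑ i ∈ Finset.range n, |combWt K A t X (h n) x n ω i|) ^ 2 * (s + 1) := by
            rw [← Finset.sum_mul]
            refine mul_le_mul_of_nonneg_right ?_ (by positivity)
            exact Finset.sum_sq_le_sq_sum_of_nonneg fun i _ => abs_nonneg _
        _ ≤ (A' * L * N ^ 2 * E₁) ^ 2 * (s + 1) := by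
            refine mul_le_mul_of_nonneg_right (pow_le_pow_left₀
              (Finset.sum_nonneg fun i _ => abs_nonneg _) hW 2) (by positivity)
        _ = _ := by simp only [B₃]; ring
    have hQ' : N * ∑ i ∈ Finset.range n, (combWt K A t X (h n) x n ω i * σ (X i ω)) ^ 2
        ≤ B₃ * (N ^ 5 * (1 + E₁ ^ 2)) := by
      calc _ ≤ N * (B₃ * (N ^ 4 * E₁ ^ 2)) := mul_le_mul_of_nonneg_left hQ hN.le
        _ = B₃ * (N ^ 5 * E₁ ^ 2) := by ring
        _ ≤ _ := by gcongr; linarith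
    have hk2 : empAvg (fun v => k v ^ 2) N n v ≤ A' ^ 2 * empAvg (fun v => κ v ^ 2) N n v := by
      rw [empAvg, empAvg, mul_left_comm, Finset.mul_sum (Finset.range n) _ (A' ^ 2)]
      refine mul_le_mul_of_nonneg_left (Finset.sum_le_sum fun i _ => ?_) (inv_pos.2 hN).le
      rw [← sq_abs, ← mul_pow]
      exact pow_le_pow_left₀ (abs_nonneg _) (hkκ _) 2
    have hk0 : 0 ≤ empAvg (fun v => k v ^ 2) N n v :=
      empAvg_nonneg (fun _ => sq_nonneg _) hN.le _ _
    have hp : s / g ^ 2 * empAvg (fun v => k v ^ 2) N n v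
        ≤ s * B₂ * empAvg (fun v => κ v ^ 2) N n v := by
      calc _ ≤ s / g ^ 2 * (A' ^ 2 * empAvg (fun v => κ v ^ 2) N n v) := by gcongr
        _ = _ := by simp only [B₂]; ring
    have hp0 : 0 ≤ s / g ^ 2 * empAvg (fun v => k v ^ 2) N n v := by positivity
    have hQ0 : 0 ≤ N * ∑ i ∈ Finset.range n, (combWt K A t X (h n) x n ω i * σ (X i ω)) ^ 2 :=
      mul_nonneg hN.le (Finset.sum_nonneg fun i _ => sq_nonneg _)
    have p3 : B₃ ≤ B₄ := by simp only [B₄]; linarith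
    have p4 : s * B₂ ≤ B₄ := by simp only [B₄]; linarith
    refine (abs_sub _ _).trans ?_
    rw [abs_of_nonneg hQ0, abs_of_nonneg hp0, ← Finset.mul_sum]
    have r1 : B₃ * (N ^ 5 * (1 + E₁ ^ 2)) ≤ B₄ * (N ^ 5 * ∑ j, {ω | ¬ GoodDesign K (a j) (c j) N n
        (scaledDesign X (h n) x (t j) ω)}.indicator
        (fun ω => 1 + empAvg κ N n (fun i => (x - X i ω) / h n) ^ 2) ω) := by
      refine mul_le_mul p3 (mul_le_mul_of_nonneg_left hsum (by positivity)) (by positivity)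
        (hB₃.trans p3)
    have r2 : s * B₂ * empAvg (fun v => κ v ^ 2) N n v ≤ B₄ * empAvg (fun v => κ v ^ 2) N n v :=
      mul_le_mul_of_nonneg_right p4 hE0
    have r3 : 0 ≤ B₄ * η * empAvg (fun v => κ v ^ 2) N n v :=
      mul_nonneg (mul_nonneg (hB₃.trans p3) hη.le) hE0
    linarith

end

/-! ### Limit of the conditional variance -/

section

variable {Ω : Type*} [MeasurableSpace Ω] {P : Measure Ω} {f K σ : ℝ → ℝ} {X : ℕ → Ω → ℝ}
  {h : ℕ → ℝ} {x : ℝ} {ι : Type*} [Fintype ι]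

theorem IsTest.sum {φ : ι → ℝ → ℝ} (hφ : ∀ j, IsTest (φ j)) : IsTest fun v => ∑ j, φ j v := by
  choose L hL using fun j => (hφ j).bounded_support
  refine ⟨Finset.measurable_sum _ fun j _ => (hφ j).measurable,
    integrable_finsetSum _ fun j _ => (hφ j).integrable, ∑ j, |L j|, fun v hv => ?_⟩
  obtain ⟨j, -, hj⟩ := Finset.exists_ne_zero_of_sum_ne_zero hv
  exact (hL j v hj).trans ((le_abs_self _).trans
    (Finset.single_le_sum (f := fun j => |L j|) (fun j _ => abs_nonneg _) (Finset.mem_univ j)))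

theorem IsKernel.isTest_comb (hK : IsKernel K) (A t : ι → ℝ) :
    IsTest fun v => ∑ j, A j * K (v + t j) :=
  IsTest.sum fun j => (hK.isTest.comp_add (t j)).mul_bdd (g := fun _ => A j) measurable_const
    (fun _ _ => le_rfl)

theorem IsKernel.memLp_comp_add (hK : IsKernel K) (t : ℝ) : MemLp (fun v => K (v + t)) 2 := by
  have hm : Measurable fun v => K (v + t) := by
    have := hK.measurable
    fun_prop
  rw [memLp_two_iff_integrable_sq hm.aestronglyMeasurable]
  exact hK.integrable_sq.comp_add_right t

theorem IsKernel.integrable_comb_sq (hK : IsKernel K) (A t : ι → ℝ) :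
    Integrable fun v => (∑ j, A j * K (v + t j)) ^ 2 :=
  (memLp_finsetSum Finset.univ fun j _ => (hK.memLp_comp_add (t j)).const_mul (A j)).integrable_sq

theorem eventually_abs_le_of_sq (hσx : ContinuousAt (fun y => σ y ^ 2) x) :
    ∀ᶠ y in 𝓝 x, |σ y| ≤ σ x ^ 2 + 2 := by
  filter_upwards [hσx.eventually_lt_const (lt_add_one (σ x ^ 2))] with y hy
  rw [← sq_abs] at hy
  nlinarith [sq_nonneg (|σ y| - 1)]

/-- The limit of the normalised conditional variance of a linear combination of local linear
estimators. -/
theorem LocalDesign.tendsto_condVar (H : LocalDesign P f X h x) (hK : IsKernel K)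
    (hσ : Measurable σ) (hσx : ContinuousAt (fun y => σ y ^ 2) x) (A t : ι → ℝ) :
    Tendsto (fun n : ℕ => ((n : ℝ) * h n) * ∫ ω, ∑ i ∈ Finset.range n,
      (combWt K A t X (h n) x n ω i * σ (X i ω)) ^ 2 ∂P) atTop
      (𝓝 (σ x ^ 2 / f x * ∫ v, (∑ j, A j * K (v + t j)) ^ 2)) := by
  have := H.isProbabilityMeasure
  have hXm := H.measurable_X
  have hf0 := H.pos_f
  have hκ : IsTest fun v => ∑ j, K (v + t j) := by simpa using hK.isTest_comb (fun _ => 1) t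
  have hκ2 : Integrable fun v => (∑ j, K (v + t j)) ^ 2 := by
    simpa using hK.integrable_comb_sq (fun _ => 1) t
  have hκ0 : ∀ v, 0 ≤ ∑ j, K (v + t j) := fun v => Finset.sum_nonneg fun j _ => hK.nonneg _
  have hk := hK.isTest_comb A t
  have hk2 := hK.integrable_comb_sq A t
  choose a c ha hc hbad using fun j => H.exists_goodDesign hK (t j) hκ hκ0 hκ2
  have hbm := fun j n =>
    (measurableSet_goodDesign (x := x) hK.measurable hXm (a j) (c j) (n * h n) (h n) (t j) n).compl
  have hκi := H.eventually_memLp_empAvg hκ hκ2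
  have hprob : ∀ j, Tendsto (fun n : ℕ => P.real {ω | ¬ GoodDesign K (a j) (c j) (n * h n) n
      (scaledDesign X (h n) x (t j) ω)}) atTop (𝓝 0) := by
    intro j
    refine tendsto_of_tendsto_of_tendsto_of_le_of_le' tendsto_const_nhds (hbad j)
      (Eventually.of_forall fun n => measureReal_nonneg) ?_
    filter_upwards [H.tendsto_nh.eventually_ge_atTop 1, hκi] with n hN hi
    have h1 : (1 : ℝ) ≤ ((n : ℝ) * h n) ^ 5 := one_le_pow₀ hN
    have hint : Integrable (fun ω => 1 + empAvg (fun v => ∑ j, K (v + t j)) (n * h n) n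
        (fun i => (x - X i ω) / h n) ^ 2) P := (integrable_const _).add hi.integrable_sq
    refine le_trans ?_ (le_mul_of_one_le_left (integral_nonneg fun ω => by positivity) h1)
    have hone := integral_indicator_one (μ := P) (hbm j n)
    rw [integral_indicator (hbm j n)] at hone
    refine hone.symm.le.trans (setIntegral_mono (integrable_const (1 : ℝ)).integrableOn
      hint.integrableOn fun ω => ?_)
    exact le_add_of_nonneg_right (sq_nonneg _)
  obtain ⟨B, hB, hpt⟩ := H.exists_condVar_sub_le hK hσx A (t := t) ha hc
  set Z : ℕ → Ω → ℝ := fun n => designErr K (f x) a c t X (h n) x n with hZ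
  have hZm : ∀ n, Measurable (Z n) := fun n => measurable_designErr hK.measurable hXm _ _ _ _ _ _
  have hZ0 : ∀ n ω, 0 ≤ Z n ω := fun n ω => designErr_nonneg n ω
  have hZ1 : ∀ n ω, Z n ω ≤ 1 := fun n ω => min_le_left _ _
  -- only `∫ K² < ∞` is available, so the error bound multiplies a kernel average that need not have
  -- a second moment; the product still tends to zero in mean because `Z ≤ 1`
  have hEZ := H.tendsto_mul_empAvg (hκ.sq hκ2) (fun v => sq_nonneg _) hZm hZ0 hZ1
    (H.tendsto_designErr hK hprob)
  have hEκ := H.tendsto_expectation (hκ.sq hκ2)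
  have hEk := H.tendsto_expectation (hk.sq hk2)
  set G := f x * ∫ v, (∑ j, K (v + t j)) ^ 2
  have hG : 0 ≤ G := mul_nonneg hf0.le (integral_nonneg fun v => sq_nonneg _)
  set D : ℕ → Ω → ℝ := fun n ω => ((n : ℝ) * h n) * ∑ i ∈ Finset.range n,
    (combWt K A t X (h n) x n ω i * σ (X i ω)) ^ 2 with hD
  set M : ℕ → Ω → ℝ := fun n ω => empAvg (fun v => (∑ j, A j * K (v + t j)) ^ 2) (n * h n) n
          (fun i => (x - X i ω) / h n) with hM
  set E : ℕ → Ω → ℝ := fun n ω => empAvg (fun v => (∑ j, K (v + t j)) ^ 2) (n * h n) n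
    (fun i => (x - X i ω) / h n) with hE
  have hσb := eventually_abs_le_of_sq hσx
  have hDi : ∀ᶠ n in atTop, Integrable (D n) P := by
    filter_upwards [H.eventually_memLp_combWt_mul hK hσ hσb A t] with n hn
    exact (integrable_finsetSum _ fun i hi => (hn i hi).integrable_sq).const_mul _
  have hdiff : Tendsto (fun n => (∫ ω, D n ω ∂P) - σ x ^ 2 / f x ^ 2 * ∫ ω, M n ω ∂P)
      atTop (𝓝 0) := by
    refine (isLittleO_one_iff ℝ).1 (isLittleO_iff.2 fun e he => ?_)
    -- chosen so that `B η (G + 1) ≤ e / 3`, where `G` is the limit of `∫ E n`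
    set η := min 1 (e / (3 * (B * (G + 1)))) with hη
    have hBG : 0 < B * (G + 1) := by positivity
    have hη0 : 0 < η := lt_min one_pos (by positivity)
    have hηe : B * η * (G + 1) ≤ e / 3 := by
      have h1 : η ≤ e / (3 * (B * (G + 1))) := min_le_right _ _
      rw [le_div_iff₀ (by positivity)] at h1
      linarith
    have l1 : Tendsto (fun n => B * ∫ ω, Z n ω * E n ω ∂P) atTop (𝓝 0) := by
      simpa using hEZ.const_mul B
    have l2 : Tendsto (fun n : ℕ => B * ∑ j, ((n : ℝ) * h n) ^ 5 *
        ∫ ω in {ω | ¬ GoodDesign K (a j) (c j) (n * h n) n (scaledDesign X (h n) x (t j) ω)},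
        (1 + empAvg (fun v => ∑ j, K (v + t j)) (n * h n) n (fun i => (x - X i ω) / h n) ^ 2) ∂P)
        atTop (𝓝 0) := by
      simpa using (tendsto_finsetSum Finset.univ fun j _ => hbad j).const_mul B
    filter_upwards [hpt η hη0 (min_le_left _ _), hDi, H.eventually_integrable_empAvg (hk.sq hk2),
      H.eventually_integrable_empAvg (hκ.sq hκ2), hκi,
      l1.eventually_le_const (by positivity : 0 < e / 3),
      l2.eventually_le_const (by positivity : 0 < e / 3),
      hEκ.eventually_le_const (lt_add_one G)] with n hn hDn hMn hEn hκn e1 e2 e3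
    have iZE : Integrable (fun ω => Z n ω * E n ω) P :=
      hEn.bdd_mul (hZm n).aestronglyMeasurable (Eventually.of_forall fun ω => by
        rw [Real.norm_eq_abs, abs_of_nonneg (hZ0 n ω)]; exact hZ1 n ω)
    have ib : Integrable (fun ω => 1 + empAvg (fun v => ∑ j, K (v + t j)) (n * h n) n
        (fun i => (x - X i ω) / h n) ^ 2) P := (integrable_const _).add hκn.integrable_sq
    set b : ι → Ω → ℝ := fun j => {ω | ¬ GoodDesign K (a j) (c j) (n * h n) n
      (scaledDesign X (h n) x (t j) ω)}.indicator (fun ω => 1 + empAvg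
        (fun v => ∑ j, K (v + t j)) (n * h n) n (fun i => (x - X i ω) / h n) ^ 2) with hb
    have ibj : ∀ j, Integrable (b j) P := fun j => ib.indicator (hbm j n)
    have ibs : Integrable (fun ω => B * ∑ j, ((n : ℝ) * h n) ^ 5 * b j ω) P :=
      (integrable_finsetSum _ fun j _ => (ibj j).const_mul _).const_mul _
    have i1 : Integrable (fun ω => B * (Z n ω * E n ω)) P := iZE.const_mul _
    have i2 : Integrable (fun ω => B * η * E n ω) P := hEn.const_mul _
    have i12 : Integrable (fun ω => B * (Z n ω * E n ω) + B * η * E n ω) P := i1.add i2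
    have hbI : ∀ j, ∫ ω, b j ω ∂P = ∫ ω in {ω | ¬ GoodDesign K (a j) (c j) (n * h n) n
        (scaledDesign X (h n) x (t j) ω)}, (1 + empAvg (fun v => ∑ j, K (v + t j)) (n * h n) n
        (fun i => (x - X i ω) / h n) ^ 2) ∂P := fun j => integral_indicator (hbm j n)
    have hMc : Integrable (fun ω => σ x ^ 2 / f x ^ 2 * M n ω) P := hMn.const_mul _
    rw [Real.norm_eq_abs, norm_one, mul_one, ← integral_const_mul, ← integral_sub hDn hMc]
    refine abs_integral_le_integral_abs.trans ?_
    calc _ ≤ ∫ ω, (B * (Z n ω * E n ω) + B * η * E n ω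
          + B * ∑ j, ((n : ℝ) * h n) ^ 5 * b j ω) ∂P :=
          integral_mono (hDn.sub hMc).abs (i12.add ibs) fun ω => hn ω
      _ = B * (∫ ω, Z n ω * E n ω ∂P) + B * η * (∫ ω, E n ω ∂P)
          + B * ∑ j, ((n : ℝ) * h n) ^ 5 * ∫ ω, b j ω ∂P := by
          rw [integral_add i12 ibs, integral_add i1 i2, integral_const_mul, integral_const_mul,
            integral_const_mul, integral_finsetSum _ fun j _ => (ibj j).const_mul _]
          simp only [integral_const_mul]
      _ ≤ e / 3 + B * η * (G + 1) + e / 3 := by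
          simp only [hbI]
          gcongr
      _ ≤ e := by linarith
  have hfin := hdiff.add (hEk.const_mul (σ x ^ 2 / f x ^ 2))
  have e1 : 0 + σ x ^ 2 / f x ^ 2 * (f x * ∫ v, (∑ j, A j * K (v + t j)) ^ 2)
      = σ x ^ 2 / f x * ∫ v, (∑ j, A j * K (v + t j)) ^ 2 := by
    field_simp
    ring
  rw [e1] at hfin
  refine hfin.congr fun n => ?_
  simp only [hD, hM, sub_add_cancel, integral_const_mul]

end

/-! ### Independence of design and errors -/

section

variable {Ω : Type*} [MeasurableSpace Ω] {P : Measure Ω} [IsProbabilityMeasure P]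
  {m σ f : ℝ → ℝ} {X ε Y : ℕ → Ω → ℝ}

omit [IsProbabilityMeasure P] in
theorem IsRegressionSample.iIndepFun_X (hd : IsRegressionSample P m σ f X ε Y) :
    iIndepFun X P :=
  hd.iIndep.comp (fun _ p => p.1) fun _ => measurable_fst

omit [IsProbabilityMeasure P] in
theorem IsRegressionSample.iIndepFun_eps (hd : IsRegressionSample P m σ f X ε Y) :
    iIndepFun ε P :=
  hd.iIndep.comp (fun _ p => p.2) fun _ => measurable_snd

/-- The vector of the first `n` design points is independent of the vector of the first `n`
errors. -/
theorem IsRegressionSample.indepFun_vec (hd : IsRegressionSample P m σ f X ε Y) (n : ℕ) :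
    IndepFun (fun ω (i : Fin n) => X i ω) (fun ω (i : Fin n) => ε i ω) P := by
  have hXm := hd.measurable_X
  have hεm := hd.measurable_eps
  have hi1 : iIndepFun (fun (i : Fin n) ω => (X i ω, ε i ω)) P :=
    hd.iIndep.precomp Fin.val_injective
  have hi2 : iIndepFun (fun (i : Fin n) ω => X i ω) P :=
    hd.iIndepFun_X.precomp Fin.val_injective
  have hi3 : iIndepFun (fun (i : Fin n) ω => ε i ω) P :=
    hd.iIndepFun_eps.precomp Fin.val_injective
  have h1 := hi1.map_fun_eq_pi_map fun i : Fin n => ((hXm i).prodMk (hεm i)).aemeasurable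
  have h2 := hi2.map_fun_eq_pi_map fun i : Fin n => (hXm i).aemeasurable
  have h3 := hi3.map_fun_eq_pi_map fun i : Fin n => (hεm i).aemeasurable
  have hpX : ∀ i, IsProbabilityMeasure (P.map (X i)) := fun i =>
    Measure.isProbabilityMeasure_map (hXm i).aemeasurable
  have hpε : ∀ i, IsProbabilityMeasure (P.map (ε i)) := fun i =>
    Measure.isProbabilityMeasure_map (hεm i).aemeasurable
  rw [indepFun_iff_map_prod_eq_prod_map_map (by fun_prop) (by fun_prop)]
  have hmp := measurePreserving_arrowProdEquivProdArrow ℝ ℝ (Fin n)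
    (fun i => P.map (X i)) (fun i => P.map (ε i))
  have hpair : ∀ i : Fin n, P.map (fun ω => (X i ω, ε i ω)) = (P.map (X i)).prod (P.map (ε i)) :=
    fun i => (indepFun_iff_map_prod_eq_prod_map_map (hXm i).aemeasurable
      (hεm i).aemeasurable).1 (hd.indep i)
  have h1' : P.map (fun ω (i : Fin n) => (X i ω, ε i ω))
      = Measure.pi fun i : Fin n => (P.map (X i)).prod (P.map (ε i)) := by
    rw [← funext hpair]
    exact h1
  have hvec : Measurable fun ω (i : Fin n) => (X i ω, ε i ω) :=
    measurable_pi_lambda _ fun i => (hXm i).prodMk (hεm i)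
  have h4 := hmp.map_eq
  rw [← h1', Measure.map_map hmp.measurable hvec] at h4
  rw [show P.map (fun ω (i : Fin n) => X i ω) = Measure.pi fun i : Fin n => P.map (X i) from h2,
    show P.map (fun ω (i : Fin n) => ε i ω) = Measure.pi fun i : Fin n => P.map (ε i) from h3, ← h4]
  rfl

/-- The statistics that depend on the design points `X 0, …, X (n - 1)` only. -/
def IsDesignStat (X : ℕ → Ω → ℝ) (n : ℕ) (G : Ω → ℝ) : Prop :=
  ∃ Φ : (Fin n → ℝ) → ℝ, Measurable Φ ∧ ∀ ω, G ω = Φ fun i => X i ω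

omit [MeasurableSpace Ω] in
theorem IsDesignStat.mul {n : ℕ} {G G' : Ω → ℝ} (hG : IsDesignStat X n G)
    (hG' : IsDesignStat X n G') : IsDesignStat X n fun ω => G ω * G' ω := by
  obtain ⟨Φ, hΦ, h⟩ := hG
  obtain ⟨Φ', hΦ', h'⟩ := hG'
  exact ⟨fun y => Φ y * Φ' y, hΦ.mul hΦ', fun ω => by simp only [h, h']⟩

omit [MeasurableSpace Ω] in
theorem IsDesignStat.sum {n : ℕ} {G : ℕ → Ω → ℝ} (s : Finset ℕ)
    (hG : ∀ i ∈ s, IsDesignStat X n (G i)) : IsDesignStat X n fun ω => ∑ i ∈ s, G i ω := by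
  classical
  choose! Φ hΦ h using hG
  refine ⟨fun y => ∑ i ∈ s, Φ i y, Finset.measurable_sum _ fun i hi => hΦ i hi, fun ω => ?_⟩
  exact Finset.sum_congr rfl fun i hi => h i hi ω

/-- Statistics of the design are independent of functions of the errors. -/
theorem IsRegressionSample.indepFun_stat (hd : IsRegressionSample P m σ f X ε Y) {n : ℕ}
    {G : Ω → ℝ} (hG : IsDesignStat X n G) {Ψ : (Fin n → ℝ) → ℝ} (hΨ : Measurable Ψ) :
    IndepFun G (fun ω => Ψ fun i => ε i ω) P := by
  obtain ⟨Φ, hΦ, h⟩ := hG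
  rw [show G = fun ω => Φ fun i => X i ω from funext h]
  exact (hd.indepFun_vec n).comp hΦ hΨ

theorem IsRegressionSample.integral_eps_mul_eps (hd : IsRegressionSample P m σ f X ε Y) (i j : ℕ) :
    ∫ ω, ε i ω * ε j ω ∂P = if i = j then 1 else 0 := by
  have hεm := hd.measurable_eps
  split_ifs with hij
  · subst hij
    have h1 := hd.variance_eps i
    rw [variance_eq_sub (hd.memLp_eps i), hd.mean_eps i] at h1
    simpa [sq] using h1
  · rw [(hd.iIndepFun_eps.indepFun hij).integral_fun_mul_eq_mul_integral
      (hεm i).aestronglyMeasurable (hεm j).aestronglyMeasurable, hd.mean_eps i, zero_mul]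

/-- The mean and the second moment of a linear form in the errors whose coefficients are statistics
of the design, and its orthogonality to statistics of the design. -/
theorem IsRegressionSample.noise (hd : IsRegressionSample P m σ f X ε Y) {n : ℕ}
    {G : ℕ → Ω → ℝ} (hG : ∀ i ∈ Finset.range n, IsDesignStat X n (G i))
    (hG2 : ∀ i ∈ Finset.range n, MemLp (G i) 2 P) {M : Ω → ℝ} (hM : IsDesignStat X n M)
    (hM2 : MemLp M 2 P) :
    MemLp (fun ω => ∑ i ∈ Finset.range n, G i ω * ε i ω) 2 P ∧
    ∫ ω, ∑ i ∈ Finset.range n, G i ω * ε i ω ∂P = 0 ∧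
    ∫ ω, M ω * ∑ i ∈ Finset.range n, G i ω * ε i ω ∂P = 0 ∧
    ∫ ω, (∑ i ∈ Finset.range n, G i ω * ε i ω) ^ 2 ∂P
      = ∫ ω, ∑ i ∈ Finset.range n, G i ω ^ 2 ∂P := by
  have hεm := hd.measurable_eps
  have hind : ∀ {F : Ω → ℝ}, IsDesignStat X n F → ∀ i ∈ Finset.range n, IndepFun F (ε i) P :=
    fun hF i hi => hd.indepFun_stat hF (Ψ := fun y => y ⟨i, Finset.mem_range.1 hi⟩) (by fun_prop)
  have hind2 : ∀ {F : Ω → ℝ}, IsDesignStat X n F → ∀ i ∈ Finset.range n, ∀ j ∈ Finset.range n,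
      IndepFun F (fun ω => ε i ω * ε j ω) P := fun hF i hi j hj => hd.indepFun_stat hF
      (Ψ := fun y => y ⟨i, Finset.mem_range.1 hi⟩ * y ⟨j, Finset.mem_range.1 hj⟩) (by fun_prop)
  have hterm : ∀ i ∈ Finset.range n, MemLp (fun ω => G i ω * ε i ω) 2 P := by
    intro i hi
    have hm : AEStronglyMeasurable (fun ω => G i ω * ε i ω) P :=
      (hG2 i hi).aestronglyMeasurable.mul (hεm i).aestronglyMeasurable
    rw [memLp_two_iff_integrable_sq hm]
    have h1 := (hind2 ((hG i hi).mul (hG i hi)) i hi i hi).integrable_mul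
      ((hG2 i hi).integrable_mul (hG2 i hi)) ((hd.memLp_eps i).integrable_mul (hd.memLp_eps i))
    refine h1.congr (Eventually.of_forall fun ω => ?_)
    simp only [Pi.mul_apply]
    ring
  have hzero : ∀ {F : Ω → ℝ}, IsDesignStat X n F → AEStronglyMeasurable F P →
      ∀ i ∈ Finset.range n, ∫ ω, F ω * ε i ω ∂P = 0 := fun hF hFm i hi => by
    rw [(hind hF i hi).integral_fun_mul_eq_mul_integral hFm (hεm i).aestronglyMeasurable,
      hd.mean_eps i, mul_zero]
  refine ⟨memLp_finsetSum _ hterm, ?_, ?_, ?_⟩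
  · rw [integral_finsetSum _ fun i hi => (hterm i hi).integrable (by norm_num)]
    exact Finset.sum_eq_zero fun i hi => hzero (hG i hi) (hG2 i hi).aestronglyMeasurable i hi
  · simp only [Finset.mul_sum]
    have hMt : ∀ i ∈ Finset.range n, Integrable (fun ω => M ω * (G i ω * ε i ω)) P :=
      fun i hi => hM2.integrable_mul (hterm i hi)
    rw [integral_finsetSum _ hMt]
    refine Finset.sum_eq_zero fun i hi => ?_
    simp only [← mul_assoc]
    exact hzero (hM.mul (hG i hi))
      (hM2.aestronglyMeasurable.mul (hG2 i hi).aestronglyMeasurable) i hi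
  · have hsq : ∀ ω, (∑ i ∈ Finset.range n, G i ω * ε i ω) ^ 2
        = ∑ i ∈ Finset.range n, ∑ j ∈ Finset.range n, (G i ω * ε i ω) * (G j ω * ε j ω) :=
      fun ω => by rw [sq, Finset.sum_mul_sum]
    simp only [hsq]
    have hij : ∀ i ∈ Finset.range n, ∀ j ∈ Finset.range n,
        Integrable (fun ω => (G i ω * ε i ω) * (G j ω * ε j ω)) P := fun i hi j hj =>
      (hterm i hi).integrable_mul (hterm j hj)
    rw [integral_finsetSum _ fun i hi => integrable_finsetSum _ fun j hj => hij i hi j hj,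
      integral_finsetSum _ fun i hi => (hG2 i hi).integrable_sq]
    refine Finset.sum_congr rfl fun i hi => ?_
    rw [integral_finsetSum _ fun j hj => hij i hi j hj]
    have hval : ∀ j ∈ Finset.range n, ∫ ω, (G i ω * ε i ω) * (G j ω * ε j ω) ∂P
        = if i = j then ∫ ω, G i ω ^ 2 ∂P else 0 := by
      intro j hj
      have h1 := (hind2 ((hG i hi).mul (hG j hj)) i hi j hj).integral_fun_mul_eq_mul_integral
        ((hG2 i hi).aestronglyMeasurable.mul (hG2 j hj).aestronglyMeasurable)
        ((hεm i).mul (hεm j)).aestronglyMeasurable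
      rw [hd.integral_eps_mul_eps] at h1
      have h2 : ∀ ω, (G i ω * ε i ω) * (G j ω * ε j ω) = G i ω * G j ω * (ε i ω * ε j ω) :=
        fun ω => by ring
      simp only [h2]
      rw [h1]
      split_ifs with hij
      · subst hij
        simp [sq]
      · rw [mul_zero]
    rw [Finset.sum_congr rfl hval, Finset.sum_ite_eq _ i (fun _ => ∫ ω, G i ω ^ 2 ∂P), if_pos hi]

end

/-! ### Linear combinations of local linear estimators -/

section

variable {Ω : Type*} [MeasurableSpace Ω] {P : Measure Ω} {m σ f K q : ℝ → ℝ} {X ε Y : ℕ → Ω → ℝ}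
  {h : ℕ → ℝ} {x : ℝ} {ι : Type*} [Fintype ι]

theorem continuousAt_of_abs_sub_le_rpow {c α : ℝ} (hα : 0 < α)
    (hf : ∀ᶠ y in 𝓝 x, |f x - f y| ≤ c * |x - y| ^ α) : ContinuousAt f x := by
  have h1 : Tendsto (fun y => c * |x - y| ^ α) (𝓝 x) (𝓝 0) := by
    have h2 : ContinuousAt (fun y => c * |x - y| ^ α) x :=
      continuousAt_const.mul ((by fun_prop : ContinuousAt (fun y => |x - y|) x).rpow_const
        (Or.inr hα.le))
    simpa [ContinuousAt, hα.ne'] using h2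
  rw [ContinuousAt, tendsto_iff_norm_sub_tendsto_zero]
  refine squeeze_zero' (Eventually.of_forall fun y => norm_nonneg _) ?_ h1
  filter_upwards [hf] with y hy
  rwa [Real.norm_eq_abs, abs_sub_comm]

theorem IsRegressionSample.localDesign (hd : IsRegressionSample P m σ f X ε Y) (hf : Measurable f)
    (hf0 : ∀ y, 0 ≤ f y) (hfc : ContinuousAt f x) (hfx : 0 < f x) (hpos : ∀ n, 0 < h n)
    (h0 : Tendsto h atTop (𝓝 0)) (hnh : Tendsto (fun n : ℕ => (n : ℝ) * h n) atTop atTop) :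
    LocalDesign P f X h x :=
  ⟨hd.measurable_X, hd.iIndepFun_X, hd.law_X, hf, hf0, hfc, hfx, hpos, h0, hnh⟩

theorem locMom_congr {N : ℝ} {n : ℕ} {u u' : ℕ → ℝ} (hu : ∀ i < n, u i = u' i) (l : ℕ) :
    locMom K N n u l = locMom K N n u' l := by
  unfold locMom
  congr 1
  exact Finset.sum_congr rfl fun i hi => by rw [hu i (Finset.mem_range.1 hi)]

theorem locWt_congr {N : ℝ} {n : ℕ} {u u' : ℕ → ℝ} (hu : ∀ i < n, u i = u' i) {i : ℕ}
    (hi : i < n) : locWt K N n u i = locWt K N n u' i := by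
  simp only [locWt, locDen, locMom_congr hu, hu i hi]

omit [MeasurableSpace Ω] in
theorem isDesignStat_combWt_mul (hK : Measurable K) (hq : Measurable q) (A t : ι → ℝ) (h : ℝ)
    {n i : ℕ} (hi : i < n) :
    IsDesignStat X n fun ω => combWt K A t X h x n ω i * q (X i ω) := by
  -- the first `n` design points as functions on the sample space `ℝⁿ`
  set X' : ℕ → (Fin n → ℝ) → ℝ := fun k y => if hk : k < n then y ⟨k, hk⟩ else 0 with hX'
  have hXm : ∀ k, Measurable (X' k) := fun k => by
    by_cases hk : k < n
    · simp only [hX', hk, dif_pos]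
      fun_prop
    · simp only [hX', hk, dif_neg, not_false_eq_true]
      fun_prop
  refine ⟨fun y => combWt K A t X' h x n y i * q (X' i y),
    (measurable_combWt hK hXm A t h n i).mul (hq.comp (hXm i)), fun ω => ?_⟩
  have hX : ∀ k < n, X k ω = X' k fun j => X j ω := fun k hk => by simp [hX', hk]
  simp only [combWt, hX i hi]
  congr 1
  refine Finset.sum_congr rfl fun j _ => ?_
  rw [locWt_congr (fun k hk => ?_) hi]
  rw [scaledDesign, scaledDesign, hX k hk]

/-- A linear combination of local linear estimators splits into its conditional mean given the
design and a linear form in the errors. -/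
theorem IsRegressionSample.sum_mhat_eq (hd : IsRegressionSample P m σ f X ε Y) (A t : ι → ℝ)
    {h : ℝ} (hh : 0 < h) {n : ℕ} (hn : 0 < n) (ω : Ω) :
    ∑ j, A j * mhat K h n (X · ω) (Y · ω) (x + h * t j)
      = ∑ i ∈ Finset.range n, combWt K A t X h x n ω i * m (X i ω)
        + ∑ i ∈ Finset.range n, combWt K A t X h x n ω i * σ (X i ω) * ε i ω := by
  have e : ∀ j, mhat K h n (X · ω) (Y · ω) (x + h * t j) = ∑ i ∈ Finset.range n,
      locWt K (n * h) n (scaledDesign X h x (t j) ω) i * Y i ω := fun j => by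
    rw [mhat_eq_sum_locWt hh hn]
    have : (fun i => (x + h * t j - X i ω) / h) = scaledDesign X h x (t j) ω := by
      funext i
      rw [scaledDesign]
      field_simp
      ring
    rw [this]
  simp only [e, Finset.mul_sum]
  rw [Finset.sum_comm, ← Finset.sum_add_distrib]
  refine Finset.sum_congr rfl fun i _ => ?_
  simp only [hd.model, combWt, Finset.sum_mul]
  rw [← Finset.sum_add_distrib]
  exact Finset.sum_congr rfl fun j _ => by ring

omit [MeasurableSpace Ω] in
/-- The deviation of the conditional mean of a linear combination from the corresponding combination
of two-term expansions. -/
theorem sum_combWt_mul_eq (A t : ι → ℝ) (h : ℝ) (n : ℕ) (ω : Ω) :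
    ∑ i ∈ Finset.range n, combWt K A t X h x n ω i * m (X i ω)
      = ∑ j, A j * (m x + deriv m x * (h * t j)
          + 1 / 2 * deriv (deriv m) x * h ^ 2 * (t j ^ 2 + ∫ v, v ^ 2 * K v))
        + ∑ j, A j * condErr K m X h x (t j) n ω := by
  rw [← Finset.sum_add_distrib]
  simp only [combWt, Finset.sum_mul]
  rw [Finset.sum_comm]
  refine Finset.sum_congr rfl fun j _ => ?_
  rw [condErr, ← mul_add, add_sub_cancel, Finset.mul_sum]
  exact Finset.sum_congr rfl fun i _ => by ring

/-- The mean square bound for the conditional bias extends to linear combinations. -/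
theorem LocalDesign.sum_condErr (H : LocalDesign P f X h x) (hK : IsKernel K)
    (hm : Measurable m) (hm1 : ∀ᶠ y in 𝓝 x, DifferentiableAt ℝ m y)
    (hm2 : DifferentiableAt ℝ (deriv m) x) (A t : ι → ℝ) :
    (∀ᶠ n : ℕ in atTop, MemLp (fun ω => ∑ j, A j * condErr K m X (h n) x (t j) n ω) 2 P) ∧
    (fun n : ℕ => ∫ ω, (∑ j, A j * condErr K m X (h n) x (t j) n ω) ^ 2 ∂P)
      =o[atTop] fun n : ℕ => h n ^ 4 + ((n : ℝ) * h n)⁻¹ := by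
  have hb := fun j => H.conditional_bias hK hm hm1 hm2 (t j)
  have hL := eventually_all.2 fun j => (hb j).1
  refine ⟨?_, ?_⟩
  · filter_upwards [hL] with n hn
    exact memLp_finsetSum _ fun j _ => (hn j).const_mul (A j)
  · have h1 : (fun n : ℕ => (∑ j, A j ^ 2) * ∑ j, ∫ ω, condErr K m X (h n) x (t j) n ω ^ 2 ∂P)
        =o[atTop] fun n : ℕ => h n ^ 4 + ((n : ℝ) * h n)⁻¹ := by
      have h0 := IsLittleO.sum (s := Finset.univ) fun j _ => (hb j).2
      simp only [Finset.sum_fn] at h0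
      exact h0.const_mul_left _
    refine (IsBigO.of_bound 1 ?_).trans_isLittleO h1
    filter_upwards [hL] with n hn
    have hi : ∀ j, Integrable (fun ω => condErr K m X (h n) x (t j) n ω ^ 2) P :=
      fun j => (hn j).integrable_sq
    have h2 : ∫ ω, (∑ j, A j * condErr K m X (h n) x (t j) n ω) ^ 2 ∂P
        ≤ (∑ j, A j ^ 2) * ∑ j, ∫ ω, condErr K m X (h n) x (t j) n ω ^ 2 ∂P := by
      rw [← integral_finsetSum _ fun j _ => hi j, ← integral_const_mul]
      refine integral_mono_of_nonneg (Eventually.of_forall fun ω => sq_nonneg _)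
        ((integrable_finsetSum _ fun j _ => hi j).const_mul _)
        (Eventually.of_forall fun ω => ?_)
      exact Finset.sum_mul_sq_le_sq_mul_sq _ _ _
    have h3 : 0 ≤ ∫ ω, (∑ j, A j * condErr K m X (h n) x (t j) n ω) ^ 2 ∂P :=
      integral_nonneg fun ω => sq_nonneg _
    rw [one_mul, Real.norm_of_nonneg h3, Real.norm_of_nonneg (h3.trans h2)]
    exact h2

/-- Mean and variance of an orthogonal sum of a nearly constant variable and a centred one. -/
theorem mean_variance_bounds [IsProbabilityMeasure P] {Z D V : Ω → ℝ} {c : ℝ}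
    (hZ : ∀ ω, Z ω = c + D ω + V ω) (hD : MemLp D 2 P) (hV : MemLp V 2 P)
    (hV0 : ∫ ω, V ω ∂P = 0) (hDV : ∫ ω, (c + D ω) * V ω ∂P = 0) :
    |∫ ω, Z ω ∂P - c| ≤ √(∫ ω, D ω ^ 2 ∂P) ∧
      |variance Z P - ∫ ω, V ω ^ 2 ∂P| ≤ ∫ ω, D ω ^ 2 ∂P := by
  have hc : MemLp (fun ω => c + D ω) 2 P := (memLp_const c).add hD
  have hZf : Z = fun ω => c + D ω + V ω := funext hZ
  have iD : Integrable D P := hD.integrable (by norm_num)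
  have iV : Integrable V P := hV.integrable (by norm_num)
  have ic : Integrable (fun ω => c + D ω) P := hc.integrable (by norm_num)
  have hZ2 : MemLp Z 2 P := hZf ▸ hc.add hV
  have e1 : ∫ ω, Z ω ∂P = c + ∫ ω, D ω ∂P := by
    simp only [hZ]
    rw [integral_add ic iV, integral_add (integrable_const c) iD, hV0]
    simp
  have hvar : variance D P = ∫ ω, D ω ^ 2 ∂P - (∫ ω, D ω ∂P) ^ 2 := variance_eq_sub hD
  have hvar0 := variance_nonneg D P
  have e2 : variance Z P = variance D P + ∫ ω, V ω ^ 2 ∂P := by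
    have h1 : variance Z P = ∫ ω, Z ω ^ 2 ∂P - (∫ ω, Z ω ∂P) ^ 2 := variance_eq_sub hZ2
    have h2 : ∀ ω, Z ω ^ 2 = (c + D ω) ^ 2 + 2 * ((c + D ω) * V ω) + V ω ^ 2 := fun ω => by
      rw [hZ]; ring
    have i1 : Integrable (fun ω => (c + D ω) ^ 2) P := hc.integrable_sq
    have i2 : Integrable (fun ω => 2 * ((c + D ω) * V ω)) P := (hc.integrable_mul hV).const_mul 2
    have i12 : Integrable (fun ω => (c + D ω) ^ 2 + 2 * ((c + D ω) * V ω)) P := i1.add i2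
    have h3 : ∫ ω, (c + D ω) ^ 2 ∂P = c ^ 2 + 2 * c * ∫ ω, D ω ∂P + ∫ ω, D ω ^ 2 ∂P := by
      have i3 : Integrable (fun ω => 2 * c * D ω) P := iD.const_mul _
      have i4 : Integrable (fun ω => c ^ 2 + 2 * c * D ω) P := (integrable_const _).add i3
      have h4 : ∀ ω, (c + D ω) ^ 2 = c ^ 2 + 2 * c * D ω + D ω ^ 2 := fun ω => by ring
      simp only [h4]
      rw [integral_add i4 hD.integrable_sq, integral_add (integrable_const _) i3,
        integral_const_mul]
      simp
    rw [h1, e1, hvar]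
    simp only [h2]
    rw [integral_add i12 hV.integrable_sq, integral_add i1 i2, integral_const_mul, hDV, h3]
    ring
  refine ⟨?_, ?_⟩
  · rw [e1, add_sub_cancel_left]
    refine Real.abs_le_sqrt ?_
    linarith
  · rw [e2, add_sub_cancel_right, abs_of_nonneg hvar0, hvar]
    linarith [sq_nonneg (∫ ω, D ω ∂P)]

/-- A mean square error of order `o(h⁴ + N⁻¹)` is a root mean square error of order
`o(h² + N^{-1/2})`. -/
theorem sqrt_isLittleO {u h N : ℕ → ℝ} (hh : ∀ n, 0 < h n) (hN : ∀ᶠ n in atTop, 0 < N n)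
    (hu : u =o[atTop] fun n => h n ^ 4 + (N n)⁻¹) :
    (fun n => √(u n)) =o[atTop] fun n => h n ^ 2 + N n ^ (-(1 / 2) : ℝ) := by
  refine IsLittleO.of_bound fun e he => ?_
  filter_upwards [hN, hu.def (sq_pos_of_pos he)] with n hn h1
  set s := N n ^ (-(1 / 2) : ℝ) with hs
  have hs0 : 0 < s := Real.rpow_pos_of_pos hn _
  have hs2 : s ^ 2 = (N n)⁻¹ := by
    rw [hs, ← Real.rpow_natCast, ← Real.rpow_mul hn.le, ← Real.rpow_neg_one]
    norm_num
  have hh0 := hh n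
  have h2 : 0 < h n ^ 4 + (N n)⁻¹ := by positivity
  have h3 : 0 < h n ^ 2 + s := by positivity
  rw [Real.norm_of_nonneg (Real.sqrt_nonneg _), Real.norm_of_nonneg h3.le]
  refine Real.sqrt_le_iff.2 ⟨by positivity, ?_⟩
  rw [Real.norm_of_nonneg h2.le] at h1
  calc u n ≤ e ^ 2 * (h n ^ 4 + (N n)⁻¹) := (le_abs_self _).trans h1
    _ ≤ (e * (h n ^ 2 + s)) ^ 2 := by
        rw [mul_pow, ← hs2]
        refine mul_le_mul_of_nonneg_left ?_ (by positivity)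
        nlinarith [mul_pos (sq_pos_of_pos hh0) hs0]

/-- Square integrability, bias and variance of a linear combination of local linear estimators at
the points `x + h t_j`. -/
theorem IsRegressionSample.sum_mhat_asymptotics [IsProbabilityMeasure P]
    (hd : IsRegressionSample P m σ f X ε Y) (H : LocalDesign P f X h x) (hK : IsKernel K)
    (hm : Measurable m) (hσ : Measurable σ) (hm1 : ∀ᶠ y in 𝓝 x, DifferentiableAt ℝ m y)
    (hm2 : DifferentiableAt ℝ (deriv m) x) (hσx : ContinuousAt (fun y => σ y ^ 2) x)
    (A t : ι → ℝ) :
    (∀ᶠ n : ℕ in atTop, MemLp (fun ω =>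
      ∑ j, A j * mhat K (h n) n (X · ω) (Y · ω) (x + h n * t j)) 2 P) ∧
    (fun n : ℕ => ∫ ω, ∑ j, A j * mhat K (h n) n (X · ω) (Y · ω) (x + h n * t j) ∂P
        - ∑ j, A j * (m x + deriv m x * (h n * t j)
          + 1 / 2 * deriv (deriv m) x * h n ^ 2 * (t j ^ 2 + ∫ v, v ^ 2 * K v)))
      =o[atTop] (fun n : ℕ => h n ^ 2 + ((n : ℝ) * h n) ^ (-(1 / 2) : ℝ)) ∧
    (fun n : ℕ => variance (fun ω =>
          ∑ j, A j * mhat K (h n) n (X · ω) (Y · ω) (x + h n * t j)) P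
        - σ x ^ 2 / ((n : ℝ) * h n * f x) * ∫ v, (∑ j, A j * K (v + t j)) ^ 2)
      =o[atTop] fun n : ℕ => h n ^ 4 + ((n : ℝ) * h n)⁻¹ := by
  have hσb := eventually_abs_le_of_sq hσx
  have hmb : ∀ᶠ y in 𝓝 x, |m y| ≤ |m x| + 1 :=
    hm1.self_of_nhds.continuousAt.abs.eventually_le_const (lt_add_one |m x|)
  obtain ⟨hDL, hDo⟩ := H.sum_condErr hK hm hm1 hm2 A t
  -- `Z = c + D + V`: target, error of the conditional mean, linear form in the errors
  set D : ℕ → Ω → ℝ := fun n ω => ∑ j, A j * condErr K m X (h n) x (t j) n ω with hDdef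
  set V : ℕ → Ω → ℝ := fun n ω => ∑ i ∈ Finset.range n,
    combWt K A t X (h n) x n ω i * σ (X i ω) * ε i ω with hVdef
  set c : ℕ → ℝ := fun n => ∑ j, A j * (m x + deriv m x * (h n * t j)
    + 1 / 2 * deriv (deriv m) x * h n ^ 2 * (t j ^ 2 + ∫ v, v ^ 2 * K v)) with hcdef
  set Z : ℕ → Ω → ℝ := fun n ω =>
    ∑ j, A j * mhat K (h n) n (X · ω) (Y · ω) (x + h n * t j) with hZdef
  have hNpos : ∀ᶠ n : ℕ in atTop, 0 < (n : ℝ) * h n := H.tendsto_nh.eventually_gt_atTop 0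
  have key : ∀ᶠ n : ℕ in atTop, (∀ ω, Z n ω = c n + D n ω + V n ω) ∧ MemLp (V n) 2 P ∧
      ∫ ω, V n ω ∂P = 0 ∧ ∫ ω, (c n + D n ω) * V n ω ∂P = 0 ∧
      ∫ ω, V n ω ^ 2 ∂P
        = ∫ ω, ∑ i ∈ Finset.range n, (combWt K A t X (h n) x n ω i * σ (X i ω)) ^ 2 ∂P := by
    filter_upwards [eventually_gt_atTop 0, hDL, H.eventually_memLp_combWt_mul hK hσ hσb A t,
      H.eventually_memLp_combWt_mul hK hm hmb A t] with n hn hDn hσn hmn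
    have hM : ∀ ω, ∑ i ∈ Finset.range n, combWt K A t X (h n) x n ω i * m (X i ω)
        = c n + D n ω := fun ω => sum_combWt_mul_eq A t (h n) n ω
    have hst : IsDesignStat X n fun ω => c n + D n ω := by
      simp only [← hM]
      exact IsDesignStat.sum _ fun i hi =>
        isDesignStat_combWt_mul hK.measurable hm A t (h n) (Finset.mem_range.1 hi)
    have hns := hd.noise (G := fun i ω => combWt K A t X (h n) x n ω i * σ (X i ω))
      (fun i hi => isDesignStat_combWt_mul hK.measurable hσ A t (h n) (Finset.mem_range.1 hi))
      hσn hst ((memLp_const (c n)).add hDn)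
    exact ⟨fun ω => by rw [← hM]; exact hd.sum_mhat_eq A t (H.pos_h n) hn ω, hns⟩
  have hb : ∀ᶠ n : ℕ in atTop, |∫ ω, Z n ω ∂P - c n| ≤ √(∫ ω, D n ω ^ 2 ∂P) ∧
      |variance (Z n) P - ∫ ω, ∑ i ∈ Finset.range n,
        (combWt K A t X (h n) x n ω i * σ (X i ω)) ^ 2 ∂P| ≤ ∫ ω, D n ω ^ 2 ∂P := by
    filter_upwards [key, hDL] with n ⟨hZ, hV, hV0, hDV, hV2⟩ hDn
    rw [← hV2]
    exact mean_variance_bounds hZ hDn hV hV0 hDV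
  refine ⟨?_, ?_, ?_⟩
  · filter_upwards [key, hDL] with n ⟨hZ, hV, _⟩ hDn
    have e : Z n = fun ω => c n + D n ω + V n ω := funext hZ
    change MemLp (Z n) 2 P
    rw [e]
    exact ((memLp_const (c n)).add hDn).add hV
  · refine (IsBigO.of_bound 1 ?_).trans_isLittleO (sqrt_isLittleO H.pos_h hNpos hDo)
    filter_upwards [hb] with n hn
    rw [one_mul, Real.norm_of_nonneg (Real.sqrt_nonneg _)]
    exact hn.1
  · set I := ∫ v, (∑ j, A j * K (v + t j)) ^ 2 with hI
    set W : ℕ → ℝ := fun n => ∫ ω, ∑ i ∈ Finset.range n,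
      (combWt K A t X (h n) x n ω i * σ (X i ω)) ^ 2 ∂P with hW
    have hlim : Tendsto (fun n : ℕ => ((n : ℝ) * h n) * W n) atTop (𝓝 (σ x ^ 2 / f x * I)) :=
      H.tendsto_condVar hK hσ hσx A t
    have h1 : (fun n : ℕ => variance (Z n) P - W n)
        =o[atTop] fun n : ℕ => h n ^ 4 + ((n : ℝ) * h n)⁻¹ := by
      refine (IsBigO.of_bound 1 ?_).trans_isLittleO hDo
      filter_upwards [hb] with n hn
      rw [one_mul, Real.norm_of_nonneg (integral_nonneg fun ω => sq_nonneg _)]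
      exact hn.2
    have h2 : (fun n : ℕ => W n - σ x ^ 2 / ((n : ℝ) * h n * f x) * I)
        =o[atTop] fun n : ℕ => h n ^ 4 + ((n : ℝ) * h n)⁻¹ := by
      refine IsLittleO.of_bound fun e he => ?_
      filter_upwards [hNpos, (Metric.tendsto_nhds.1 hlim) e he] with n hN hn
      have hh0 := H.pos_h n
      have hf0 := H.pos_f
      have e1 : W n - σ x ^ 2 / ((n : ℝ) * h n * f x) * I
          = ((n : ℝ) * h n)⁻¹ * ((n : ℝ) * h n * W n - σ x ^ 2 / f x * I) := by
        rw [mul_sub, inv_mul_cancel_left₀ hN.ne']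
        field_simp
      rw [Real.dist_eq] at hn
      have hi : 0 < ((n : ℝ) * h n)⁻¹ := inv_pos.2 hN
      have hs : ((n : ℝ) * h n)⁻¹ ≤ h n ^ 4 + ((n : ℝ) * h n)⁻¹ :=
        le_add_of_nonneg_left (by positivity)
      rw [e1, norm_mul, Real.norm_of_nonneg hi.le, Real.norm_of_nonneg (hi.le.trans hs),
        Real.norm_eq_abs, mul_comm e]
      exact mul_le_mul hs hn.le (abs_nonneg _) (hi.le.trans hs)
    exact (h1.add h2).congr_left fun n => sub_add_sub_cancel _ _ _

end

/-! ### The interpolation constants -/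

section

variable {K : ℝ → ℝ}

/-- The integral of a product of two translates depends only on the difference of the shifts. -/
theorem integral_mul_shift (K : ℝ → ℝ) (a b c : ℝ) :
    ∫ s, K (s + a) * K (s + b) = ∫ s, K (s + (a + c)) * K (s + (b + c)) := by
  rw [← integral_add_right_eq_self (fun s => K (s + a) * K (s + b)) c]
  simp only [add_assoc, add_comm c]

theorem IsKernel.nuTilde_two (hK : IsKernel K) (r δ : ℝ) :
    nuTilde K r δ 2 = nu K 0 2 - r ^ 2 * (1 - r ^ 2) * C K δ := by
  have hi : ∀ a b : ℝ, Integrable fun s => K (s + a) * K (s + b) := fun a b =>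
    (hK.memLp_comp_add a).integrable_mul (hK.memLp_comp_add b)
  have hnu : ∀ a, ∫ s, K (s + a) * K (s + a) = nu K 0 2 := fun a => by
    rw [integral_mul_shift K a a (-a)]
    simp [nu, sq]
  have hc0 : C₂ K 0 δ = nu K 0 2 := by simp [C₂, nu, sq]
  have hc : ∀ a b c : ℝ, c * δ * 2 = b - a → ∫ s, K (s + a) * K (s + b) = C₂ K c δ := by
    intro a b c habc
    rw [integral_mul_shift K a b (-(a + b) / 2), C₂]
    have e1 : a + -(a + b) / 2 = -(c * δ) := by linarith
    have e2 : b + -(a + b) / 2 = c * δ := by linarith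
    simp only [e1, e2, sub_eq_add_neg]
  have h01 : ∫ s, K (s + 0) * K (s + δ) = C₂ K (1 / 2) δ := hc _ _ _ (by ring)
  have h12 : ∫ s, K (s + δ) * K (s + 2 * δ) = C₂ K (1 / 2) δ := hc _ _ _ (by ring)
  have h02 : ∫ s, K (s + 0) * K (s + 2 * δ) = C₂ K 1 δ := hc _ _ _ (by ring)
  -- expand the square into the nine products of translates
  set t : Fin 3 → ℝ := ![0, δ, 2 * δ] with ht
  have hexp : nuTilde K r δ 2 = ∑ i, ∑ j, A r i * A r j * ∫ s, K (s + t i) * K (s + t j) := by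
    have e : ∀ s : ℝ, (∑ i : Fin 3, A r i * K (s + (i : ℕ) * δ)) ^ 2
        = ∑ i, ∑ j, A r i * A r j * (K (s + t i) * K (s + t j)) := fun s => by
      simp [Fin.sum_univ_three, ht]
      ring
    rw [nuTilde]
    simp only [e]
    rw [integral_finsetSum _ fun i _ => integrable_finsetSum _ fun j _ => (hi _ _).const_mul _]
    refine Finset.sum_congr rfl fun i _ => ?_
    rw [integral_finsetSum _ fun j _ => (hi _ _).const_mul _]
    simp only [integral_const_mul]
  have hsymm : ∀ a b : ℝ, ∫ s, K (s + a) * K (s + b) = ∫ s, K (s + b) * K (s + a) :=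
    fun a b => by simp only [mul_comm]
  rw [hexp]
  simp only [Fin.sum_univ_three, ht, Matrix.cons_val_zero, Matrix.cons_val_one, Matrix.cons_val,
    hsymm δ 0, hsymm (2 * δ) 0, hsymm (2 * δ) δ, h01, h12, h02, hnu, A, C, hc0]
  ring

/-- The positions, in units of the bandwidth and relative to `x`, of the points between which the
variance reduced estimator interpolates. -/
def node (r δ : ℝ) (j : Fin 3) : ℝ := ((j : ℕ) - 1 - r) * δ

theorem mtilde_eq (h : ℝ) (n : ℕ) (X Y : ℕ → ℝ) (r δ x : ℝ) :
    mtilde K h n X Y r δ x = ∑ j, A r j * mhat K h n X Y (x + h * node r δ j) := by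
  refine Finset.sum_congr rfl fun j _ => ?_
  rw [node]
  congr 2
  ring

theorem integral_node_sq (K : ℝ → ℝ) (r δ : ℝ) :
    ∫ v, (∑ j, A r j * K (v + node r δ j)) ^ 2 = nuTilde K r δ 2 := by
  rw [← integral_add_right_eq_self _ ((1 + r) * δ), nuTilde]
  refine integral_congr_ae (Eventually.of_forall fun v => ?_)
  simp only [node]
  congr 1
  refine Finset.sum_congr rfl fun j _ => ?_
  congr 2
  ring

/-- Quadratic interpolation reproduces the expansion at `x`: the coefficients sum to one and
annihilate the first two powers of the nodes. -/
theorem sum_node_expansion (r δ a b c ν h : ℝ) :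
    ∑ j, A r j * (a + b * (h * node r δ j) + c * h ^ 2 * (node r δ j ^ 2 + ν))
      = a + c * ν * h ^ 2 := by
  simp [Fin.sum_univ_three, A, node]
  ring

end

end LocalLinear

theorem theorem1 {Ω : Type*} [MeasurableSpace Ω] (P : Measure Ω) [IsProbabilityMeasure P]
    (m σ f K : ℝ → ℝ) (X ε Y : ℕ → Ω → ℝ) (h : ℕ → ℝ) (x r δ : ℝ)
    (hm : Measurable m) (hσ : Measurable σ) (hf : Measurable f) (hf0 : ∀ y, 0 ≤ f y)
    -- the data
    (hdata : LocalLinear.IsRegressionSample P m σ f X ε Y)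
    -- the kernel
    (hK : LocalLinear.IsKernel K)
    -- `m''` exists near `x` and is continuous at `x` (hence bounded near `x`)
    (hm1 : ∀ᶠ y in 𝓝 x, DifferentiableAt ℝ m y)
    (hm2 : ∀ᶠ y in 𝓝 x, DifferentiableAt ℝ (deriv m) y)
    (hm3 : ContinuousAt (deriv (deriv m)) x)
    -- the design density is positive and Hölder at `x`
    (hfx : 0 < f x)
    (hfH : ∃ c α : ℝ, 0 < α ∧ α < 1 ∧ ∀ᶠ y in 𝓝 x, |f x - f y| ≤ c * |x - y| ^ α)
    -- `σ²` is continuous at `x` (hence bounded near `x`)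
    (hσx : ContinuousAt (fun y => σ y ^ 2) x)
    -- the interpolation parameters and the bandwidths
    (hr : r ∈ Set.Ioo (-1 : ℝ) 1) (hδ : 0 < δ)
    (hpos : ∀ n, 0 < h n) (h0 : Tendsto h atTop (𝓝 0))
    (hnh : Tendsto (fun n : ℕ => (n : ℝ) * h n) atTop atTop) :
    -- for large `n` the estimators have finite second moments
    (∀ᶠ n : ℕ in atTop,
      MemLp (fun ω => LocalLinear.mhat K (h n) n (X · ω) (Y · ω) x) 2 P ∧
      MemLp (fun ω => LocalLinear.mtilde K (h n) n (X · ω) (Y · ω) r δ x) 2 P) ∧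
    -- asymptotic bias of `m̃_q(x)`
    (fun n : ℕ =>
        (∫ ω, LocalLinear.mtilde K (h n) n (X · ω) (Y · ω) r δ x ∂P) - m x
          - 1 / 2 * deriv (deriv m) x * LocalLinear.nu K 2 1 * h n ^ 2)
      =o[atTop] (fun n : ℕ => h n ^ 2 + ((n : ℝ) * h n) ^ (-(1 / 2) : ℝ)) ∧
    -- it is the same as the asymptotic bias of `m̂(x)`
    (fun n : ℕ =>
        (∫ ω, LocalLinear.mhat K (h n) n (X · ω) (Y · ω) x ∂P) - m x
          - 1 / 2 * deriv (deriv m) x * LocalLinear.nu K 2 1 * h n ^ 2)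
      =o[atTop] (fun n : ℕ => h n ^ 2 + ((n : ℝ) * h n) ^ (-(1 / 2) : ℝ)) ∧
    -- asymptotic variance of `m̃_q(x)`
    (fun n : ℕ =>
        variance (fun ω => LocalLinear.mtilde K (h n) n (X · ω) (Y · ω) r δ x) P
          - σ x ^ 2 / ((n : ℝ) * h n * f x) * LocalLinear.nuTilde K r δ 2)
      =o[atTop] (fun n : ℕ => h n ^ 4 + ((n : ℝ) * h n)⁻¹) ∧
    -- the constant in the asymptotic variance
    LocalLinear.nuTilde K r δ 2
      = LocalLinear.nu K 0 2 - r ^ 2 * (1 - r ^ 2) * LocalLinear.C K δ := by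
  obtain ⟨c, α, hα, -, hH⟩ := hfH
  have H : LocalLinear.LocalDesign P f X h x := hdata.localDesign hf hf0
    (LocalLinear.continuousAt_of_abs_sub_le_rpow hα hH) hfx hpos h0 hnh
  have hnu : ∫ v, v ^ 2 * K v = LocalLinear.nu K 2 1 := by simp [LocalLinear.nu]
  obtain ⟨hL, hB, hV⟩ := hdata.sum_mhat_asymptotics H hK hm hσ hm1 hm2.self_of_nhds hσx
    (LocalLinear.A r) (LocalLinear.node r δ)
  -- the plain estimator is the linear combination with a single node at `x`
  obtain ⟨hL1, hB1, -⟩ := hdata.sum_mhat_asymptotics H hK hm hσ hm1 hm2.self_of_nhds hσx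
    (fun _ : Unit => 1) (fun _ => 0)
  simp only [← LocalLinear.mtilde_eq, LocalLinear.sum_node_expansion, hnu,
    LocalLinear.integral_node_sq] at hL hB hV
  simp only [Finset.univ_unique, Finset.sum_const, Finset.card_singleton, one_smul, one_mul,
    mul_zero, add_zero, hnu] at hL1 hB1
  refine ⟨hL1.and hL, hB.congr_left fun n => by ring, hB1.congr_left fun n => by ring, hV,
    hK.nuTilde_two r δ⟩
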